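/- **Routing Plan.** An instance consists of a finite set $A$ of assets, a finite simple undirected graph $G=(V,E)$, distinct vertices $s,t\in V$, a set of traps $R\subseteq V\setminus\{s,t\}$, a reload time $c(r)\in\{1,2,\dots\}$ for each $r\in R$, and a goal $k\in\{1,\dots,|A|\}$. Instances are encoded as binary words in which $A$ and $V$ are given by listing their elements (so $|A|$ and $|V|$ are at most the length of the encoding), $G$ by its adjacency matrix, and reload times in binary. A plan is a map $\rho\colon A\times\mathbb{N}_0\to V\cup\{\dagger\}$, where $\dagger\notin V$ is the location of eliminated assets. A trap $r\in R$ is *triggered* at time $j$ if $\rho(a,j)=r$ for some $a\in A$ and $r$ is active at time $j$; here $r$ is *active* at time $j$ unless it was triggered at one of the times $j-c(r),\dots,j-1$ (so all traps are active initially). The plan $\rho$ is *valid* if 1. $\rho(a,0)=s$ for all $a\in A$, and $\rho(a,j)=s$ implies $\rho(a,j-1)=s$ for all $j>0$; 2. $\rho(a,j)\in\{t,\dagger\}$ implies $\rho(a,j+1)=\rho(a,j)$; 3. for $j\geq 1$, if $\rho(a,j)\neq\dagger$, then $\rho(a,j)$ is adjacent or equal to $\rho(a,j-1)$; 4. if $a\neq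 a'$ and $\rho(a,j)=\rho(a',j)$, then $\rho(a,j)\in\{s,t,\dagger\}$; 5. if $\rho(a,j)=r\in R$ and $r$ is triggered at time $j$, then $\rho(a,j+1)=\dagger$; 6. for every $j\ge 1$, if $\rho(a,j)\notin\{t,\dagger\}$ for some $a\in A$, then $\rho(a',j)\neq\rho(a',j+1)$ for some $a'\in A$; 7. there is an integer $\ell\geq 1$, the length of $\rho$, such that $\rho(a,\ell)\in\{t,\dagger\}$ for all $a\in A$ and $\rho(a,\ell-1)\notin\{t,\dagger\}$ for some $a\in A$. The problem *Routing Plan* asks whether there is a valid plan $\rho$ with at least $k$ surviving assets, i.e. assets $a$ with $\rho(a,\ell)=t$, where $\ell$ is the length of $\rho$. **Theorem.** Routing Plan is in NP: there are a polynomial $p$ and a polynomial-time Turing machine $V$ such that a binary word $x$ encodes a yes-instance if and only if there is a binary word $w$ with $|w|\leq p(|x|)$ such that $V$ accepts $(x,w)$. The same holds if it is moreover required of the plan that assets are eliminated by active traps only, i.e. that $\rho(a,j)\neq\dagger=\rho(a,j+1)$ implies that $\rho(a,j)$ is a trap that is triggered at time $j$. -/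

import Mathlib

noncomputable section

/-- The word over `{0, 1, #}` that presents a pair of binary words `(x, w)` to a machine:
`x`, then the separator `#` (here `none`), then `w`. -/
def encodePair (p : List Bool × List Bool) : List (Option Bool) :=
  p.1.map some ++ none :: p.2.map some

/-- The complexity class NP, as a class of languages of binary words: `L` is in NP if there are a
polynomial `p` and a verifier `V`, computable by a Turing machine in time polynomial in the length
of its input, such that `x ∈ L` exactly if `V` accepts `(x, w)` for some certificate `w` of length
at most `p |x|`. -/
def NP : Set (Language Bool) :=
  {L | ∃ (p : Polynomial ℕ) (V : List Bool × List Bool → Bool),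
    Nonempty (Turing.TM2ComputableInPolyTime encodePair Computability.encodeBool V) ∧
    ∀ x : List Bool, x ∈ L ↔ ∃ w : List Bool, w.length ≤ p.eval x.length ∧ V (x, w) = true}

/-- An instance `(G, s, t, R, c, A, k)` of Routing Plan. The vertices of the topology `G` are
`0, …, n - 1` and the assets are `0, …, m - 1`. -/
structure RoutingInstance where
  /-- number of vertices -/
  n : ℕ
  /-- number of assets -/
  m : ℕ
  /-- the topology -/
  G : SimpleGraph (Fin n)
  /-- initial vertex -/
  s : Fin n
  /-- target vertex -/
  t : Fin n
  s_ne_t : s ≠ t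
  /-- locations protected by traps -/
  R : Finset (Fin n)
  s_notMem : s ∉ R
  t_notMem : t ∉ R
  /-- reload times -/
  c : R → ℕ
  c_pos : ∀ r, 1 ≤ c r
  /-- the goal -/
  k : ℕ
  k_pos : 1 ≤ k
  k_le : k ≤ m

namespace RoutingInstance

variable (I : RoutingInstance)

/-- A location is a vertex or the special location `†` of the eliminated assets (`none`). -/
abbrev Location := Option (Fin I.n)

/-- A movement plan gives the location of every asset at every timestep. -/
abbrev Plan := Fin I.m → ℕ → I.Location

variable {I}

/-- The trap `r` is triggered at time `j`: some asset is on `r` at time `j`, and `r` is active at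
that time. A trap is active at time `j` unless it was triggered at one of the times
`j - c r, …, j - 1`; in particular, every trap is active at time `0`. -/
def Triggered (ρ : I.Plan) (r : I.R) (j : ℕ) : Prop :=
  (∃ a, ρ a j = some r.1) ∧ ∀ i : ℕ, i < j → j ≤ i + I.c r → ¬ Triggered ρ r i
termination_by j

/-- Asset `a` has reached the target or has been eliminated by time `j`. -/
def Finished (ρ : I.Plan) (a : Fin I.m) (j : ℕ) : Prop :=
  ρ a j = some I.t ∨ ρ a j = none

/-- The plan `ρ` ends at time `ℓ`, i.e. has length `ℓ`. -/
def HasLength (ρ : I.Plan) (ℓ : ℕ) : Prop :=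
  1 ≤ ℓ ∧ (∀ a, Finished ρ a ℓ) ∧ ∃ a, ¬ Finished ρ a (ℓ - 1)

/-- Valid plans. -/
structure Valid (ρ : I.Plan) : Prop where
  /-- every asset starts at `s` -/
  start : ∀ a, ρ a 0 = some I.s
  /-- no asset returns to `s` after leaving it -/
  no_return : ∀ a j, ρ a (j + 1) = some I.s → ρ a j = some I.s
  /-- no asset leaves `t` or `†` -/
  stay : ∀ a j, Finished ρ a j → ρ a (j + 1) = ρ a j
  /-- assets move along edges or stay put, unless they get eliminated -/
  move : ∀ a j v, ρ a (j + 1) = some v → ∃ u, ρ a j = some u ∧ (I.G.Adj u v ∨ u = v)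
  /-- no two assets are on the same vertex, other than `s` and `t`, at the same time -/
  collision_free : ∀ a a', a ≠ a' → ∀ j, ρ a j = ρ a' j →
    ρ a j = some I.s ∨ ρ a j = some I.t ∨ ρ a j = none
  /-- an asset on an active trap is eliminated -/
  trap : ∀ a j (r : I.R), ρ a j = some r.1 → Triggered ρ r j → ρ a (j + 1) = none
  /-- some asset moves in each round as long as some asset remains -/
  progress : ∀ j, 1 ≤ j → (∃ a, ¬ Finished ρ a j) → ∃ a, ρ a j ≠ ρ a (j + 1)
  /-- all assets finish in finite time -/
  finite : ∃ ℓ, HasLength ρ ℓ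

/-- Assets are eliminated by active traps only. -/
def EliminatedByTraps (ρ : I.Plan) : Prop :=
  ∀ a j, ρ a j ≠ none → ρ a (j + 1) = none →
    ∃ r : I.R, ρ a j = some r.1 ∧ Triggered ρ r j

/-- At least `k` assets survive in the plan `ρ`, i.e. are at `t` when the plan ends. -/
def Achieves (ρ : I.Plan) (k : ℕ) : Prop :=
  ∃ ℓ, HasLength ρ ℓ ∧ k ≤ Nat.card {a // ρ a ℓ = some I.t}

variable (I)

/-- `I` is a yes-instance of Routing Plan. -/
def IsYes : Prop :=
  ∃ ρ : I.Plan, Valid ρ ∧ Achieves ρ I.k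

/-- `I` has a solution in which, moreover, assets are eliminated by active traps only. -/
def IsYesTrapsOnly : Prop :=
  ∃ ρ : I.Plan, Valid ρ ∧ EliminatedByTraps ρ ∧ Achieves ρ I.k

/-- Self-delimiting unary code. -/
def encodeUnary (x : ℕ) : List Bool := List.replicate x true ++ [false]

/-- Self-delimiting binary code: each binary digit (least significant first) is preceded by `1`,
and the end is marked by `0`. -/
def encodeBinary (x : ℕ) : List Bool := (Nat.bits x).flatMap (fun b => [true, b]) ++ [false]

open scoped Classical in
/-- The binary word that encodes an instance: the numbers of vertices and assets in unary (both
are sets, given by listing their elements), then `k`, `s`, `t` in binary, the adjacency matrix of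
`G` row by row, and for each vertex a bit telling whether it is in `R`, followed by its reload time
in binary if it is. -/
def encode : List Bool :=
  encodeUnary I.n ++ encodeUnary I.m ++ encodeBinary I.k ++ encodeBinary I.s ++ encodeBinary I.t ++
  (List.finRange I.n).flatMap (fun u => (List.finRange I.n).map fun v => decide (I.G.Adj u v)) ++
  (List.finRange I.n).flatMap (fun v =>
    if h : v ∈ I.R then true :: encodeBinary (I.c ⟨v, h⟩) else [false])

end RoutingInstance

/-- The decision problem Routing Plan: the language of all encodings of yes-instances. -/
def RoutingPlan : Language Bool :=
  {x | ∃ I : RoutingInstance, I.encode = x ∧ I.IsYes}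

/-- Routing Plan with plans in which assets are eliminated by active traps only. -/
def RoutingPlanTrapsOnly : Language Bool :=
  {x | ∃ I : RoutingInstance, I.encode = x ∧ I.IsYesTrapsOnly}

end

/-! A plan need not have polynomial length: reload times are written in binary, and it can pay to
wait exponentially long for clocks to run down while some asset keeps moving. The certificate is
therefore a compressed plan: a list of polynomially many snapshots, where consecutive ones are
joined by a macro step. A macro step is either one timestep, or an odd number `N` of timesteps
during which the assets oscillate between two positions while nothing is triggered. It can be
checked without unrolling, using binary arithmetic on the clocks.

Plans are the same as walks in the graph of states, a state being the positions of the assets and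
the remaining reload times (`exists_walk_of_plan`, `exists_plan_of_walk`). Along a walk, a potential
bounded by `6 * m + n` never decreases: an asset passes through the phases "at `s`", "on the way",
"on an active trap", "at `t` or eliminated" in this order, and each deactivation of a trap is paid
for by an asset that is eliminated there (`Step.potential_le`). Hence all but at most `6 * m + n`
timesteps are quiet. In a quiet stretch no trap changes between active and inactive, clocks just run
down, and assets move only between free vertices (`Chain.quiet`).

Survivors are only counted, so the assets are interchangeable, and a quiet stretch is a sequence of
moves of indistinguishable tokens on the free part of the graph. Token moves are reversible, and two
reachable configurations are at most `n ^ 2` moves apart. In a symmetric relation every walk can be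
replaced by a short one whose length has the same parity (`Chain.exists_short`). So keep the first
move of the stretch, repeat it back and forth to use up the surplus time, which parity makes an odd
number of timesteps, and then make the few remaining moves. The total duration and thus all clocks
are preserved (`Chain.exists_bMacro_of_quiet`). Together with the loud timesteps this yields
polynomially many macro steps (`exists_short_walk`).

That the verifier runs in polynomial time on a Turing machine is proved from scratch. Structured
stack programs compile to `TM2` machines, data are binary trees in Polish notation on a stack, and
the class `PTime` of functions computed by such programs is closed under the usual list operations,
most of which reduce to size-bounded folds (`PTime.foldl`). The predicate is registered with
`fun_prop`. The verifier never parses the instance: the certificate contains the decoded data, which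
are encoded again and compared with the input. -/

noncomputable section

/-! ### Structured stack programs and their compilation to `TM2` machines. -/

namespace StackProg

open Turing Turing.TM2 Function

variable {K : Type} [DecidableEq K] {Γ : K → Type} {σ : Type}

/-- Structured programs that work on finitely many stacks and a register. -/
inductive Prog (Γ : K → Type) (σ : Type) : Type
  | push (k : K) (f : σ → Γ k) : Prog Γ σ
  | pop (k : K) (f : σ → Option (Γ k) → σ) : Prog Γ σ
  | load (f : σ → σ) : Prog Γ σ
  | seq (p q : Prog Γ σ) : Prog Γ σ
  | ite (c : σ → Bool) (p q : Prog Γ σ) : Prog Γ σ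
  | loop (c : σ → Bool) (p : Prog Γ σ) : Prog Γ σ

namespace Prog

/-- `Exec p v S v' S' n`: started with register `v` and stacks `S`, the program `p` halts after
`n` steps with register `v'` and stacks `S'`. -/
inductive Exec : Prog Γ σ → σ → (∀ k, List (Γ k)) → σ → (∀ k, List (Γ k)) → ℕ → Prop
  | push {k f v S} : Exec (push k f) v S v (update S k (f v :: S k)) 1
  | pop {k f v S} : Exec (pop k f) v S (f v (S k).head?) (update S k (S k).tail) 1
  | load {f v S} : Exec (load f) v S (f v) S 1
  | seq {p q v S v' S' v'' S'' n n'} : Exec p v S v' S' n → Exec q v' S' v'' S'' n' →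
      Exec (seq p q) v S v'' S'' (n + n')
  | ite_true {c p q v S v' S' n} : c v = true → Exec p v S v' S' n →
      Exec (ite c p q) v S v' S' (n + 1)
  | ite_false {c p q v S v' S' n} : c v = false → Exec q v S v' S' n →
      Exec (ite c p q) v S v' S' (n + 1)
  | loop_false {c p v S} : c v = false → Exec (loop c p) v S v S 1
  | loop_true {c p v S v' S' v'' S'' n n'} : c v = true → Exec p v S v' S' n →
      Exec (loop c p) v' S' v'' S'' n' → Exec (loop c p) v S v'' S'' (n + n' + 1)

/-- The labels of the machine that executes a program. -/
def Lab : Prog Γ σ → Type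
  | push _ _ => Unit
  | pop _ _ => Unit
  | load _ => Unit
  | seq p q => Lab p ⊕ Lab q
  | ite _ p q => Option (Lab p ⊕ Lab q)
  | loop _ p => Option (Lab p)

instance Lab.instFintype : (p : Prog Γ σ) → Fintype (Lab p)
  | push _ _ => inferInstanceAs (Fintype Unit)
  | pop _ _ => inferInstanceAs (Fintype Unit)
  | load _ => inferInstanceAs (Fintype Unit)
  | seq p q =>
    have := Lab.instFintype p
    have := Lab.instFintype q
    inferInstanceAs (Fintype (Lab p ⊕ Lab q))
  | ite _ p q =>
    have := Lab.instFintype p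
    have := Lab.instFintype q
    inferInstanceAs (Fintype (Option (Lab p ⊕ Lab q)))
  | loop _ p =>
    have := Lab.instFintype p
    inferInstanceAs (Fintype (Option (Lab p)))

/-- The label at which the execution of a program starts. -/
def entry : (p : Prog Γ σ) → Lab p
  | push _ _ => ()
  | pop _ _ => ()
  | load _ => ()
  | seq p _ => Sum.inl (entry p)
  | ite _ _ _ => none
  | loop _ _ => none

/-- The statements of the machine that executes a program, where `emb` embeds the labels of the
program into those of the machine and `ex` is the statement to execute at the end. -/
def code {Λ : Type} : (p : Prog Γ σ) → (Lab p → Λ) → Stmt Γ Λ σ → Lab p → Stmt Γ Λ σ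
  | push k f, _, ex, _ => .push k f ex
  | pop k f, _, ex, _ => .pop k f ex
  | load f, _, ex, _ => .load f ex
  | seq p q, emb, _, Sum.inl l =>
    code p (fun l => emb (Sum.inl l)) (.goto fun _ => emb (Sum.inr (entry q))) l
  | seq _ q, emb, ex, Sum.inr l => code q (fun l => emb (Sum.inr l)) ex l
  | ite c p q, emb, _, none =>
    .branch c (.goto fun _ => emb (some (Sum.inl (entry p))))
      (.goto fun _ => emb (some (Sum.inr (entry q))))
  | ite _ p _, emb, ex, some (Sum.inl l) => code p (fun l => emb (some (Sum.inl l))) ex l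
  | ite _ _ q, emb, ex, some (Sum.inr l) => code q (fun l => emb (some (Sum.inr l))) ex l
  | loop c p, emb, ex, none => .branch c (.goto fun _ => emb (some (entry p))) ex
  | loop _ p, emb, _, some l => code p (fun l => emb (some l)) (.goto fun _ => emb none) l

/-- `n` steps of the machine `M` lead from `c` to `c'`. -/
def Steps {Λ : Type} (M : Λ → Stmt Γ Λ σ) (c c' : Cfg Γ Λ σ) (n : ℕ) : Prop :=
  (flip bind (step M))^[n] (some c) = some c'

theorem Steps.trans {Λ : Type} {M : Λ → Stmt Γ Λ σ} {c₁ c₂ c₃ : Cfg Γ Λ σ} {n n' : ℕ}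
    (h : Steps M c₁ c₂ n) (h' : Steps M c₂ c₃ n') : Steps M c₁ c₃ (n + n') := by
  unfold Steps at *
  rw [add_comm, iterate_add_apply, h, h']

theorem Steps.of_eq {Λ : Type} {M : Λ → Stmt Γ Λ σ} {l : Λ} {q : Stmt Γ Λ σ} {v : σ}
    {S : ∀ k, List (Γ k)} {c : Cfg Γ Λ σ} (h : M l = q) (hc : stepAux q v S = c) :
    Steps M ⟨some l, v, S⟩ c 1 := by
  subst h hc
  rfl

/-- Every elementary command and every evaluation of a test is one labelled statement, so the step
counts agree exactly. The exit statement `ex` is run within the last step rather than in one of its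
own; it has to vary in the induction because subprograms exit into their surroundings. -/
theorem Exec.steps {p : Prog Γ σ} {v v' : σ} {S S' : ∀ k, List (Γ k)} {n : ℕ}
    (h : Exec p v S v' S' n) {Λ : Type} (M : Λ → Stmt Γ Λ σ) (emb : Lab p → Λ)
    (ex : Stmt Γ Λ σ) (hM : ∀ l, M (emb l) = code p emb ex l) :
    Steps M ⟨some (emb (entry p)), v, S⟩ (stepAux ex v' S') n := by
  induction h generalizing ex with
  | push => exact Steps.of_eq (hM ()) rfl
  | pop => exact Steps.of_eq (hM ()) rfl
  | load => exact Steps.of_eq (hM ()) rfl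
  | seq _ _ ih ih' =>
    exact (ih (fun l => emb (Sum.inl l)) _ fun l => hM (Sum.inl l)).trans
      (ih' (fun l => emb (Sum.inr l)) _ fun l => hM (Sum.inr l))
  | @ite_true c p q v S v' S' n hc _ ih =>
    rw [add_comm]
    exact (Steps.of_eq (hM none) (by simp only [code, stepAux, hc, cond_true])).trans
      (ih (fun l => emb (some (Sum.inl l))) _ fun l => hM (some (Sum.inl l)))
  | @ite_false c p q v S v' S' n hc _ ih =>
    rw [add_comm]
    exact (Steps.of_eq (hM none) (by simp only [code, stepAux, hc, cond_false])).trans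
      (ih (fun l => emb (some (Sum.inr l))) _ fun l => hM (some (Sum.inr l)))
  | @loop_false c p v S hc =>
    exact Steps.of_eq (hM none) (by simp only [code, stepAux, hc, cond_false])
  | @loop_true c p v S v' S' v'' S'' n n' hc _ _ ih ih' =>
    rw [show n + n' + 1 = 1 + n + n' by ring]
    exact ((Steps.of_eq (hM none) (by simp only [code, stepAux, hc, cond_true])).trans
      (ih (fun l => emb (some l)) _ fun l => hM (some l))).trans (ih' emb ex hM)

/-- `p` runs from `(v, S)` to `(v', S')` in at most `N` steps. -/
def Runs (p : Prog Γ σ) (v : σ) (S : ∀ k, List (Γ k)) (v' : σ) (S' : ∀ k, List (Γ k))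
    (N : ℕ) : Prop :=
  ∃ n ≤ N, Exec p v S v' S' n

theorem Runs.mono {p : Prog Γ σ} {v v' : σ} {S S' : ∀ k, List (Γ k)} {N N' : ℕ}
    (h : Runs p v S v' S' N) (hN : N ≤ N') : Runs p v S v' S' N' :=
  let ⟨n, hn, h⟩ := h
  ⟨n, hn.trans hN, h⟩

theorem Runs.push {k : K} {f : σ → Γ k} {v : σ} {S S' : ∀ k, List (Γ k)}
    (h : update S k (f v :: S k) = S') : Runs (push k f) v S v S' 1 :=
  ⟨1, le_rfl, h ▸ .push⟩

theorem Runs.pop {k : K} {f : σ → Option (Γ k) → σ} {v v' : σ} {S S' : ∀ k, List (Γ k)}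
    (h : f v (S k).head? = v') (h' : update S k (S k).tail = S') : Runs (pop k f) v S v' S' 1 :=
  ⟨1, le_rfl, h ▸ h' ▸ .pop⟩

theorem Runs.load {f : σ → σ} {v : σ} {S : ∀ k, List (Γ k)} : Runs (load f) v S (f v) S 1 :=
  ⟨1, le_rfl, .load⟩

theorem Runs.seq {p q : Prog Γ σ} {v v' v'' : σ} {S S' S'' : ∀ k, List (Γ k)} {N N' : ℕ}
    (h : Runs p v S v' S' N) (h' : Runs q v' S' v'' S'' N') :
    Runs (seq p q) v S v'' S'' (N + N') :=
  let ⟨n, hn, h⟩ := h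
  let ⟨n', hn', h'⟩ := h'
  ⟨n + n', add_le_add hn hn', .seq h h'⟩

theorem Runs.ite_true {c : σ → Bool} {p q : Prog Γ σ} {v v' : σ} {S S' : ∀ k, List (Γ k)} {N : ℕ}
    (hc : c v = true) (h : Runs p v S v' S' N) : Runs (ite c p q) v S v' S' (N + 1) :=
  let ⟨n, hn, h⟩ := h
  ⟨n + 1, by omega, .ite_true hc h⟩

theorem Runs.ite_false {c : σ → Bool} {p q : Prog Γ σ} {v v' : σ} {S S' : ∀ k, List (Γ k)} {N : ℕ}
    (hc : c v = false) (h : Runs q v S v' S' N) : Runs (ite c p q) v S v' S' (N + 1) :=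
  let ⟨n, hn, h⟩ := h
  ⟨n + 1, by omega, .ite_false hc h⟩

theorem Runs.loop_false {c : σ → Bool} {p : Prog Γ σ} {v : σ} {S : ∀ k, List (Γ k)}
    (hc : c v = false) : Runs (loop c p) v S v S 1 :=
  ⟨1, le_rfl, .loop_false hc⟩

theorem Runs.loop_true {c : σ → Bool} {p : Prog Γ σ} {v v' v'' : σ} {S S' S'' : ∀ k, List (Γ k)}
    {N N' : ℕ} (hc : c v = true) (h : Runs p v S v' S' N) (h' : Runs (loop c p) v' S' v'' S'' N') :
    Runs (loop c p) v S v'' S'' (N + N' + 1) :=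
  let ⟨n, hn, h⟩ := h
  let ⟨n', hn', h'⟩ := h'
  ⟨n + n' + 1, by omega, .loop_true hc h h'⟩

end Prog
end StackProg
end

/-! ### Binary trees in Polish notation and stack routines on them. -/

noncomputable section

/-- Binary trees, used as a universal data type. -/
inductive Sexp : Type
  | nil : Sexp
  | cons (a b : Sexp) : Sexp
  deriving DecidableEq

namespace Sexp

/-- The Polish notation of a tree. -/
def enc : Sexp → List Bool
  | nil => [false]
  | cons a b => true :: (enc a ++ enc b)

/-- The length of the Polish notation of a tree. -/
def size : Sexp → ℕ
  | nil => 1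
  | cons a b => size a + size b + 1

@[simp] theorem length_enc (d : Sexp) : (enc d).length = size d := by
  induction d with
  | nil => rfl
  | cons a b iha ihb => simp [enc, size, iha, ihb]

theorem size_pos (d : Sexp) : 1 ≤ size d := by cases d <;> simp [size]

/-- The first component of a pair. -/
def hd : Sexp → Sexp
  | nil => nil
  | cons a _ => a

/-- The second component of a pair. -/
def tl : Sexp → Sexp
  | nil => nil
  | cons _ b => b

theorem size_hd_le (d : Sexp) : size (hd d) ≤ size d := by cases d <;> simp [hd, size]; omega

theorem size_tl_le (d : Sexp) : size (tl d) ≤ size d := by cases d <;> simp [tl, size]; omega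

/-- Polish notation is self-delimiting, which is why several trees can share one stack. -/
theorem enc_append_inj {a b : Sexp} {r r' : List Bool} (h : enc a ++ r = enc b ++ r') :
    a = b ∧ r = r' := by
  induction a generalizing b r r' with
  | nil => cases b <;> simp_all [enc]
  | cons a₁ a₂ ih₁ ih₂ =>
    cases b with
    | nil => simp [enc] at h
    | cons b₁ b₂ =>
      simp only [enc, List.cons_append, List.cons.injEq, true_and, List.append_assoc] at h
      obtain ⟨rfl, h'⟩ := ih₁ h
      obtain ⟨rfl, rfl⟩ := ih₂ h'
      simp

theorem enc_injective : Function.Injective enc := fun a b h =>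
  (enc_append_inj (r := []) (r' := []) (by rw [h])).1

end Sexp

namespace StackProg

open Function Prog

/-- The stacks of the machines that work on trees: the input, the main stack, three auxiliary
stacks, and the output. -/
inductive Stk : Type
  | inp | main | t | u | cnt | out
  deriving DecidableEq

instance : Fintype Stk where
  elems := {.inp, .main, .t, .u, .cnt, .out}
  complete k := by cases k <;> simp

/-- The alphabets of the stacks. -/
abbrev Sym : Stk → Type
  | .inp => Option Bool
  | .main => Bool
  | .t => Bool
  | .u => Bool
  | .cnt => Bool
  | .out => Bool

/-- The registers: two symbols and one input symbol. -/
abbrev Reg : Type := Option Bool × Option Bool × Option (Option Bool)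

/-- The stacks with given contents. -/
def stk (i : List (Option Bool)) (m t u c o : List Bool) : ∀ k, List (Sym k)
  | .inp => i
  | .main => m
  | .t => t
  | .u => u
  | .cnt => c
  | .out => o

section update

variable (i i' : List (Option Bool)) (m t u c o l : List Bool)

@[simp] theorem stk_inp : stk i m t u c o .inp = i := rfl
@[simp] theorem stk_main : stk i m t u c o .main = m := rfl
@[simp] theorem stk_t : stk i m t u c o .t = t := rfl
@[simp] theorem stk_u : stk i m t u c o .u = u := rfl
@[simp] theorem stk_cnt : stk i m t u c o .cnt = c := rfl
@[simp] theorem stk_out : stk i m t u c o .out = o := rfl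

@[simp] theorem update_stk_inp : update (stk i m t u c o) .inp i' = stk i' m t u c o := by
  funext k; cases k <;> rfl
@[simp] theorem update_stk_main : update (stk i m t u c o) .main l = stk i l t u c o := by
  funext k; cases k <;> rfl
@[simp] theorem update_stk_t : update (stk i m t u c o) .t l = stk i m l u c o := by
  funext k; cases k <;> rfl
@[simp] theorem update_stk_u : update (stk i m t u c o) .u l = stk i m t l c o := by
  funext k; cases k <;> rfl
@[simp] theorem update_stk_cnt : update (stk i m t u c o) .cnt l = stk i m t u l o := by
  funext k; cases k <;> rfl
@[simp] theorem update_stk_out : update (stk i m t u c o) .out l = stk i m t u c l := by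
  funext k; cases k <;> rfl

end update

abbrev TProg : Type := Prog Sym Reg

def skip : TProg := load id

theorem runs_skip (v : Reg) (S : ∀ k, List (Sym k)) : Runs skip v S v S 1 := Runs.load

def popMain : TProg := pop .main fun v x => (x, v.2)
def popT : TProg := pop .t fun v x => (x, v.2)
def popU : TProg := pop .u fun v x => (x, v.2)
def popU' : TProg := pop .u fun v x => (v.1, x, v.2.2)
def popCnt : TProg := pop .cnt fun v x => (x, v.2)
def pushMain : TProg := push .main fun v => v.1.getD false
def pushT : TProg := push .t fun v => v.1.getD false
def pushU : TProg := push .u fun v => v.1.getD false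
def pushCnt : TProg := push .cnt fun _ => true

/-- Pop symbols with `pp` and store them with `ps` until no symbol is left. -/
def drain (pp ps : TProg) : TProg := seq pp (loop (fun v => v.1.isSome) (seq ps pp))

/-- `F l acc` gives the stacks when `l` is still to be popped and `acc` has been stored, so that one
statement covers pouring, copying and clearing. -/
theorem runs_drain {pp ps : TProg} {F : List Bool → List Bool → ∀ k, List (Sym k)} {N : ℕ}
    (hpp : ∀ l acc v, Runs pp v (F l acc) (l.head?, v.2) (F l.tail acc) 1)
    (hps : ∀ x l acc (v : Reg), v.1 = some x → Runs ps v (F l acc) v (F l (x :: acc)) N)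
    (l acc : List Bool) (v : Reg) :
    ∃ v', Runs (drain pp ps) v (F l acc) v' (F [] (l.reverse ++ acc)) ((N + 2) * l.length + 2) := by
  refine ⟨(none, v.2), Runs.mono (Runs.seq (hpp l acc v) (N' := (N + 2) * l.length + 1) ?_)
    (by omega)⟩
  obtain ⟨v₁, v₂⟩ := v
  simp only
  clear v₁
  induction l generalizing acc with
  | nil => exact Runs.loop_false rfl
  | cons x l ih =>
    have h1 := Runs.loop_true (c := fun v : Reg => v.1.isSome) (v := (some x, v₂)) rfl
      (Runs.seq (hps x l acc _ rfl) (hpp l _ _)) (ih (x :: acc))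
    simp only [List.reverse_cons, List.append_assoc, List.cons_append, List.nil_append,
      List.head?_cons, List.tail_cons, List.length_cons]
    refine h1.mono ?_
    ring_nf
    omega

theorem runs_popMain (m t u c : List Bool) (v : Reg) :
    Runs popMain v (stk [] m t u c []) (m.head?, v.2) (stk [] m.tail t u c []) 1 :=
  Runs.pop rfl (by simp)

theorem runs_popT (m t u c : List Bool) (v : Reg) :
    Runs popT v (stk [] m t u c []) (t.head?, v.2) (stk [] m t.tail u c []) 1 :=
  Runs.pop rfl (by simp)

theorem runs_popU (m t u c : List Bool) (v : Reg) :
    Runs popU v (stk [] m t u c []) (u.head?, v.2) (stk [] m t u.tail c []) 1 :=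
  Runs.pop rfl (by simp)

theorem runs_popCnt (m t u c : List Bool) (v : Reg) :
    Runs popCnt v (stk [] m t u c []) (c.head?, v.2) (stk [] m t u c.tail []) 1 :=
  Runs.pop rfl (by simp)

theorem runs_pushMain {x : Bool} (m t u c : List Bool) (v : Reg) (hv : v.1 = some x) :
    Runs pushMain v (stk [] m t u c []) v (stk [] (x :: m) t u c []) 1 :=
  Runs.push (by simp [hv])

theorem runs_pushT {x : Bool} (m t u c : List Bool) (v : Reg) (hv : v.1 = some x) :
    Runs pushT v (stk [] m t u c []) v (stk [] m (x :: t) u c []) 1 :=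
  Runs.push (by simp [hv])

theorem runs_pushU {x : Bool} (m t u c : List Bool) (v : Reg) (hv : v.1 = some x) :
    Runs pushU v (stk [] m t u c []) v (stk [] m t (x :: u) c []) 1 :=
  Runs.push (by simp [hv])

theorem runs_pourT (m t u c : List Bool) (v : Reg) :
    ∃ v', Runs (drain popT pushMain) v (stk [] m t u c []) v'
      (stk [] (t.reverse ++ m) [] u c []) (3 * t.length + 2) :=
  runs_drain (F := fun l acc => stk [] acc l u c []) (fun l acc v => runs_popT acc l u c v)
    (fun _ l acc v hv => runs_pushMain acc l u c v hv) t m v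

theorem runs_pourU (m t u c : List Bool) (v : Reg) :
    ∃ v', Runs (drain popU pushMain) v (stk [] m t u c []) v'
      (stk [] (u.reverse ++ m) t [] c []) (3 * u.length + 2) :=
  runs_drain (F := fun l acc => stk [] acc t l c []) (fun l acc v => runs_popU acc t l c v)
    (fun _ l acc v hv => runs_pushMain acc t l c v hv) u m v

theorem runs_pourUT (m t u c : List Bool) (v : Reg) :
    ∃ v', Runs (drain popU pushT) v (stk [] m t u c []) v'
      (stk [] m (u.reverse ++ t) [] c []) (3 * u.length + 2) :=
  runs_drain (F := fun l acc => stk [] m acc l c []) (fun l acc v => runs_popU m acc l c v)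
    (fun _ l acc v hv => runs_pushT m acc l c v hv) u t v

theorem runs_clearT (m t u c : List Bool) (v : Reg) :
    ∃ v', Runs (drain popT skip) v (stk [] m t u c []) v' (stk [] m [] u c []) (3 * t.length + 2) :=
  runs_drain (F := fun l _ => stk [] m l u c []) (fun l _ v => runs_popT m l u c v)
    (fun _ _ _ _ _ => runs_skip _ _) t [] v

theorem runs_forkT (m t c : List Bool) (v : Reg) :
    ∃ v', Runs (drain popT (seq pushMain pushU)) v (stk [] m t [] c []) v'
      (stk [] (t.reverse ++ m) [] t.reverse c []) (4 * t.length + 2) := by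
  have := runs_drain (F := fun l acc => stk [] (acc ++ m) l acc c [])
    (fun l acc v => runs_popT (acc ++ m) l acc c v)
    (fun x l acc v hv => (runs_pushMain (acc ++ m) l acc c v hv).seq
      (runs_pushU (x :: (acc ++ m)) l acc c v hv)) t [] v
  simpa using this

/-- The action of pushing the register to `t` or to `u`. -/
def pushTo (b : Bool) : TProg := bif b then pushT else pushU

/-- The stacks where the given one of `t` and `u` contains `l`, and the other one `l'`. -/
def stkTo (b : Bool) (m l l' c : List Bool) : ∀ k, List (Sym k) :=
  bif b then stk [] m l l' c [] else stk [] m l' l c []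

/-- Move the tree at the top of the main stack to `t` or `u` in reverse. -/
def moveTop (b : Bool) : TProg :=
  seq (load fun v => (some true, v.2)) (loop (fun v => v.1.isSome)
    (seq popMain (seq (pushTo b) (seq (ite (fun v => v.1 == some true) (seq pushCnt pushCnt) skip)
      popCnt))))

/-- The loop moves symbols while it still owes trees: the filled register stands for the current one
and `cnt` counts the others. A symbol `true` replaces one owed tree by two, a symbol `false` settles
one. The lemma is in continuation form, prefixing a run that starts after `d` has been moved, so
that the two subtrees of a node can be chained in the induction. -/
theorem runs_moveTop_loop (b : Bool) (l' : List Bool) (d : Sexp) (r l cs : List Bool) (v v' : Reg)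
    (S' : ∀ k, List (Sym k)) (N : ℕ) (hv : v.1.isSome = true)
    (h : Runs (loop (fun v => v.1.isSome) (seq popMain (seq (pushTo b)
      (seq (ite (fun v => v.1 == some true) (seq pushCnt pushCnt) skip) popCnt))))
      (cs.head?, v.2) (stkTo b r (d.enc.reverse ++ l) l' cs.tail) v' S' N) :
    Runs (loop (fun v => v.1.isSome) (seq popMain (seq (pushTo b)
      (seq (ite (fun v => v.1 == some true) (seq pushCnt pushCnt) skip) popCnt))))
      v (stkTo b (d.enc ++ r) l l' cs) v' S' (N + 7 * d.size) := by
  induction d generalizing r l cs v N with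
  | nil =>
    refine (Runs.loop_true (c := fun v : Reg => v.1.isSome) hv ?_ h (N := 5)).mono
      (by simp only [Sexp.size]; omega)
    have h1 : Runs popMain v (stkTo b (Sexp.nil.enc ++ r) l l' cs) (some false, v.2)
        (stkTo b r l l' cs) 1 := by
      cases b <;> exact runs_popMain (false :: r) _ _ _ v
    have h2 : Runs (pushTo b) (some false, v.2) (stkTo b r l l' cs) (some false, v.2)
        (stkTo b r (false :: l) l' cs) 1 := by
      cases b
      · exact runs_pushU _ _ _ _ _ rfl
      · exact runs_pushT _ _ _ _ _ rfl
    have h3 : Runs popCnt (some false, v.2) (stkTo b r (false :: l) l' cs) (cs.head?, v.2)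
        (stkTo b r (false :: l) l' cs.tail) 1 := by
      cases b <;> exact runs_popCnt _ _ _ _ _
    exact h1.seq (h2.seq ((Runs.ite_false rfl (runs_skip _ _)).seq h3))
  | cons a₁ a₂ ih₁ ih₂ =>
    have key := ih₁ (a₂.enc ++ r) (true :: l) (true :: cs) (some true, v.2) _ rfl
      (ih₂ r (a₁.enc.reverse ++ true :: l) cs (some true, v.2) N rfl (by simpa [Sexp.enc] using h))
    refine (Runs.loop_true (c := fun v : Reg => v.1.isSome) hv ?_ key (N := 6)).mono
      (by simp only [Sexp.size]; omega)
    have h1 : Runs popMain v (stkTo b ((a₁.cons a₂).enc ++ r) l l' cs) (some true, v.2)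
        (stkTo b (a₁.enc ++ (a₂.enc ++ r)) l l' cs) 1 := by
      rw [← List.append_assoc]
      cases b <;> exact runs_popMain (true :: (a₁.enc ++ a₂.enc ++ r)) _ _ _ v
    have h2 : Runs (pushTo b) (some true, v.2) (stkTo b (a₁.enc ++ (a₂.enc ++ r)) l l' cs)
        (some true, v.2) (stkTo b (a₁.enc ++ (a₂.enc ++ r)) (true :: l) l' cs) 1 := by
      cases b
      · exact runs_pushU _ _ _ _ _ rfl
      · exact runs_pushT _ _ _ _ _ rfl
    have h3 : ∀ cs, Runs pushCnt (some true, v.2)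
        (stkTo b (a₁.enc ++ (a₂.enc ++ r)) (true :: l) l' cs)
        (some true, v.2) (stkTo b (a₁.enc ++ (a₂.enc ++ r)) (true :: l) l' (true :: cs)) 1 := by
      intro cs
      cases b <;> exact Runs.push (by simp [stkTo])
    have h4 : Runs popCnt (some true, v.2)
        (stkTo b (a₁.enc ++ (a₂.enc ++ r)) (true :: l) l' (true :: true :: cs))
        (some true, v.2) (stkTo b (a₁.enc ++ (a₂.enc ++ r)) (true :: l) l' (true :: cs)) 1 := by
      cases b <;> exact runs_popCnt _ _ _ _ _
    exact h1.seq (h2.seq ((Runs.ite_true rfl ((h3 _).seq (h3 _))).seq h4))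

theorem runs_moveTop (b : Bool) (d : Sexp) (r l l' : List Bool) (v : Reg) :
    ∃ v', Runs (moveTop b) v (stkTo b (d.enc ++ r) l l' []) v'
      (stkTo b r (d.enc.reverse ++ l) l' []) (7 * d.size + 2) := by
  refine ⟨_, Runs.mono (Runs.seq Runs.load (runs_moveTop_loop b l' d r l [] _ _ _ 1 rfl
    (Runs.loop_false rfl))) (by omega)⟩

theorem runs_moveT (d : Sexp) (r u : List Bool) (v : Reg) :
    ∃ v', Runs (moveTop true) v (stk [] (d.enc ++ r) [] u [] []) v'
      (stk [] r d.enc.reverse u [] []) (7 * d.size + 2) := by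
  simpa [stkTo] using runs_moveTop true d r [] u v

theorem runs_moveU (d : Sexp) (r t : List Bool) (v : Reg) :
    ∃ v', Runs (moveTop false) v (stk [] (d.enc ++ r) t [] [] []) v'
      (stk [] r t d.enc.reverse [] []) (7 * d.size + 2) := by
  simpa [stkTo] using runs_moveTop false d r [] t v

/-- Remove the tree at the top of the main stack. -/
def drop : TProg := seq (moveTop true) (drain popT skip)

theorem runs_drop (d : Sexp) (r : List Bool) (v : Reg) :
    ∃ v', Runs drop v (stk [] (d.enc ++ r) [] [] [] []) v' (stk [] r [] [] [] [])
      (10 * d.size + 4) := by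
  obtain ⟨v₁, h₁⟩ := runs_moveT d r [] v
  obtain ⟨v₂, h₂⟩ := runs_clearT r d.enc.reverse [] [] v₁
  refine ⟨v₂, (h₁.seq h₂).mono ?_⟩
  simp only [List.length_reverse, Sexp.length_enc]
  omega

/-- Duplicate the tree at the top of the main stack. -/
def dup : TProg :=
  seq (moveTop true) (seq (drain popT (seq pushMain pushU)) (seq (drain popU pushT)
    (drain popT pushMain)))

theorem runs_dup (d : Sexp) (r : List Bool) (v : Reg) :
    ∃ v', Runs dup v (stk [] (d.enc ++ r) [] [] [] []) v'
      (stk [] (d.enc ++ (d.enc ++ r)) [] [] [] []) (17 * d.size + 8) := by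
  obtain ⟨v₁, h₁⟩ := runs_moveT d r [] v
  obtain ⟨v₂, h₂⟩ := runs_forkT r d.enc.reverse [] v₁
  obtain ⟨v₃, h₃⟩ := runs_pourUT (d.enc ++ r) [] d.enc [] v₂
  obtain ⟨v₄, h₄⟩ := runs_pourT (d.enc ++ r) d.enc.reverse [] [] v₃
  simp only [List.reverse_reverse, List.length_reverse, Sexp.length_enc, List.append_nil]
    at h₂ h₃ h₄
  refine ⟨v₄, (h₁.seq (h₂.seq (h₃.seq h₄))).mono ?_⟩
  omega

/-- Swap the two trees at the top of the main stack. -/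
def swap : TProg :=
  seq (moveTop true) (seq (moveTop false) (seq (drain popT pushMain) (drain popU pushMain)))

theorem runs_swap (d d' : Sexp) (r : List Bool) (v : Reg) :
    ∃ v', Runs swap v (stk [] (d.enc ++ (d'.enc ++ r)) [] [] [] []) v'
      (stk [] (d'.enc ++ (d.enc ++ r)) [] [] [] []) (10 * d.size + 10 * d'.size + 8) := by
  obtain ⟨v₁, h₁⟩ := runs_moveT d (d'.enc ++ r) [] v
  obtain ⟨v₂, h₂⟩ := runs_moveU d' r d.enc.reverse v₁
  obtain ⟨v₃, h₃⟩ := runs_pourT r d.enc.reverse d'.enc.reverse [] v₂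
  obtain ⟨v₄, h₄⟩ := runs_pourU (d.enc ++ r) [] d'.enc.reverse [] v₃
  simp only [List.reverse_reverse, List.length_reverse, Sexp.length_enc] at h₃ h₄
  refine ⟨v₄, (h₁.seq (h₂.seq (h₃.seq h₄))).mono ?_⟩
  omega

/-- Push a symbol to the main stack. -/
def pushSym (b : Bool) : TProg := push .main fun _ => b

theorem runs_pushSym (b : Bool) (m t u c : List Bool) (v : Reg) :
    Runs (pushSym b) v (stk [] m t u c []) v (stk [] (b :: m) t u c []) 1 :=
  Runs.push (by simp)

def popBoth : TProg := seq popT popU'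

theorem runs_popBoth (m t u c : List Bool) (v : Reg) :
    Runs popBoth v (stk [] m t u c []) (t.head?, u.head?, v.2.2) (stk [] m t.tail u.tail c []) 2 :=
  Runs.seq (runs_popT m t u c v) (Runs.pop rfl (by simp))

/-- Compare the words on `t` and `u`, and push a mark to `cnt` for each difference. -/
def compare : TProg :=
  seq popBoth (loop (fun v => v.1.isSome || v.2.1.isSome)
    (seq (ite (fun v => v.1 == v.2.1) skip pushCnt) popBoth))

theorem runs_pushCnt (m t u c : List Bool) (v : Reg) :
    Runs pushCnt v (stk [] m t u c []) v (stk [] m t u (true :: c) []) 1 :=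
  Runs.push (by simp)

theorem runs_compare (m t u c : List Bool) (v : Reg) :
    ∃ v' c', Runs compare v (stk [] m t u c []) v' (stk [] m [] [] c' [])
      (5 * (t.length + u.length) + 3) ∧ (c' = [] ↔ c = [] ∧ t = u) ∧
      c'.length ≤ c.length + t.length + u.length := by
  -- The invariant is stated for the loop after both first symbols were popped, which is the
  -- situation at each test.
  suffices h : ∃ v' c', Runs (loop (fun v : Reg => v.1.isSome || v.2.1.isSome)
      (seq (ite (fun v : Reg => v.1 == v.2.1) skip pushCnt) popBoth))
      (t.head?, u.head?, v.2.2) (stk [] m t.tail u.tail c []) v' (stk [] m [] [] c' [])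
      (5 * (t.length + u.length) + 1) ∧ (c' = [] ↔ c = [] ∧ t = u) ∧
      c'.length ≤ c.length + t.length + u.length by
    obtain ⟨v', c', h, h'⟩ := h
    exact ⟨v', c', (Runs.seq (runs_popBoth m t u c v) h).mono (by omega), h'⟩
  obtain ⟨v₁, v₂, v₃⟩ := v
  induction hn : t.length + u.length using Nat.strong_induction_on generalizing t u c with
  | _ n ih =>
  rcases t with _ | ⟨x, t⟩
  · rcases u with _ | ⟨y, u⟩
    · exact ⟨_, c, (Runs.loop_false rfl).mono (by omega), by simp⟩
    · obtain ⟨v', c', h, h', h''⟩ := ih u.length (by simp at hn; omega) [] u (true :: c) (by simp)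
      refine ⟨v', c', (Runs.loop_true (v := (none, some y, v₃)) rfl
        (Runs.seq (Runs.ite_false rfl (runs_pushCnt ..))
        (runs_popBoth _ _ _ (true :: c) _)) h).mono (?_ : 1 + 1 + 2 + _ + 1 ≤ _), ?_, ?_⟩
      · simp at hn; omega
      · simp [h']
      · simp at hn h'' ⊢; omega
  · rcases u with _ | ⟨y, u⟩
    · obtain ⟨v', c', h, h', h''⟩ := ih t.length (by simp at hn; omega) t [] (true :: c) (by simp)
      refine ⟨v', c', (Runs.loop_true (v := (some x, none, v₃)) rfl
        (Runs.seq (Runs.ite_false rfl (runs_pushCnt ..))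
        (runs_popBoth _ _ _ (true :: c) _)) h).mono (?_ : 1 + 1 + 2 + _ + 1 ≤ _), ?_, ?_⟩
      · simp at hn; omega
      · simp [h']
      · simp at hn h'' ⊢; omega
    · by_cases hxy : x = y
      · obtain ⟨v', c', h, h', h''⟩ := ih (t.length + u.length) (by simp at hn; omega) t u c rfl
        refine ⟨v', c', (Runs.loop_true (v := (some x, some y, v₃)) rfl
          (Runs.seq (Runs.ite_true (by simp [hxy]) (runs_skip _ _))
          (runs_popBoth _ _ _ c _)) h).mono (?_ : 1 + 1 + 2 + _ + 1 ≤ _), ?_, ?_⟩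
        · simp at hn; omega
        · simp [h', hxy]
        · simp at hn h'' ⊢; omega
      · obtain ⟨v', c', h, h', h''⟩ :=
          ih (t.length + u.length) (by simp at hn; omega) t u (true :: c) rfl
        refine ⟨v', c', (Runs.loop_true (v := (some x, some y, v₃)) rfl
          (Runs.seq (Runs.ite_false (by simp [hxy]) (runs_pushCnt ..))
          (runs_popBoth _ _ _ (true :: c) _)) h).mono (?_ : 1 + 1 + 2 + _ + 1 ≤ _), ?_, ?_⟩
        · simp at hn; omega
        · simp [h', hxy]
        · simp at hn h'' ⊢; omega

theorem runs_clearCnt (m t u c : List Bool) (v : Reg) :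
    ∃ v', Runs (drain popCnt skip) v (stk [] m t u c []) v' (stk [] m t u [] [])
      (3 * c.length + 2) :=
  runs_drain (F := fun l _ => stk [] m t u l []) (fun l _ v => runs_popCnt m t u l v)
    (fun _ _ _ _ _ => runs_skip _ _) c [] v

/-- The tree that stands for a truth value. -/
def ofBool (b : Bool) : Sexp := bif b then .cons .nil .nil else .nil

/-- Replace the two trees at the top of the main stack by the truth value of their equality. -/
def eqTop : TProg :=
  seq (moveTop true) (seq (moveTop false) (seq compare (seq popCnt (seq
    (ite (fun v => v.1.isNone) (seq (pushSym false) (seq (pushSym false) (pushSym true)))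
      (pushSym false)) (drain popCnt skip)))))

open scoped Classical in
theorem runs_eqTop (d d' : Sexp) (r : List Bool) (v : Reg) :
    ∃ v', Runs eqTop v (stk [] (d.enc ++ (d'.enc ++ r)) [] [] [] []) v'
      (stk [] ((ofBool (decide (d = d'))).enc ++ r) [] [] [] [])
      (20 * d.size + 20 * d'.size + 20) := by
  obtain ⟨v₁, h₁⟩ := runs_moveT d (d'.enc ++ r) [] v
  obtain ⟨v₂, h₂⟩ := runs_moveU d' r d.enc.reverse v₁
  obtain ⟨v₃, c, h₃, hc, hl⟩ := runs_compare r d.enc.reverse d'.enc.reverse [] v₂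
  have h₄ := runs_popCnt r [] [] c v₃
  have h₅ : Runs (ite (fun v : Reg => v.1.isNone)
      (seq (pushSym false) (seq (pushSym false) (pushSym true))) (pushSym false)) (c.head?, v₃.2)
      (stk [] r [] [] c.tail []) (c.head?, v₃.2)
      (stk [] ((ofBool (decide (d = d'))).enc ++ r) [] [] c.tail []) 4 := by
    by_cases h : d = d'
    · have : c = [] := hc.2 ⟨rfl, by rw [h]⟩
      subst this
      simp only [h, decide_true]
      exact Runs.ite_true rfl ((runs_pushSym ..).seq ((runs_pushSym ..).seq (runs_pushSym ..)))
    -- Both codes lie reversed on the auxiliary stacks, which does not affect equality.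
    · have : c ≠ [] := fun h' => h (Sexp.enc_injective (List.reverse_injective (hc.1 h').2))
      obtain ⟨x, c, rfl⟩ := List.exists_cons_of_ne_nil this
      simp only [h, decide_false]
      exact (Runs.ite_false rfl (runs_pushSym ..)).mono (by omega)
  obtain ⟨v₆, h₆⟩ := runs_clearCnt ((ofBool (decide (d = d'))).enc ++ r) [] [] c.tail (c.head?, v₃.2)
  refine ⟨v₆, (h₁.seq (h₂.seq (h₃.seq (h₄.seq (h₅.seq h₆))))).mono ?_⟩
  simp only [List.length_reverse, Sexp.length_enc, List.length_nil, List.length_tail] at *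
  omega

end StackProg
end

/-! ### Polynomial-time functions on coded types, and bounded folds. -/

noncomputable section

theorem Polynomial.eval_mono_nat (q : Polynomial ℕ) {m n : ℕ} (h : m ≤ n) :
    q.eval m ≤ q.eval n := by
  simp only [Polynomial.eval_eq_sum_range]
  gcongr

namespace StackProg

open Function Prog Sexp

/-- The stacks when only the main stack is used. -/
abbrev mainStk (m : List Bool) : ∀ k, List (Sym k) := stk [] m [] [] [] []

/-- Types whose elements are represented by trees. -/
class Coded (α : Type) where
  /-- the tree that represents an element -/
  toS : α → Sexp
  /-- the element represented by a tree -/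
  ofS : Sexp → α
  ofS_toS : ∀ a, ofS (toS a) = a

open Coded (toS ofS ofS_toS)

theorem toS_injective {α : Type} [Coded α] : Injective (toS : α → Sexp) :=
  Function.LeftInverse.injective ofS_toS

/-- The size of the representation of an element. -/
def sz {α : Type} [Coded α] (a : α) : ℕ := size (toS a)

/-- The word that represents an element. -/
def word {α : Type} [Coded α] (a : α) : List Bool := (toS a).enc

instance : Coded Sexp := ⟨fun d => d, fun d => d, fun _ => rfl⟩

instance : Coded Unit := ⟨fun _ => .nil, fun _ => (), fun _ => rfl⟩

instance : Coded Bool where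
  toS := ofBool
  ofS
    | .nil => false
    | .cons _ _ => true
  ofS_toS b := by cases b <;> rfl

instance {α β : Type} [Coded α] [Coded β] : Coded (α × β) where
  toS p := .cons (toS p.1) (toS p.2)
  ofS d := (ofS (hd d), ofS (tl d))
  ofS_toS p := by simp [hd, tl, ofS_toS]

/-- The representation of lists. -/
def listToS {α : Type} [Coded α] : List α → Sexp
  | [] => .nil
  | a :: l => .cons (toS a) (listToS l)

/-- The list represented by a tree. -/
def listOfS {α : Type} [Coded α] : Sexp → List α
  | .nil => []
  | .cons a l => ofS a :: listOfS l

instance {α : Type} [Coded α] : Coded (List α) where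
  toS := listToS
  ofS := listOfS
  ofS_toS l := by
    induction l with
    | nil => rfl
    | cons a l ih => simp [listToS, listOfS, ofS_toS, ih]

/-- Natural numbers are represented in unary. -/
instance : Coded ℕ where
  toS n := toS (List.replicate n ())
  ofS d := (ofS d : List Unit).length
  ofS_toS n := by simp [ofS_toS]

section sz

variable {α β : Type} [Coded α] [Coded β]

theorem sz_pos (a : α) : 1 ≤ sz a := size_pos _

@[simp] theorem sz_prod (p : α × β) : sz p = sz p.1 + sz p.2 + 1 := rfl

@[simp] theorem sz_nil : sz ([] : List α) = 1 := rfl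

@[simp] theorem sz_cons (a : α) (l : List α) : sz (a :: l) = sz a + sz l + 1 := rfl

theorem sz_bool_le (b : Bool) : sz b ≤ 3 := by cases b <;> simp [sz, toS, ofBool, size]

@[simp] theorem sz_unit (b : Unit) : sz b = 1 := rfl

theorem sz_list (l : List α) : sz l = (l.map sz).sum + l.length + 1 := by
  induction l with
  | nil => rfl
  | cons a l ih => simp [ih]; ring

@[simp] theorem sz_nat (n : ℕ) : sz n = 2 * n + 1 := by
  change sz (List.replicate n ()) = _
  simp [sz_list]
  ring

theorem length_lt_sz (l : List α) : l.length < sz l := by rw [sz_list]; omega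

theorem sz_le_of_mem {a : α} {l : List α} (h : a ∈ l) : sz a ≤ sz l := by
  rw [sz_list]
  have := List.le_sum_of_mem (List.mem_map_of_mem (f := sz) h)
  omega

theorem sz_list_le (l : List α) (N : ℕ) (h : ∀ a ∈ l, sz a ≤ N) :
    sz l ≤ l.length * (N + 1) + 1 := by
  induction l with
  | nil => simp
  | cons a l ih =>
    have h1 := h a (by simp)
    have h2 := ih fun b hb => h b (by simp [hb])
    simp only [sz_cons, List.length_cons]
    rw [Nat.succ_mul]
    omega

theorem sz_append (l l' : List α) : sz (l ++ l') + 1 = sz l + sz l' := by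
  simp only [sz_list, List.map_append, List.sum_append, List.length_append]
  ring

theorem sz_reverse (l : List α) : sz l.reverse = sz l := by
  simp [sz_list]

theorem sz_le_of_sublist {l l' : List α} (h : l.Sublist l') : sz l ≤ sz l' := by
  rw [sz_list, sz_list]
  have := (h.map sz).sum_le_sum (by simp)
  have := h.length_le
  omega

end sz

variable {α β γ δ : Type} [Coded α] [Coded β] [Coded γ] [Coded δ]

/-- Functions computed by a program in polynomial time. -/
@[fun_prop]
def PTime (f : α → β) : Prop :=
  ∃ (p : TProg) (q : Polynomial ℕ), ∀ x, sz (f x) ≤ q.eval (sz x) ∧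
    ∀ r v, ∃ v', Runs p v (mainStk (word x ++ r)) v' (mainStk (word (f x) ++ r)) (q.eval (sz x))

@[fun_prop]
theorem PTime.id : PTime fun x : α => x :=
  ⟨skip, .X + 1, fun x => ⟨by simp, fun r v => ⟨v, (runs_skip _ _).mono (by simp)⟩⟩⟩

-- The second program runs on the output of the first. Hence `PTime` bounds the size of the output
-- as well as the time, and monotonicity of polynomials with natural coefficients enters.
@[fun_prop]
theorem PTime.comp {f : β → γ} {g : α → β} (hf : PTime f) (hg : PTime g) :
    PTime fun x => f (g x) := by
  obtain ⟨p, q, h⟩ := hf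
  obtain ⟨p', q', h'⟩ := hg
  refine ⟨seq p' p, q' + q.comp q', fun x => ?_⟩
  have hq : q.eval (sz (g x)) ≤ q.eval (q'.eval (sz x)) := q.eval_mono_nat (h' x).1
  simp only [Polynomial.eval_add, Polynomial.eval_comp]
  refine ⟨(h (g x)).1.trans (by omega), fun r v => ?_⟩
  obtain ⟨v₁, h₁⟩ := (h' x).2 r v
  obtain ⟨v₂, h₂⟩ := (h (g x)).2 r v₁
  exact ⟨v₂, (h₁.seq h₂).mono (by omega)⟩

/-- A function is computed by any program that computes a function on the representations. -/
theorem PTime.of_toS {f : α → β} {g : Sexp → Sexp} (hg : PTime g)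
    (h : ∀ a, g (toS a) = toS (f a)) : PTime f := by
  obtain ⟨p, q, h'⟩ := hg
  refine ⟨p, q, fun x => ?_⟩
  have := h' (toS x)
  unfold word sz at *
  rw [h] at this
  exact this

/-- A tree represents itself, so both sides speak of the same words. -/
theorem PTime.repr {f : α → β} (hf : PTime f) : PTime fun a => toS (f a) := hf

-- The input is duplicated, `g` is run on the upper copy, the two are swapped, and `f` is run on the
-- other copy. A final symbol `true` joins the results to a node.
@[fun_prop]
theorem PTime.prodMk {f : α → β} {g : α → γ} (hf : PTime f) (hg : PTime g) :
    PTime fun x => (f x, g x) := by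
  obtain ⟨p, q, h⟩ := hf
  obtain ⟨p', q', h'⟩ := hg
  refine ⟨seq dup (seq p' (seq swap (seq p (pushSym true)))), 27 * .X + 11 * q' + q + 17,
    fun x => ?_⟩
  have hn := sz_pos x
  have e1 := (h x).1
  have e2 := (h' x).1
  simp only [Polynomial.eval_add, Polynomial.eval_mul, Polynomial.eval_ofNat, Polynomial.eval_X]
  refine ⟨by simp only [sz_prod]; omega, fun r v => ?_⟩
  obtain ⟨v₁, h₁⟩ := runs_dup (Coded.toS x) r v
  obtain ⟨v₂, h₂⟩ := (h' x).2 (word x ++ r) v₁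
  obtain ⟨v₃, h₃⟩ := runs_swap (Coded.toS (g x)) (Coded.toS x) r v₂
  obtain ⟨v₄, h₄⟩ := (h x).2 (word (g x) ++ r) v₃
  have h₅ := runs_pushSym true (word (f x) ++ (word (g x) ++ r)) [] [] [] v₄
  have e : word (f x, g x) ++ r = true :: (word (f x) ++ (word (g x) ++ r)) := by
    simp [word, Coded.toS, Sexp.enc]
  rw [← e] at h₅
  refine ⟨v₄, (h₁.seq (h₂.seq (h₃.seq (h₄.seq h₅)))).mono ?_⟩
  unfold sz at *
  omega

-- A nonempty list and the pair of its head and tail are represented by the same tree.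
@[fun_prop]
theorem PTime.cons {f : α → β} {g : α → List β} (hf : PTime f) (hg : PTime g) :
    PTime fun x => f x :: g x := hf.prodMk hg

@[fun_prop]
theorem PTime.const (b : β) : PTime fun _ : α => b := by
  suffices h : ∀ d : Sexp, PTime fun _ : α => d from h (Coded.toS b)
  intro d
  induction d with
  | nil =>
    refine ⟨seq drop (pushSym false), 10 * .X + 5, fun x => ?_⟩
    simp only [Polynomial.eval_add, Polynomial.eval_mul, Polynomial.eval_ofNat, Polynomial.eval_X]
    refine ⟨by change 1 ≤ _; omega, fun r v => ?_⟩
    obtain ⟨v₁, h₁⟩ := runs_drop (Coded.toS x) r v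
    exact ⟨v₁, (h₁.seq (runs_pushSym false r [] [] [] v₁)).mono (by unfold sz; omega)⟩
  | cons a b iha ihb => exact iha.prodMk ihb

theorem ptime_hd : PTime hd := by
  refine ⟨seq popMain (ite (fun v => v.1 == some true) (seq swap drop) (pushSym false)),
    30 * .X + 30, fun x => ?_⟩
  simp only [Polynomial.eval_add, Polynomial.eval_mul, Polynomial.eval_ofNat, Polynomial.eval_X]
  change size (Sexp.hd x) ≤ 30 * size x + 30 ∧ _
  refine ⟨(size_hd_le x).trans (by omega), fun r v => ?_⟩
  have h₁ := runs_popMain (word x ++ r) [] [] [] v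
  cases x with
  | nil => exact ⟨_, (h₁.seq (Runs.ite_false rfl (runs_pushSym ..))).mono (by omega)⟩
  | cons a b =>
    obtain ⟨v₂, h₂⟩ := runs_swap a b r (some true, v.2)
    obtain ⟨v₃, h₃⟩ := runs_drop b (a.enc ++ r) v₂
    rw [← List.append_assoc] at h₂
    exact ⟨_, (h₁.seq (Runs.ite_true rfl (h₂.seq h₃))).mono
      (by change _ ≤ 30 * (a.size + b.size + 1) + 30; omega)⟩

theorem ptime_tl : PTime tl := by
  refine ⟨seq popMain (ite (fun v => v.1 == some true) drop (pushSym false)), 30 * .X + 30,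
    fun x => ?_⟩
  simp only [Polynomial.eval_add, Polynomial.eval_mul, Polynomial.eval_ofNat, Polynomial.eval_X]
  change size (Sexp.tl x) ≤ 30 * size x + 30 ∧ _
  refine ⟨(size_tl_le x).trans (by omega), fun r v => ?_⟩
  have h₁ := runs_popMain (word x ++ r) [] [] [] v
  cases x with
  | nil => exact ⟨_, (h₁.seq (Runs.ite_false rfl (runs_pushSym ..))).mono (by omega)⟩
  | cons a b =>
    obtain ⟨v₂, h₂⟩ := runs_drop a (b.enc ++ r) (some true, v.2)
    rw [← List.append_assoc] at h₂
    exact ⟨_, (h₁.seq (Runs.ite_true rfl h₂)).mono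
      (by change _ ≤ 30 * (a.size + b.size + 1) + 30; omega)⟩

@[fun_prop]
theorem PTime.fst {f : α → β × γ} (hf : PTime f) : PTime fun x => (f x).1 :=
  (PTime.of_toS (f := Prod.fst) ptime_hd fun _ => rfl).comp hf

@[fun_prop]
theorem PTime.snd {f : α → β × γ} (hf : PTime f) : PTime fun x => (f x).2 :=
  (PTime.of_toS (f := Prod.snd) ptime_tl fun _ => rfl).comp hf

@[fun_prop]
theorem PTime.ite {c : α → Bool} {f g : α → β} (hc : PTime c) (hf : PTime f) (hg : PTime g) :
    PTime fun x => if c x = true then f x else g x := by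
  obtain ⟨p, q, h⟩ := hc
  obtain ⟨p', q', h'⟩ := hf
  obtain ⟨p'', q'', h''⟩ := hg
  -- Popping and pushing back reads the first symbol of the truth value, which determines it; the
  -- truth value is then dropped in either branch.
  refine ⟨seq dup (seq p (seq popMain (seq pushMain (Prog.ite (fun v => v.1 == some true)
    (seq drop p') (seq drop p''))))), 17 * .X + 11 * q + q' + q'' + 15, fun x => ?_⟩
  simp only [Polynomial.eval_add, Polynomial.eval_mul, Polynomial.eval_ofNat, Polynomial.eval_X]
  have e := (h x).1
  have e' := (h' x).1
  have e'' := (h'' x).1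
  refine ⟨by split_ifs <;> omega, fun r v => ?_⟩
  obtain ⟨v₁, h₁⟩ := runs_dup (Coded.toS x) r v
  obtain ⟨v₂, h₂⟩ := (h x).2 (word x ++ r) v₁
  have h₃ := runs_popMain (word (c x) ++ (word x ++ r)) [] [] [] v₂
  obtain ⟨v₅, h₅⟩ := runs_drop (Coded.toS (c x)) (word x ++ r) (some (c x), v₂.2)
  have : Coded.toS (c x) = ofBool (c x) := rfl
  cases hcx : c x with
  | false =>
    rw [hcx] at h₂ h₃ h₅ e
    obtain ⟨v₆, h₆⟩ := (h'' x).2 r v₅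
    refine ⟨v₆, (h₁.seq (h₂.seq (h₃.seq ((runs_pushMain (x := false) _ _ _ _ _ rfl).seq
      (Runs.ite_false rfl (h₅.seq h₆)))))).mono ?_⟩
    unfold sz at *
    omega
  | true =>
    rw [hcx] at h₂ h₃ h₅ e
    obtain ⟨v₆, h₆⟩ := (h' x).2 r v₅
    refine ⟨v₆, (h₁.seq (h₂.seq (h₃.seq ((runs_pushMain (x := true) _ _ _ _ _ rfl).seq
      (Runs.ite_true rfl (h₅.seq h₆)))))).mono ?_⟩
    unfold sz at *
    omega

@[fun_prop]
theorem PTime.decideEq [DecidableEq β] {f g : α → β} (hf : PTime f) (hg : PTime g) :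
    PTime fun x => decide (f x = g x) := by
  classical
  obtain ⟨p, q, h⟩ := hf
  obtain ⟨p', q', h'⟩ := hg
  refine ⟨seq dup (seq p' (seq swap (seq p eqTop))), 27 * .X + 31 * q' + 21 * q + 40,
    fun x => ?_⟩
  have hn := sz_pos x
  have e1 := (h x).1
  have e2 := (h' x).1
  simp only [Polynomial.eval_add, Polynomial.eval_mul, Polynomial.eval_ofNat, Polynomial.eval_X]
  refine ⟨(sz_bool_le _).trans (by omega), fun r v => ?_⟩
  obtain ⟨v₁, h₁⟩ := runs_dup (Coded.toS x) r v
  obtain ⟨v₂, h₂⟩ := (h' x).2 (word x ++ r) v₁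
  obtain ⟨v₃, h₃⟩ := runs_swap (Coded.toS (g x)) (Coded.toS x) r v₂
  obtain ⟨v₄, h₄⟩ := (h x).2 (word (g x) ++ r) v₃
  obtain ⟨v₅, h₅⟩ := runs_eqTop (Coded.toS (f x)) (Coded.toS (g x)) r v₄
  rw [decide_eq_decide.2 toS_injective.eq_iff] at h₅
  refine ⟨v₅, (h₁.seq (h₂.seq (h₃.seq (h₄.seq h₅)))).mono ?_⟩
  unfold sz at *
  omega

/-- Put the second symbol of the main stack, whose first symbol is `1`, into the register. -/
def testHd : TProg := seq popMain (seq popMain (seq pushMain (pushSym true)))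

theorem runs_testHd (b : Bool) (m : List Bool) (v : Reg) :
    Runs testHd v (mainStk (true :: b :: m)) (some b, v.2) (mainStk (true :: b :: m)) 4 :=
  (runs_popMain _ _ _ _ _).seq ((runs_popMain _ _ _ _ _).seq
    ((runs_pushMain (x := b) _ _ _ _ _ rfl).seq (runs_pushSym ..)))


/-- This is the only source of iteration for the functions that follow. Iterating a polynomial-time
step can make the accumulator grow exponentially, so `hq` demands a polynomial bound on it after
every prefix of the list. The loop works on the tree of (rest of the list, context, accumulator). -/
theorem PTime.foldl {s : γ → β → α → β} {i : γ → β} {l : γ → List α}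
    (hs : PTime fun p : γ × β × α => s p.1 p.2.1 p.2.2) (hi : PTime i) (hl : PTime l)
    (q : Polynomial ℕ)
    (hq : ∀ c l', l' <+: l c → sz (l'.foldl (s c) (i c)) ≤ q.eval (sz c)) :
    PTime fun c => (l c).foldl (s c) (i c) := by
  suffices H : PTime fun c => (c, (l c).foldl (s c) (i c)) from H.snd
  obtain ⟨p₀, q₀, h₀⟩ : PTime fun c => (l c, (c, i c)) := hl.prodMk (PTime.id.prodMk hi)
  obtain ⟨p, Q, h⟩ : PTime fun x : (α × List α) × γ × β =>
      (x.1.2, (x.2.1, s x.2.1 x.2.2 x.1.1)) :=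
    (PTime.id.fst.snd).prodMk (PTime.id.snd.fst.prodMk
      (hs.comp (PTime.id.snd.fst.prodMk (PTime.id.snd.snd.prodMk PTime.id.fst.fst))))
  -- `l₁` is the part of the list already processed and `l₂` the rest. The pair `((a, l₂), _)` has
  -- the same tree as `(a :: l₂, _)`, so the loop body can take the list apart as a pair.
  have key : ∀ (c : γ) (N : ℕ), sz c ≤ N → sz (l c) ≤ N →
      ∀ (l₂ l₁ : List α) (r : List Bool) (v : Reg), l₁ ++ l₂ = l c →
      ∃ v', Runs (seq testHd (loop (fun v => v.1 == some true) (seq p testHd)))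
        v (mainStk (word (l₂, (c, l₁.foldl (s c) (i c))) ++ r)) v'
        (mainStk (word (([] : List α), (c, (l c).foldl (s c) (i c))) ++ r))
        (l₂.length * (Q.eval (N + N + q.eval N + 2) + 5) + 5) := by
    intro c N hc hl l₂
    induction l₂ with
    | nil =>
      intro l₁ r v e
      rw [List.append_nil] at e
      subst e
      exact ⟨_, ((runs_testHd false _ v).seq (Runs.loop_false rfl)).mono (by omega)⟩
    | cons a l₂ ih =>
      intro l₁ r v e
      have hs' : sz ((a, l₂), (c, l₁.foldl (s c) (i c))) ≤ N + N + q.eval N + 2 := by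
        have h1 := hq c l₁ ⟨_, e⟩
        have h2 := q.eval_mono_nat hc
        have h3 : sz (a :: l₂) ≤ sz (l c) := sz_le_of_sublist (e ▸ List.sublist_append_right _ _)
        simp only [sz_prod, sz_cons] at *
        omega
      have hQ := Q.eval_mono_nat hs'
      obtain ⟨v₁, h₁⟩ := (h ((a, l₂), (c, l₁.foldl (s c) (i c)))).2 r (some true, v.2)
      obtain ⟨v₂, ⟨n, hn, h₂⟩⟩ := ih (l₁ ++ [a]) r v₁ (by simpa using e)
      refine ⟨v₂, ?_⟩
      simp only [List.foldl_append, List.foldl_cons, List.foldl_nil] at h₂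
      -- The run given by induction begins with a head test, which is split off because it belongs
      -- to the current round of the loop.
      cases h₂ with
      | @seq _ _ _ _ v₄ S₄ _ _ n₁ n₂ e₁ e₂ =>
      have e₃ := Runs.loop_true (c := fun v : Reg => v.1 == some true) (v := (some true, v.2)) rfl
        (h₁.seq ⟨n₁, le_rfl, e₁⟩) ⟨n₂, le_rfl, e₂⟩
      refine (Runs.seq (runs_testHd true _ v) e₃).mono ?_
      rw [List.length_cons, Nat.succ_mul]
      omega
  -- At the end the stack holds the code of `([], (c, result))`, that is `true`, `false`, and the
  -- code of `(c, result)`. The two final pops remove these two symbols.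
  refine ⟨seq p₀ (seq (seq testHd (loop (fun v => v.1 == some true) (seq p testHd)))
    (seq popMain popMain)),
    q₀ + (.X + q₀) * (Q.comp (.X + q₀ + (.X + q₀) + q.comp (.X + q₀) + 2) + 5) + 7 + .X + q + 1,
    fun x => ?_⟩
  simp only [Polynomial.eval_add, Polynomial.eval_mul, Polynomial.eval_ofNat, Polynomial.eval_X,
    Polynomial.eval_comp, Polynomial.eval_one]
  refine ⟨?_, fun r v => ?_⟩
  · have := hq x (l x) List.prefix_rfl
    simp only [sz_prod]
    omega
  · have hsz : sz (l x) ≤ sz x + q₀.eval (sz x) := by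
      have := (h₀ x).1
      simp only [sz_prod] at this
      omega
    obtain ⟨v₁, h₁⟩ := (h₀ x).2 r v
    obtain ⟨v₂, h₂⟩ := key x (sz x + q₀.eval (sz x)) (by omega) hsz (l x) [] r v₁ rfl
    have h₃ := (runs_popMain (word (([] : List α), (x, (l x).foldl (s x) (i x))) ++ r)
      [] [] [] v₂).seq (runs_popMain _ [] [] [] _)
    refine ⟨_, (h₁.seq (h₂.seq h₃)).mono ?_⟩
    have := Nat.mul_le_mul_right (Q.eval (sz x + q₀.eval (sz x) + (sz x + q₀.eval (sz x)) +
      q.eval (sz x + q₀.eval (sz x)) + 2) + 5) ((length_lt_sz (l x)).le.trans hsz)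
    omega

end StackProg
end

/-! ### Closure of polynomial time under Boolean, list and unary operations. -/

noncomputable section

namespace StackProg

open Function Prog Sexp
open Coded (toS ofS ofS_toS)

variable {α β γ δ : Type} [Coded α] [Coded β] [Coded γ] [Coded δ]

theorem PTime.bound {f : α → β} (hf : PTime f) :
    ∃ q : Polynomial ℕ, ∀ x, sz (f x) ≤ q.eval (sz x) :=
  let ⟨_, q, h⟩ := hf
  ⟨q, fun x => (h x).1⟩

@[fun_prop]
theorem PTime.not {f : α → Bool} (hf : PTime f) : PTime fun x => !(f x) := by
  have := hf.ite (PTime.const false) (PTime.const true)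
  convert this with x
  cases f x <;> rfl

@[fun_prop]
theorem PTime.and {f g : α → Bool} (hf : PTime f) (hg : PTime g) : PTime fun x => f x && g x := by
  have := hf.ite hg (PTime.const false)
  convert this with x
  cases f x <;> rfl

@[fun_prop]
theorem PTime.or {f g : α → Bool} (hf : PTime f) (hg : PTime g) : PTime fun x => f x || g x := by
  have := hf.ite (PTime.const true) hg
  convert this with x
  cases f x <;> rfl

@[fun_prop]
theorem PTime.xor {f g : α → Bool} (hf : PTime f) (hg : PTime g) :
    PTime fun x => Bool.xor (f x) (g x) := by
  have := hf.ite hg.not hg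
  convert this with x
  cases f x <;> simp

@[fun_prop]
theorem PTime.isEmpty {f : α → List β} (hf : PTime f) : PTime fun x => (f x).isEmpty := by
  have : PTime fun x => decide (toS (f x) = .nil) := hf.repr.decideEq (PTime.const _)
  convert this with x
  cases f x <;> simp [toS, listToS]

@[fun_prop]
theorem PTime.tail {f : α → List β} (hf : PTime f) : PTime fun x => (f x).tail :=
  (PTime.of_toS (f := List.tail) ptime_tl fun l => by cases l <;> rfl).comp hf

@[fun_prop]
theorem PTime.headD {f : α → List β} {g : α → β} (hf : PTime f) (hg : PTime g) :
    PTime fun x => (f x).headD (g x) := by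
  have : PTime fun x => if (f x).isEmpty = true then toS (g x) else hd (toS (f x)) :=
    hf.isEmpty.ite hg.repr (ptime_hd.comp hf.repr)
  suffices h : PTime fun x => toS ((f x).headD (g x)) from h
  convert this with x
  cases f x <;> rfl

theorem PTime.all {l : γ → List α} {p : γ → α → Bool} (hp : PTime fun x : γ × α => p x.1 x.2)
    (hl : PTime l) : PTime fun c => (l c).all (p c) := by
  have h : PTime fun c => (l c).foldl (fun b a => b && p c a) true :=
    PTime.foldl (s := fun c b a => b && p c a) (by
      have := hp.comp (f := fun x : γ × α => p x.1 x.2)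
        (g := fun x : γ × Bool × α => (x.1, x.2.2)) (by fun_prop)
      fun_prop) (by fun_prop) hl 3 (fun c l _ => by simpa using sz_bool_le _)
  convert h with c
  suffices ∀ (l : List α) (b : Bool), (b && l.all (p c)) = l.foldl (fun b a => b && p c a) b by
    simpa using this (l c) true
  intro l
  induction l with
  | nil => simp
  | cons a l ih => intro b; simp [← ih, Bool.and_assoc]

theorem PTime.any {l : γ → List α} {p : γ → α → Bool} (hp : PTime fun x : γ × α => p x.1 x.2)
    (hl : PTime l) : PTime fun c => (l c).any (p c) := by
  have := (PTime.all (p := fun c a => !p c a) (by fun_prop) hl).not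
  convert this with c
  rw [List.any_eq_not_all_not]

@[fun_prop]
theorem PTime.reverse {l : γ → List α} (hl : PTime l) : PTime fun c => (l c).reverse := by
  suffices PTime fun l : List α => l.reverse from this.comp hl
  have := PTime.foldl (γ := List α) (s := fun _ (acc : List α) a => a :: acc) (i := fun _ => [])
    (l := fun l => l) (by fun_prop) (by fun_prop) (by fun_prop) .X (fun l l' h => by
      have := sz_le_of_sublist h.sublist
      simpa [sz_reverse] using this)
  simpa using this

@[fun_prop]
theorem PTime.append {l l' : γ → List α} (hl : PTime l) (hl' : PTime l') :
    PTime fun c => l c ++ l' c := by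
  suffices PTime fun c : List α × List α => c.1 ++ c.2 from this.comp (hl.prodMk hl')
  have := PTime.foldl (γ := List α × List α) (s := fun _ (acc : List α) a => a :: acc)
    (i := fun c => c.2) (l := fun c => c.1.reverse) (by fun_prop) (by fun_prop) (by fun_prop) .X
    (fun c l' h => by
      have := sz_le_of_sublist h.sublist
      have := sz_append l'.reverse c.2
      simp [sz_reverse] at *
      omega)
  simpa using this

theorem PTime.map {l : γ → List α} {f : γ → α → β} (hf : PTime fun x : γ × α => f x.1 x.2)
    (hl : PTime l) : PTime fun c => (l c).map (f c) := by
  obtain ⟨q, hq⟩ := hf.bound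
  obtain ⟨q', hq'⟩ := hl.bound
  have := (PTime.foldl (s := fun c (acc : List β) a => f c a :: acc) (i := fun _ => [])
    -- The fold builds the list in reverse. Each entry is bounded through `q` by the size of the
    -- context and the list, and the number of entries by the size of the list.
    (l := l) (by
      have := hf.comp (f := fun x : γ × α => f x.1 x.2)
        (g := fun x : γ × List β × α => (x.1, x.2.2)) (by fun_prop)
      fun_prop) (by fun_prop) hl (q' * (q.comp (.X + q' + 1) + 1) + 1) (fun c l' h => by
      have h1 : (l'.foldl (fun (acc : List β) a => f c a :: acc) []) = (l'.map (f c)).reverse := by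
        rw [← List.foldl_map (f := f c) (g := fun acc b => b :: acc)]
        simp
      rw [h1, sz_reverse]
      have h2 := sz_list_le (l'.map (f c)) (q.eval (sz c + q'.eval (sz c) + 1)) (fun b hb => by
        obtain ⟨a, ha, rfl⟩ := List.mem_map.1 hb
        refine (hq (c, a)).trans (q.eval_mono_nat ?_)
        have := sz_le_of_mem (h.subset ha)
        have := hq' c
        simp only [sz_prod]
        omega)
      refine h2.trans ?_
      simp only [Polynomial.eval_add, Polynomial.eval_mul, Polynomial.eval_X,
        Polynomial.eval_comp, Polynomial.eval_one, List.length_map]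
      gcongr
      exact h.length_le.trans ((length_lt_sz _).le.trans (hq' c)))).reverse
  convert this with c
  rw [← List.foldl_map (f := f c) (g := fun acc b => b :: acc)]
  simp

@[fun_prop]
theorem PTime.flatten {l : γ → List (List α)} (hl : PTime l) : PTime fun c => (l c).flatten := by
  suffices PTime fun l : List (List α) => l.flatten from this.comp hl
  have e : ∀ (l : List (List α)) (acc : List α),
      l.foldl (fun acc a => acc ++ a) acc = acc ++ l.flatten := by
    intro l
    induction l with
    | nil => simp
    | cons a l ih => intro acc; simp [ih]
  have e' : ∀ l : List (List α), sz l.flatten ≤ sz l := by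
    intro l
    induction l with
    | nil => simp
    | cons a l ih =>
      have := sz_append a l.flatten
      simp only [List.flatten_cons, sz_cons]
      omega
  have := PTime.foldl (γ := List (List α)) (s := fun _ (acc : List α) a => acc ++ a)
    (i := fun _ => []) (l := fun l => l) (by fun_prop) (by fun_prop) (by fun_prop) .X
    (fun l l' h => by
      have := sz_le_of_sublist h.sublist
      have := e' l'
      rw [e]
      simp
      omega)
  simpa [e] using this

theorem PTime.flatMap {l : γ → List α} {f : γ → α → List β}
    (hf : PTime fun x : γ × α => f x.1 x.2) (hl : PTime l) :
    PTime fun c => (l c).flatMap (f c) := by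
  simpa only [List.flatMap_def] using (PTime.map hf hl).flatten

-- Numbers are represented in unary, so a number and the list of that many units have the same tree.
-- A loop over the unit list is a loop with a counter.
@[fun_prop]
theorem PTime.replicateUnit {f : α → ℕ} (hf : PTime f) : PTime fun x => List.replicate (f x) () :=
  hf

@[fun_prop]
theorem PTime.length {l : γ → List α} (hl : PTime l) : PTime fun c => (l c).length := by
  have := PTime.map (f := fun _ _ => ()) (by fun_prop) hl
  suffices PTime fun c => List.replicate (l c).length () from this
  convert this with c
  simp

@[fun_prop]
theorem PTime.succ {f : α → ℕ} (hf : PTime f) : PTime fun x => f x + 1 := by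
  have := (PTime.const ()).cons hf.replicateUnit
  exact this

@[fun_prop]
theorem PTime.drop {l : γ → List α} {i : γ → ℕ} (hl : PTime l) (hi : PTime i) :
    PTime fun c => (l c).drop (i c) := by
  suffices PTime fun c : List α × ℕ => c.1.drop c.2 from this.comp (hl.prodMk hi)
  have e : ∀ (n : ℕ) (l : List α), (List.replicate n ()).foldl (fun l _ => l.tail) l = l.drop n := by
    intro n
    induction n with
    | zero => simp
    | succ n ih => intro l; simp [List.replicate_succ, ih]
  have := PTime.foldl (γ := List α × ℕ) (s := fun _ (l : List α) (_ : Unit) => l.tail)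
    (i := fun c => c.1) (l := fun c => List.replicate c.2 ()) (by fun_prop) (by fun_prop)
    (by fun_prop) .X (fun c l' h => by
      obtain ⟨n, rfl⟩ : ∃ n, l' = List.replicate n () := ⟨l'.length, List.eq_replicate_length.2 fun _ _ => rfl⟩
      rw [e]
      have := sz_le_of_sublist (List.drop_sublist n c.1)
      simp only [sz_prod, Polynomial.eval_X]
      omega)
  simpa [e] using this

@[fun_prop]
theorem PTime.getD {l : γ → List α} {i : γ → ℕ} {d : γ → α} (hl : PTime l) (hi : PTime i)
    (hd : PTime d) : PTime fun c => (l c).getD (i c) (d c) := by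
  have : PTime fun c => ((l c).drop (i c)).headD (d c) := by fun_prop
  convert this with c
  rw [List.headD_eq_head?_getD, List.head?_drop, List.getD_eq_getElem?_getD]

@[fun_prop]
theorem PTime.sub {f g : α → ℕ} (hf : PTime f) (hg : PTime g) : PTime fun x => f x - g x := by
  have : PTime fun x => ((List.replicate (f x) ()).drop (g x)).length := by fun_prop
  simpa using this

@[fun_prop]
theorem PTime.decideLe {f g : α → ℕ} (hf : PTime f) (hg : PTime g) :
    PTime fun x => decide (f x ≤ g x) := by
  have : PTime fun x => decide (f x - g x = 0) := by fun_prop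
  simpa only [Nat.sub_eq_zero_iff_le] using this

@[fun_prop]
theorem PTime.decideLt {f g : α → ℕ} (hf : PTime f) (hg : PTime g) :
    PTime fun x => decide (f x < g x) := by
  have : PTime fun x => decide (f x + 1 ≤ g x) := by fun_prop
  exact this

@[fun_prop]
theorem PTime.range {f : α → ℕ} (hf : PTime f) : PTime fun x => List.range (f x) := by
  suffices PTime fun n : ℕ => List.range n from this.comp hf
  have e : ∀ n : ℕ, (List.replicate n ()).foldl
      (fun (s : ℕ × List ℕ) _ => (s.1 + 1, s.1 :: s.2)) (0, []) = (n, (List.range n).reverse) := by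
    intro n
    induction n with
    | zero => rfl
    | succ n ih => simp [List.replicate_succ', ih, List.range_succ]
  have := (PTime.foldl (γ := ℕ)
    (s := fun _ (s : ℕ × List ℕ) (_ : Unit) => (s.1 + 1, s.1 :: s.2)) (i := fun _ => (0, []))
    (l := fun n => List.replicate n ()) (by fun_prop) (by fun_prop) (by fun_prop)
    (.X + .X * (.X + 1) + 2) (fun n l' h => by
      obtain ⟨k, rfl⟩ : ∃ n, l' = List.replicate n () := ⟨l'.length, List.eq_replicate_length.2 fun _ _ => rfl⟩
      have hk : k ≤ n := by simpa using h.length_le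
      rw [e]
      have h1 := sz_list_le (List.range k) (sz n) (fun b hb => by
        simp only [List.mem_range] at hb
        simp only [sz_nat]
        omega)
      have h2 : k * (sz n + 1) ≤ sz n * (sz n + 1) := by
        gcongr
        simp only [sz_nat]
        omega
      simp only [List.length_range] at h1
      simp only [sz_prod, sz_reverse, Polynomial.eval_add, Polynomial.eval_mul,
        Polynomial.eval_X, Polynomial.eval_one, Polynomial.eval_ofNat]
      have : sz k ≤ sz n := by simp only [sz_nat]; omega
      omega)).snd.reverse
  simpa [e] using this

theorem PTime.countP {l : γ → List α} {p : γ → α → Bool} (hp : PTime fun x : γ × α => p x.1 x.2)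
    (hl : PTime l) : PTime fun c => (l c).countP (p c) := by
  have h1 : PTime fun c => ((l c).flatMap fun a => if p c a = true then [()] else []).length :=
    (PTime.flatMap (f := fun c a => if p c a = true then [()] else []) (by fun_prop) hl).length
  convert h1 with c
  induction l c with
  | nil => rfl
  | cons a l ih => by_cases h : p c a = true <;> simp [h, ih]

/-- Types for which the element represented by a tree can be computed in polynomial time. -/
class PolyDec (α : Type) [Coded α] : Prop where
  ptime_ofS : PTime (ofS : Sexp → α)

theorem ptime_ofS [PolyDec α] {f : γ → Sexp} (hf : PTime f) :
    PTime fun x => (ofS (f x) : α) := PolyDec.ptime_ofS.comp hf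

instance : PolyDec Bool where
  ptime_ofS := by
    have : PTime fun d : Sexp => !decide (d = .nil) := by fun_prop
    convert this with d
    cases d <;> simp [ofS]

instance [PolyDec α] [PolyDec β] : PolyDec (α × β) where
  ptime_ofS := (ptime_ofS ptime_hd).prodMk (ptime_ofS ptime_tl)

/-- Following second components, every tree can be read as a list of trees. Decoding a list thus
amounts to decoding its entries. -/
theorem listToS_listOfS (d : Sexp) : listToS (listOfS d : List Sexp) = d := by
  induction d with
  | nil => rfl
  | cons a b _ ih => simp [listToS, listOfS, ih, toS, ofS]

instance [PolyDec α] : PolyDec (List α) where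
  ptime_ofS := by
    have h : PTime fun d : Sexp => (listOfS d : List Sexp) :=
      PTime.of_toS PTime.id fun d => (listToS_listOfS d).symm
    have := PTime.map (f := fun _ d => (ofS d : α)) (ptime_ofS PTime.id.snd) h
    convert this with d
    induction d with
    | nil => rfl
    | cons a b _ ih => simpa [ofS, listOfS] using ih

instance : PolyDec Unit where
  ptime_ofS := PTime.const ()

instance : PolyDec ℕ where
  ptime_ofS := by
    have : PTime fun d : Sexp => (ofS d : List Unit).length := (ptime_ofS PTime.id).length
    exact this

end StackProg
end

/-! ### Parsing, input and output of the machines, and a criterion for membership in `NP`. -/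

noncomputable section

namespace StackProg

open Function Prog Sexp
open Coded (toS ofS ofS_toS)

/-- Read trees in Polish notation from the end of a word, collecting them on a stack. -/
def parseStack (w : List Bool) : List Sexp :=
  w.foldr (fun b st => if b = true then .cons (st.headD .nil) (st.tail.headD .nil) :: st.tail.tail
    else .nil :: st) []

/-- The tree whose Polish notation is a given word. -/
def parse (w : List Bool) : Sexp := (parseStack w).headD .nil

/-- Read from the right, the operands of a node are on the stack before its symbol is met, as in the
evaluation of Polish notation. -/
theorem parseStack_enc_append (d : Sexp) (w : List Bool) :
    parseStack (d.enc ++ w) = d :: parseStack w := by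
  induction d generalizing w with
  | nil => rfl
  | cons a b iha ihb =>
    have h : parseStack (a.enc ++ (b.enc ++ w)) = a :: b :: parseStack w := by rw [iha, ihb]
    rw [Sexp.enc, List.cons_append, List.append_assoc, parseStack, List.foldr_cons, ← parseStack, h]
    simp

theorem parse_enc (d : Sexp) : parse d.enc = d := by
  have := parseStack_enc_append d []
  rw [List.append_nil] at this
  simp [parse, this]

/-- Ill-formed words are parsed too, with `nil` for missing operands. The worst symbol is a `true`
that meets the empty stack, which adds 4. -/
theorem sz_parseStack_le (w : List Bool) : sz (parseStack w) ≤ 4 * w.length + 1 := by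
  induction w with
  | nil => simp [parseStack]
  | cons b w ih =>
    have h : parseStack (b :: w) = if b = true then
      .cons ((parseStack w).headD .nil) ((parseStack w).tail.headD .nil) :: (parseStack w).tail.tail
      else .nil :: parseStack w := rfl
    have e : ∀ a b : Sexp, sz (Sexp.cons a b) = sz a + sz b + 1 := fun _ _ => rfl
    have e' : sz Sexp.nil = 1 := rfl
    rw [h]
    generalize parseStack w = st at *
    rcases b with _ | _ <;> rcases st with _ | ⟨x, _ | ⟨y, st⟩⟩ <;>
      simp [e, e'] at * <;> omega

theorem PTime.parse : PTime parse := by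
  have h := PTime.foldl (γ := List Bool)
    (s := fun _ (st : List Sexp) b => if b = true then
      (Sexp.cons (st.headD .nil) (st.tail.headD .nil)) :: st.tail.tail else Sexp.nil :: st)
    (i := fun _ => []) (l := fun w => w.reverse)
    (by
      have : PTime fun p : List Bool × List Sexp × Bool =>
          (Sexp.cons (p.2.1.headD .nil) (p.2.1.tail.headD .nil)) := by
        have : PTime fun p : List Bool × List Sexp × Bool =>
          ((p.2.1.headD .nil), (p.2.1.tail.headD .nil)) := by fun_prop
        exact this
      fun_prop) (by fun_prop) (by fun_prop) (4 * .X + 1) (fun w l' h => by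
      have := sz_parseStack_le l'.reverse
      have h2 := length_lt_sz w
      have h3 := h.length_le
      simp only [parseStack, List.foldr_reverse, List.length_reverse] at this h3
      simp only [Polynomial.eval_add, Polynomial.eval_mul, Polynomial.eval_X, Polynomial.eval_one,
        Polynomial.eval_ofNat]
      omega)
  have h' : PTime fun w : List Bool => (parseStack w).headD .nil := by
    simp only [List.foldl_reverse] at h
    exact PTime.headD h (by fun_prop)
  exact h'

/-- Read a pair of words from the input. -/
def readPair : TProg :=
  seq (pop .inp fun v x => (v.1, v.2.1, x)) (seq (loop (fun v => v.2.2.isSome)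
    (seq (ite (fun v => v.2.2 == some none) (push .t fun _ => false)
      (seq (push .t fun _ => true) (ite (fun v => v.2.2 == some (some true))
        (seq (push .t fun _ => true) (seq (push .t fun _ => false) (push .t fun _ => false)))
        (push .t fun _ => false))))
      (pop .inp fun v x => (v.1, v.2.1, x))))
    (seq (push .t fun _ => false) (seq (drain popT pushMain) (pushSym true))))

/-- The part of the representation of a pair of words that comes from one input symbol. -/
def symWord : Option Bool → List Bool
  | none => [false]
  | some b => true :: word b

/-- The code of the pair can be produced symbol by symbol from the input: the separator becomes the
end of the first list, and only one leading and one final symbol are missing. -/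
theorem flatMap_symWord (p : List Bool × List Bool) :
    true :: ((encodePair p).flatMap symWord ++ [false]) = word p := by
  obtain ⟨x, w⟩ := p
  have h : ∀ l : List Bool, (l.map some).flatMap symWord ++ [false] = word l := by
    intro l
    induction l with
    | nil => rfl
    | cons b l ih =>
      change true :: word b ++ _ ++ _ = true :: (word b ++ word l)
      rw [← ih, List.append_assoc]
      rfl
  have h' : word (x, w) = true :: (word x ++ word w) := rfl
  rw [h', ← h x, ← h w]
  simp [encodePair, symWord]

theorem length_symWord_le (s : Option Bool) : (symWord s).length ≤ 4 := by
  rcases s with _ | _ | _ <;> simp [symWord, word, toS, ofBool, Sexp.enc]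

theorem length_flatMap_symWord_le (s : List (Option Bool)) :
    (s.flatMap symWord).length ≤ 4 * s.length := by
  induction s with
  | nil => simp
  | cons a s ih =>
    have := length_symWord_le a
    simp only [List.flatMap_cons, List.length_append, List.length_cons]
    omega

theorem sz_pair_le (p : List Bool × List Bool) : sz p ≤ 4 * (encodePair p).length + 2 := by
  have h := congrArg List.length (flatMap_symWord p)
  have := length_flatMap_symWord_le (encodePair p)
  simp only [word, length_enc, List.length_cons, List.length_append, List.length_nil] at h
  unfold sz
  omega

theorem runs_readPair (p : List Bool × List Bool) (v : Reg) :
    ∃ v', Runs readPair v (stk (encodePair p) [] [] [] [] []) v' (mainStk (word p))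
      (21 * (encodePair p).length + 10) := by
  have hpop : ∀ (i : List (Option Bool)) (t : List Bool) (v : Reg),
      Runs (pop .inp fun v x => (v.1, v.2.1, x)) v (stk i [] t [] [] []) (v.1, v.2.1, i.head?)
        (stk i.tail [] t [] [] []) 1 := fun i t v => Runs.pop rfl (by simp)
  have hpush : ∀ (b : Bool) (i : List (Option Bool)) (t : List Bool) (v : Reg),
      Runs (push .t fun _ => b) v (stk i [] t [] [] []) v (stk i [] (b :: t) [] [] []) 1 :=
    fun b i t v => Runs.push (by simp)
  have key : ∀ (i : List (Option Bool)) (t : List Bool) (v : Reg),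
      Runs (loop (fun v => v.2.2.isSome) (seq (Prog.ite (fun v : Reg => v.2.2 == some none)
        (push .t fun _ => false) (seq (push .t fun _ => true)
          (Prog.ite (fun v => v.2.2 == some (some true))
          (seq (push .t fun _ => true) (seq (push .t fun _ => false) (push .t fun _ => false)))
          (push .t fun _ => false))))
        (pop .inp fun v x => (v.1, v.2.1, x)))) (v.1, v.2.1, i.head?) (stk i.tail [] t [] [] [])
        (v.1, v.2.1, none) (stk [] [] ((i.flatMap symWord).reverse ++ t) [] [] [])
        (8 * i.length + 1) := by
    intro i
    induction i with
    | nil => exact fun t v => Runs.loop_false rfl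
    | cons s i ih =>
      intro t v
      have h := ih ((symWord s).reverse ++ t) v
      simp only [List.flatMap_cons, List.reverse_append, List.append_assoc, List.length_cons]
      refine (Runs.loop_true (c := fun v : Reg => v.2.2.isSome) (v := (v.1, v.2.1, some s)) rfl
        (Runs.seq (N := 6) ?_ (hpop i ((symWord s).reverse ++ t) (v.1, v.2.1, some s))) h).mono (by omega)
      rcases s with _ | _ | _
      · exact Runs.mono (N := 2) (Runs.ite_true rfl (hpush _ _ _ _)) (by omega)
      · exact Runs.mono (N := 4) (Runs.ite_false rfl ((hpush _ _ _ _).seq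
          (Runs.ite_false rfl (hpush _ _ _ _)))) (by omega)
      · exact Runs.ite_false rfl ((hpush _ _ _ _).seq
          (Runs.ite_true rfl ((hpush _ _ _ _).seq ((hpush _ _ _ _).seq (hpush _ _ _ _)))))
  have hl := length_flatMap_symWord_le (encodePair p)
  have h₁ := hpop (encodePair p) [] v
  have h₂ := key (encodePair p) [] v
  have h₃ := hpush false [] (((encodePair p).flatMap symWord).reverse ++ []) (v.1, v.2.1, none)
  obtain ⟨v₄, h₄⟩ := runs_pourT [] (false :: (((encodePair p).flatMap symWord).reverse ++ []))
    [] [] (v.1, v.2.1, none)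
  have h₅ := runs_pushSym true
    ((false :: (((encodePair p).flatMap symWord).reverse ++ [])).reverse ++ []) [] [] [] v₄
  have e : true :: ((false :: (((encodePair p).flatMap symWord).reverse ++ [])).reverse ++ []) =
      word p := by
    rw [← flatMap_symWord]
    simp
  rw [e] at h₅
  refine ⟨v₄, (h₁.seq (h₂.seq (h₃.seq (h₄.seq h₅)))).mono ?_⟩
  simp only [List.length_cons, List.length_append, List.length_reverse, List.length_nil]
  omega

/-- Write the truth value on the main stack to the output, and clean up. -/
def writeBool : TProg :=
  seq popMain (seq (push .out fun v => v.1.getD false) (seq (drain popMain skip')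
    (load fun _ => (none, none, none))))
where
  /-- Do nothing. -/
  skip' : TProg := load id

theorem runs_writeBool (b : Bool) (v : Reg) :
    Runs writeBool v (mainStk (word b)) (none, none, none) (stk [] [] [] [] [] [b]) 20 := by
  have h₁ := runs_popMain (word b) [] [] [] v
  have h₂ : ∀ (m : List Bool) (v : Reg), v.1 = some b →
      Runs (push .out fun v => v.1.getD false) v (stk [] m [] [] [] []) v (stk [] m [] [] [] [b]) 1 :=
    fun m v hv => Runs.push (by simp [hv])
  have h₃ := fun v : Reg => runs_drain (F := fun l _ => stk [] l [] [] [] [b]) (pp := popMain)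
    (ps := writeBool.skip') (fun l _ v => Runs.pop rfl (by simp)) (fun _ _ _ _ _ => Runs.load)
    (word b).tail [] v
  obtain ⟨v', h₃⟩ := h₃ ((word b).head?, v.2)
  refine (h₁.seq ((h₂ _ _ ?_).seq (h₃.seq Runs.load))).mono ?_
  · cases b <;> rfl
  · cases b <;> simp [word, toS, ofBool, Sexp.enc]

open Turing in
/-- The Turing machine that runs a program on a pair of words. -/
def machine (p : TProg) : FinTM2 where
  K := Stk
  k₀ := .inp
  k₁ := .out
  Γ := Sym
  Λ := Lab (seq readPair (seq p writeBool))
  main := entry _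
  σ := Reg
  initialState := (none, none, none)
  m := code (seq readPair (seq p writeBool)) (fun l => l) .halt

open Turing in
theorem PTime.computable {V : List Bool × List Bool → Bool} (hV : PTime V) :
    Nonempty (TM2ComputableInPolyTime encodePair Computability.encodeBool V) := by
  obtain ⟨p, q, h⟩ := hV
  refine ⟨⟨⟨machine p, Equiv.refl _, Equiv.refl _⟩, 21 * .X + 30 + q.comp (4 * .X + 2), fun a => ?_⟩⟩
  have H : ∃ n ≤ 21 * (encodePair a).length + 30 + q.eval (4 * (encodePair a).length + 2),
      Exec (seq readPair (seq p writeBool)) (none, none, none) (stk (encodePair a) [] [] [] [] [])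
        (none, none, none) (stk [] [] [] [] [] [V a]) n := by
    obtain ⟨v₁, h₁⟩ := runs_readPair a (none, none, none)
    obtain ⟨v₂, h₂⟩ := (h a).2 [] v₁
    simp only [List.append_nil] at h₂
    have := q.eval_mono_nat (sz_pair_le a)
    exact (h₁.seq (h₂.seq (runs_writeBool (V a) v₂))).mono (by omega)
  refine ⟨⟨H.choose, ?_⟩, ?_⟩
  · have := H.choose_spec.2.steps (machine p).m (fun l => l) .halt fun _ => rfl
    unfold Steps at this
    have e₀ : (List.map (Equiv.refl (Option Bool)).invFun (encodePair a)) = encodePair a := by simp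
    have e₁ : initList (machine p) (encodePair a) =
        ⟨some (entry _), (none, none, none), stk (encodePair a) [] [] [] [] []⟩ := by
      unfold initList
      congr 1
      funext k
      cases k <;> rfl
    -- A halting configuration has the initial register and only the output stack filled, hence the
    -- cleaning up in `writeBool`.
    have e₂ : haltList (machine p) [V a] =
        ⟨none, (none, none, none), stk [] [] [] [] [] [V a]⟩ := by
      unfold haltList
      congr 1
      funext k
      cases k <;> rfl
    exact (congrArg _ (congrArg some ((congrArg (initList (machine p)) e₀).trans e₁))).trans (this.trans (congrArg some e₂.symm))
  · simpa using H.choose_spec.1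

/-- Certificates may be structured data: they are written in Polish notation, and the verifier
decodes them. Decoding is total, so a word that codes nothing still yields some certificate, and
`sound` applies to it. -/
theorem mem_NP {α : Type} [Coded α] [PolyDec α] {L : Language Bool} {V : List Bool × α → Bool}
    (hV : PTime V) (q : Polynomial ℕ) (sound : ∀ x c, V (x, c) = true → x ∈ L)
    (complete : ∀ x ∈ L, ∃ c, sz c ≤ q.eval x.length ∧ V (x, c) = true) : L ∈ NP := by
  refine ⟨q, fun p => V (p.1, ofS (parse p.2)), PTime.computable ?_, fun x => ⟨fun hx => ?_, ?_⟩⟩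
  · have : PTime fun p : List Bool × List Bool => (ofS (parse p.2) : α) :=
      ptime_ofS (PTime.parse.comp PTime.id.snd)
    fun_prop
  · obtain ⟨c, hc, h⟩ := complete x hx
    exact ⟨(toS c).enc, by rwa [length_enc], by
      change V (x, ofS (parse (toS c).enc)) = true
      rwa [parse_enc, ofS_toS]⟩
  · rintro ⟨w, -, h⟩
    exact sound x _ h

end StackProg
end

/-! ### Arithmetic of binary numbers in polynomial time. -/

noncomputable section

namespace StackProg

/-- The number with given binary digits, least significant first. -/
def bitsVal (l : List Bool) : ℕ := l.foldr Nat.bit 0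

@[simp] theorem bitsVal_nil : bitsVal [] = 0 := rfl

@[simp] theorem bitsVal_cons (b : Bool) (l : List Bool) :
    bitsVal (b :: l) = 2 * bitsVal l + b.toNat := by
  rw [← Nat.bit_val]
  rfl

@[simp] theorem bitsVal_bits (n : ℕ) : bitsVal n.bits = n := by
  induction n using Nat.binaryRec' with
  | zero => simp
  | bit b n h ih => rw [Nat.bits_append_bit n b h, bitsVal_cons, ih, Nat.bit_val]

/-- The hypothesis says that the most significant digit is 1. It lets the verifier recognise
canonical reload times, so that its encoding is that of an actual instance. -/
theorem bits_bitsVal {l : List Bool} (h : l.reverse.headD false = true) :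
    0 < bitsVal l ∧ (bitsVal l).bits = l := by
  induction l with
  | nil => simp at h
  | cons b l ih =>
    rcases eq_or_ne l [] with rfl | hl
    · have : b = true := by simpa using h
      subst this
      simp
    · have h' : l.reverse.headD false = true := by
        obtain ⟨x, l', e⟩ := List.exists_cons_of_ne_nil (List.reverse_ne_nil_iff.2 hl)
        simpa [e] using h
      obtain ⟨h1, h2⟩ := ih h'
      refine ⟨by rw [bitsVal_cons]; omega, ?_⟩
      rw [bitsVal_cons, ← Nat.bit_val, Nat.bits_append_bit _ _ (by omega), h2]

theorem headD_reverse_bits {n : ℕ} (h : 0 < n) : n.bits.reverse.headD false = true := by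
  induction n using Nat.binaryRec' with
  | zero => simp at h
  | bit b n hn ih =>
    rw [Nat.bits_append_bit n b hn]
    rcases Nat.eq_zero_or_pos n with rfl | h'
    · simp [hn rfl]
    · have hl : n.bits ≠ [] := by
        intro e
        have := bitsVal_bits n
        rw [e] at this
        simp at this
        omega
      obtain ⟨x, l', e⟩ := List.exists_cons_of_ne_nil (List.reverse_ne_nil_iff.2 hl)
      simpa [e] using ih h'

theorem length_bits_le {n k : ℕ} (h : n < 2 ^ k) : n.bits.length ≤ k := by
  rw [Nat.size_eq_bits_len]
  exact Nat.size_le.2 h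

theorem sz_bits_le {n k : ℕ} (h : n < 2 ^ k) : sz n.bits ≤ 4 * k + 1 := by
  have h1 := sz_list_le n.bits 3 fun b _ => sz_bool_le b
  have := length_bits_le h
  omega

/-- The increment of a binary number. -/
def incBits (l : List Bool) : List Bool :=
  let s := l.foldl (fun s b => (s.1 && b, Bool.xor s.1 b :: s.2)) (true, [])
  s.2.reverse ++ if s.1 = true then [true] else []

theorem incBits_bits (n : ℕ) : incBits n.bits = (n + 1).bits := by
  -- The claim is generalised to an arbitrary carry `c` and to digits `acc` already produced.
  have h : ∀ (n : ℕ) (c : Bool) (acc : List Bool),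
      (n.bits.foldl (fun s b => (s.1 && b, Bool.xor s.1 b :: s.2)) (c, acc)).2.reverse ++
      (if (n.bits.foldl (fun s b => (s.1 && b, Bool.xor s.1 b :: s.2)) (c, acc)).1 = true
        then [true] else []) = acc.reverse ++ (n + c.toNat).bits := by
    intro n
    induction n using Nat.binaryRec' with
    | zero => intro c acc; cases c <;> simp
    | bit b n hn ih =>
      intro c acc
      rw [Nat.bits_append_bit n b hn, List.foldl_cons, ih, List.reverse_cons, List.append_assoc]
      congr 1
      have e : Nat.bit b n + c.toNat = Nat.bit (Bool.xor c b) (n + (c && b).toNat) := by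
        rw [Nat.bit_val, Nat.bit_val]
        cases b <;> cases c <;> simp; ring
      rw [e, Nat.bits_append_bit]
      · rfl
      · intro h
        have : n = 0 := by omega
        have hb := hn this
        subst hb
        cases c <;> simp at h ⊢
  simpa [incBits] using h n true []

theorem sz_bool_list_le (l : List Bool) : sz l ≤ 4 * l.length + 1 := by
  have h1 := sz_list_le l 3 fun b _ => sz_bool_le b
  omega

@[fun_prop]
theorem PTime.incBits {α : Type} [Coded α] {f : α → List Bool} (hf : PTime f) :
    PTime fun x => incBits (f x) := by
  suffices PTime fun l : List Bool => StackProg.incBits l from this.comp hf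
  have h := PTime.foldl (γ := List Bool) (β := Bool × List Bool)
    (s := fun _ s (b : Bool) => (s.1 && b, Bool.xor s.1 b :: s.2)) (i := fun _ => (true, []))
    (l := fun l => l) (by fun_prop) (by fun_prop) (by fun_prop) (4 * .X + 5) (fun l l' hl => by
      have e : ∀ (l : List Bool) (s : Bool × List Bool),
          (l.foldl (fun s b => (s.1 && b, Bool.xor s.1 b :: s.2)) s).2.length =
            l.length + s.2.length := by
        intro l
        induction l with
        | nil => simp
        | cons a l ih => intro s; simp [ih]; ring
      have h1 := sz_bool_list_le (l'.foldl (fun s b => (s.1 && b, Bool.xor s.1 b :: s.2))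
        (true, [])).2
      have h2 := sz_bool_le (l'.foldl (fun (s : Bool × List Bool) b =>
        (s.1 && b, Bool.xor s.1 b :: s.2)) (true, [])).1
      rw [e] at h1
      have h3 := hl.length_le
      have h4 := length_lt_sz l
      simp only [sz_prod, Polynomial.eval_add, Polynomial.eval_mul, Polynomial.eval_X,
        Polynomial.eval_ofNat, List.length_nil] at *
      omega)
  unfold StackProg.incBits
  fun_prop

@[fun_prop]
theorem PTime.bits {α : Type} [Coded α] {f : α → ℕ} (hf : PTime f) :
    PTime fun x => (f x).bits := by
  suffices PTime fun n : ℕ => n.bits from this.comp hf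
  have e : ∀ n : ℕ, (List.replicate n ()).foldl (fun l _ => StackProg.incBits l) [] = n.bits := by
    intro n
    induction n with
    | zero => simp
    | succ n ih => simp [List.replicate_succ', ih, incBits_bits]
  have h := PTime.foldl (γ := ℕ) (s := fun _ l (_ : Unit) => StackProg.incBits l)
    (i := fun _ => []) (l := fun n => List.replicate n ()) (by fun_prop) (by fun_prop)
    (by fun_prop) (4 * .X + 5) (fun n l' h => by
      obtain ⟨k, rfl⟩ : ∃ n, l' = List.replicate n () :=
        ⟨l'.length, List.eq_replicate_length.2 fun _ _ => rfl⟩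
      have hk : k ≤ n := by simpa using h.length_le
      rw [e]
      have := sz_bits_le (Nat.lt_two_pow_self (n := k))
      simp only [Polynomial.eval_add, Polynomial.eval_mul, Polynomial.eval_X,
        Polynomial.eval_ofNat, sz_nat]
      omega)
  simpa only [e] using h

/-- One step of the subtraction of binary numbers: the state consists of the remaining digits of
the subtrahend, the borrow, and the digits of the difference. -/
def subStep (s : List Bool × Bool × List Bool) (x : Bool) : List Bool × Bool × List Bool :=
  (s.1.tail, if x = true then s.1.headD false && s.2.1 else s.1.headD false || s.2.1,
    Bool.xor x (Bool.xor (s.1.headD false) s.2.1) :: s.2.2)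

/-- The truncated difference of binary numbers. -/
def subBits (a b : List Bool) : List Bool :=
  if ((a.foldl subStep (b, false, [])).2.1 || (a.foldl subStep (b, false, [])).1.any (fun b => b))
    = true then [] else (a.foldl subStep (b, false, [])).2.2.reverse

theorem any_iff_bitsVal (l : List Bool) : l.any (fun b => b) = true ↔ 0 < bitsVal l := by
  induction l with
  | nil => simp
  | cons b l ih =>
    rw [List.any_cons, Bool.or_eq_true, ih, bitsVal_cons]
    cases b <;> simp

theorem bitsVal_append (l l' : List Bool) :
    bitsVal (l ++ l') = bitsVal l + 2 ^ l.length * bitsVal l' := by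
  induction l with
  | nil => simp
  | cons b l ih => simp only [List.cons_append, bitsVal_cons, ih, List.length_cons]; ring

/-- The invariant of subtraction with borrow `w`. A final borrow, or nonzero digits of `b` left
over, means that the difference is negative; otherwise the digits produced satisfy the subtraction
identity, shifted by the length of `acc`. -/
theorem foldl_subStep (a b : List Bool) (w : Bool) (acc : List Bool) :
    ((a.foldl subStep (b, w, acc)).2.1 = true ∨ 0 < bitsVal (a.foldl subStep (b, w, acc)).1 →
      bitsVal a < bitsVal b + w.toNat) ∧
    ((a.foldl subStep (b, w, acc)).2.1 = false → bitsVal (a.foldl subStep (b, w, acc)).1 = 0 →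
      bitsVal (a.foldl subStep (b, w, acc)).2.2.reverse + 2 ^ acc.length * (bitsVal b + w.toNat) =
        bitsVal acc.reverse + 2 ^ acc.length * bitsVal a) := by
  induction a generalizing b w acc with
  | nil =>
    cases w <;> simp
  | cons x a ih =>
    rw [List.foldl_cons]
    have hb : bitsVal b = 2 * bitsVal b.tail + (b.headD false).toNat := by cases b <;> simp
    obtain ⟨h1, h2⟩ := ih b.tail
      (if x = true then b.headD false && w else b.headD false || w)
      (Bool.xor x (Bool.xor (b.headD false) w) :: acc)
    have e : subStep (b, w, acc) x = (b.tail,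
      if x = true then b.headD false && w else b.headD false || w,
      Bool.xor x (Bool.xor (b.headD false) w) :: acc) := rfl
    rw [e]
    clear e ih
    generalize List.foldl subStep _ a = R at *
    refine ⟨fun h => ?_, fun h h' => ?_⟩
    · have := h1 h
      clear h1 h2 h
      rw [hb, bitsVal_cons]
      generalize b.headD false = y at *
      cases x <;> cases y <;> cases w <;> simp at * <;> omega
    · have := h2 h h'
      clear h1 h2 h h'
      rw [hb, bitsVal_cons]
      rw [List.reverse_cons, bitsVal_append] at this
      simp only [List.length_cons, List.length_reverse, bitsVal_cons, bitsVal_nil, pow_succ] at this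
      generalize b.headD false = y at *
      cases x <;> cases y <;> cases w <;> simp at * <;> linarith

theorem bitsVal_subBits (a b : List Bool) : bitsVal (subBits a b) = bitsVal a - bitsVal b := by
  obtain ⟨h1, h2⟩ := foldl_subStep a b false []
  unfold subBits
  split_ifs with h
  · rw [Bool.or_eq_true, any_iff_bitsVal] at h
    have := h1 h
    simp at this ⊢
    omega
  · rw [Bool.or_eq_true, any_iff_bitsVal, not_or] at h
    have := h2 (by simpa using h.1) (by omega)
    simp at this ⊢
    omega

@[fun_prop]
theorem PTime.subBits {α : Type} [Coded α] {f g : α → List Bool} (hf : PTime f) (hg : PTime g) :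
    PTime fun x => subBits (f x) (g x) := by
  suffices PTime fun c : List Bool × List Bool => StackProg.subBits c.1 c.2 from
    this.comp (hf.prodMk hg)
  have h := PTime.foldl (γ := List Bool × List Bool)
    (s := fun _ => subStep) (i := fun c => (c.2, false, []))
    (l := fun c => c.1) (by unfold subStep; fun_prop) (by fun_prop) (by fun_prop) (5 * .X + 10)
    (fun c l' hl => by
      have e : ∀ (l : List Bool) (s : List Bool × Bool × List Bool),
          (l.foldl subStep s).2.2.length = l.length + s.2.2.length ∧
          sz (l.foldl subStep s).1 ≤ sz s.1 := by
        intro l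
        induction l with
        | nil => simp
        | cons a l ih =>
          intro s
          obtain ⟨h1, h2⟩ := ih (subStep s a)
          refine ⟨by rw [List.foldl_cons, h1]; simp [subStep]; ring, h2.trans ?_⟩
          exact sz_le_of_sublist (List.tail_sublist _)
      obtain ⟨e1, e2⟩ := e l' (c.2, false, [])
      have h1 := sz_bool_list_le (l'.foldl subStep (c.2, false, [])).2.2
      have h2 := sz_bool_le (l'.foldl subStep (c.2, false, [])).2.1
      have h3 := hl.length_le
      have h4 := length_lt_sz c.1
      rw [e1] at h1
      simp only [sz_prod, Polynomial.eval_add, Polynomial.eval_mul, Polynomial.eval_X,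
        Polynomial.eval_ofNat, List.length_nil] at *
      omega)
  have h' : PTime fun c : List Bool × List Bool =>
      (c.1.foldl subStep (c.2, false, [])).1.any (fun b => b) :=
    PTime.any (p := fun _ b => b) (by fun_prop) (by fun_prop)
  unfold StackProg.subBits
  fun_prop

/-- Comparison of binary numbers. -/
def leBits (a b : List Bool) : Bool := !((subBits a b).any (fun b => b))

theorem leBits_iff (a b : List Bool) : leBits a b = true ↔ bitsVal a ≤ bitsVal b := by
  rw [leBits, Bool.not_eq_true', Bool.eq_false_iff, ne_eq, any_iff_bitsVal,
    bitsVal_subBits]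
  omega

@[fun_prop]
theorem PTime.leBits {α : Type} [Coded α] {f g : α → List Bool} (hf : PTime f) (hg : PTime g) :
    PTime fun x => leBits (f x) (g x) := by
  unfold StackProg.leBits
  have h' : PTime fun c : α => (StackProg.subBits (f c) (g c)).any (fun b => b) :=
    PTime.any (p := fun _ b => b) (by fun_prop) (by fun_prop)
  fun_prop

end StackProg
end

/-! ### Plans as walks in the graph of states. -/

noncomputable section

namespace RoutingInstance

variable {I : RoutingInstance}

open Relation

/-- Walks of given length along a relation. -/
inductive Chain {σ : Type*} (R : σ → σ → Prop) : ℕ → σ → σ → Prop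
  | nil (x : σ) : Chain R 0 x x
  | cons {n : ℕ} {x y z : σ} : R x y → Chain R n y z → Chain R (n + 1) x z

theorem Chain.exists_seq {σ : Type*} {R : σ → σ → Prop} {n : ℕ} {x y : σ} (h : Chain R n x y) :
    ∃ f : ℕ → σ, f 0 = x ∧ f n = y ∧ ∀ i < n, R (f i) (f (i + 1)) := by
  induction h with
  | nil x => exact ⟨fun _ => x, rfl, rfl, by simp⟩
  | @cons n x y z h _ ih =>
    obtain ⟨f, h0, hN, hf⟩ := ih
    refine ⟨fun i => i.casesOn x f, rfl, hN, fun i hi => ?_⟩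
    cases i with
    | zero => simpa [h0] using h
    | succ i => exact hf i (by omega)

theorem exists_chain {σ : Type*} {R : σ → σ → Prop} {x y : σ} (h : ReflTransGen R x y) :
    ∃ n, Chain R n x y := by
  induction h using ReflTransGen.head_induction_on with
  | refl => exact ⟨0, .nil _⟩
  | head h _ ih =>
    obtain ⟨n, ih⟩ := ih
    exact ⟨n + 1, .cons h ih⟩

/-- The positions of the assets and, for each trap, the number of timesteps until it is active. -/
@[ext]
structure State (I : RoutingInstance) where
  /-- the positions of the assets -/
  pos : Fin I.m → I.Location
  /-- the time until the traps are active -/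
  clk : I.R → ℕ

/-- At the beginning, all assets are at `s` and all traps are active. -/
def State.init (I : RoutingInstance) : State I := ⟨fun _ => some I.s, fun _ => 0⟩

/-- No two assets are on the same vertex, other than `s` and `t`. -/
def CollisionFree (C : Fin I.m → I.Location) : Prop :=
  ∀ a a', a ≠ a' → C a = C a' → C a = some I.s ∨ C a = some I.t ∨ C a = none

/-- The assets can move from `C` to `C'` within one timestep if the clocks of the traps show `d`;
if `tr` holds, then assets are eliminated by active traps only. -/
structure Move (tr : Prop) (C : Fin I.m → I.Location) (d : I.R → ℕ) (C' : Fin I.m → I.Location) :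
    Prop where
  no_return : ∀ a, C' a = some I.s → C a = some I.s
  stay : ∀ a, C a = some I.t ∨ C a = none → C' a = C a
  move : ∀ a v, C' a = some v → ∃ u, C a = some u ∧ (I.G.Adj u v ∨ u = v)
  collision_free : CollisionFree C'
  trap : ∀ a (r : I.R), C a = some r.1 → d r = 0 → C' a = none
  only : tr → ∀ a, C a ≠ none → C' a = none → ∃ r : I.R, C a = some r.1 ∧ d r = 0
  progress : ∃ a, C a ≠ C' a

open scoped Classical in
/-- The clocks after one timestep. -/
def tick (C : Fin I.m → I.Location) (d : I.R → ℕ) (r : I.R) : ℕ :=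
  if (∃ a, C a = some r.1) ∧ d r = 0 then I.c r else d r - 1

/-- One timestep, in which some asset moves. -/
def Step (tr : Prop) (S S' : State I) : Prop :=
  Move tr S.pos S.clk S'.pos ∧ S'.clk = tick S.pos S.clk

/-- The clocks during a plan. -/
def clock (ρ : I.Plan) : ℕ → I.R → ℕ
  | 0 => fun _ => 0
  | j + 1 => tick (fun a => ρ a j) (clock ρ j)

/-- The clock is the time until all past triggerings have expired. The case `x = 0` is the activity
condition in `Triggered`; general `x` is needed since each tick shifts the threshold by one. -/
theorem clock_le_iff (ρ : I.Plan) (r : I.R) (j x : ℕ)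
    (h : ∀ i < j, Triggered ρ r i ↔ (∃ a, ρ a i = some r.1) ∧ clock ρ i r = 0) :
    clock ρ j r ≤ x ↔ ∀ i < j, j + x ≤ i + I.c r → ¬ Triggered ρ r i := by
  induction j generalizing x with
  | zero => simp [clock]
  | succ j ih =>
    have ih := fun x => ih x fun i hi => h i (by omega)
    have hj := h j (by omega)
    simp only [clock, tick]
    split_ifs with ht
    · rw [← hj] at ht
      constructor
      · intro hc i _ hi'
        omega
      · intro hi
        by_contra hc
        -- A clock just reset to `I.c r > x` is contradicted by the triggering at time `j` itself.
        exact hi j (by omega) (by omega) ht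
    · rw [← hj] at ht
      rw [Nat.sub_le_iff_le_add, ih]
      constructor
      · intro H i hi hi'
        rcases Nat.lt_succ_iff_lt_or_eq.1 hi with hi | rfl
        · exact H i hi (by omega)
        · exact ht
      · intro H i hi hi'
        exact H i (by omega) (by omega)

theorem triggered_iff (ρ : I.Plan) (r : I.R) (j : ℕ) :
    Triggered ρ r j ↔ (∃ a, ρ a j = some r.1) ∧ clock ρ j r = 0 := by
  induction j using Nat.strong_induction_on with
  | _ j ih =>
    rw [← Nat.le_zero, clock_le_iff ρ r j 0 ih, Triggered]
    simp

/-- All assets have reached the target or have been eliminated, and `k` of them survive. -/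
def Final (S : State I) : Prop :=
  (∀ a, S.pos a = some I.t ∨ S.pos a = none) ∧ I.k ≤ Nat.card {a // S.pos a = some I.t}

/-- Each timestep before the end in which an asset moves is a step between states. The condition
`progress` starts at time 1, so only the timestep from 0 to 1 can be idle. -/
theorem exists_walk_of_plan {tr : Prop} {ρ : I.Plan} (hv : Valid ρ) (ht : tr → EliminatedByTraps ρ)
    (ha : Achieves ρ I.k) : ∃ F, ReflTransGen (Step tr) (State.init I) F ∧ Final F := by
  obtain ⟨ℓ, ⟨hl, hfin, b, hb⟩, hk⟩ := ha
  have hmono : ∀ a j i, Finished ρ a j → Finished ρ a (j + i) := by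
    intro a j i h
    induction i with
    | zero => exact h
    | succ i ih =>
      have := hv.stay a _ ih
      unfold Finished at *
      rw [← add_assoc, this]
      exact ih
  have hmove : ∀ j, (∃ a, ρ a j ≠ ρ a (j + 1)) →
      Step tr ⟨fun a => ρ a j, clock ρ j⟩ ⟨fun a => ρ a (j + 1), clock ρ (j + 1)⟩ := by
    intro j hj
    refine ⟨⟨fun a => hv.no_return a j, fun a => hv.stay a j, fun a v => hv.move a j v,
      fun a a' h h' => hv.collision_free a a' h _ h', fun a r h h' => ?_, fun htr a h h' => ?_, hj⟩,
      rfl⟩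
    · exact hv.trap a j r h ((triggered_iff ρ r j).2 ⟨⟨a, h⟩, h'⟩)
    · obtain ⟨r, hr, hr'⟩ := ht htr a j h h'
      exact ⟨r, hr, ((triggered_iff ρ r j).1 hr').2⟩
  have hwalk : ∀ j ≤ ℓ, ReflTransGen (Step tr) (State.init I) ⟨fun a => ρ a j, clock ρ j⟩ := by
    intro j
    induction j with
    | zero =>
      intro _
      have : State.init I = ⟨fun a => ρ a 0, clock ρ 0⟩ := by
        simp [State.init, hv.start, clock]
      rw [this]
    | succ j ih =>
      intro hj
      by_cases h : ∃ a, ρ a j ≠ ρ a (j + 1)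
      · exact (ih (by omega)).tail (hmove j h)
      -- An idle first timestep leaves the initial state unchanged, as `s` carries no trap, and can
      -- be skipped.
      · rcases Nat.eq_zero_or_pos j with rfl | hj'
        · push Not at h
          have : State.init I = ⟨fun a => ρ a (0 + 1), clock ρ (0 + 1)⟩ := by
            simp only [← h, State.init, hv.start, clock, State.mk.injEq, true_and]
            funext r
            have : I.s ≠ r.1 := fun h => I.s_notMem (h ▸ r.2)
            simp [tick, this]
          rw [this]
        · refine absurd (hv.progress j hj' ⟨b, fun hb' => hb ?_⟩) h
          have := hmono b j (ℓ - 1 - j) hb'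
          rwa [show j + (ℓ - 1 - j) = ℓ - 1 by omega] at this
  exact ⟨_, hwalk ℓ le_rfl, hfin, hk⟩

/-- The walk is continued by staying in the final state forever. The length of the plan is exactly
`N`, since the asset that moves in the last step was not finished before. -/
theorem exists_plan_of_walk {tr : Prop} {F : State I} (h : ReflTransGen (Step tr) (State.init I) F)
    (hF : Final F) : ∃ ρ : I.Plan, Valid ρ ∧ (tr → EliminatedByTraps ρ) ∧ Achieves ρ I.k := by
  obtain ⟨N, h⟩ := exists_chain h
  obtain ⟨f, h0, hN, h⟩ := h.exists_seq
  set ρ : I.Plan := fun a j => (f (min j N)).pos a with hρ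
  have hlt : ∀ a j, j ≤ N → ρ a j = (f j).pos a := fun a j hj => by simp [hρ, hj]
  have hge : ∀ a j, N ≤ j → ρ a j = F.pos a := fun a j hj => by simp [hρ, hj, hN]
  have hclk : ∀ j ≤ N, clock ρ j = (f j).clk := by
    intro j
    induction j with
    | zero => intro _; rw [h0]; rfl
    | succ j ih =>
      intro hj
      rw [(h j (by omega)).2, ← ih (by omega), clock]
      congr 1
      funext a
      exact hlt a j (by omega)
  have hpos : 1 ≤ N := by
    by_contra hn
    have : N = 0 := by omega
    subst this
    rw [h0] at hN
    have ha := hF.1 ⟨0, I.k_pos.trans I.k_le⟩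
    rw [← hN] at ha
    simp [State.init, I.s_ne_t] at ha
  have hlen : HasLength ρ N := by
    refine ⟨hpos, fun a => by unfold Finished; rw [hge a N le_rfl]; exact hF.1 a, ?_⟩
    have hs := h (N - 1) (by omega)
    obtain ⟨a, ha⟩ := hs.1.progress
    refine ⟨a, fun hfin => ha ?_⟩
    unfold Finished at hfin
    rw [hlt a _ (by omega)] at hfin
    exact (hs.1.stay a hfin).symm
  have hcases : ∀ j, N ≤ j ∨ (j < N ∧ ∀ a, ρ a j = (f j).pos a ∧ ρ a (j + 1) = (f (j + 1)).pos a) :=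
    fun j => (le_or_gt N j).imp_right fun hj => ⟨hj, fun a => ⟨hlt a j hj.le, hlt a _ hj⟩⟩
  refine ⟨ρ, ⟨?_, ?_, ?_, ?_, ?_, ?_, ?_, ⟨N, hlen⟩⟩, ?_, ⟨N, hlen, ?_⟩⟩
  · intro a
    rw [hlt a 0 (by omega), h0]
    rfl
  · intro a j hj
    rcases hcases j with hN | ⟨hN, e⟩
    · rwa [hge a j hN, ← hge a (j + 1) (by omega)]
    · rw [(e a).1]
      rw [(e a).2] at hj
      exact (h j hN).1.no_return a hj
  · intro a j hj
    rcases hcases j with hN | ⟨hN, e⟩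
    · rw [hge a j hN, ← hge a (j + 1) (by omega)]
    · unfold Finished at hj
      rw [(e a).1] at hj
      rw [(e a).1, (e a).2]
      exact (h j hN).1.stay a hj
  · intro a j v hj
    rcases hcases j with hN | ⟨hN, e⟩
    · rw [hge a (j + 1) (by omega)] at hj
      exact ⟨v, by rw [hge a j hN, hj], Or.inr rfl⟩
    · rw [(e a).2] at hj
      rw [(e a).1]
      exact (h j hN).1.move a v hj
  · intro a a' haa' j hj
    rcases Nat.eq_zero_or_pos j with rfl | hj'
    · left
      rw [hlt a 0 (by omega), h0]
      rfl
    -- `Move` asserts collision-freeness of its target only, so the step leading to time `min j N`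
    -- is used.
    · have hm : min j N = (min j N - 1) + 1 := by omega
      have := (h (min j N - 1) (by omega)).1.collision_free
      rw [← hm] at this
      exact this a a' haa' hj
  · intro a j r hj ht
    rcases hcases j with hN | ⟨hN, e⟩
    · rw [hge a j hN] at hj
      rcases hF.1 a with h' | h' <;> rw [h'] at hj
      · exact absurd (Option.some_injective _ hj ▸ r.2) I.t_notMem
      · simp at hj
    · rw [(e a).2]
      refine (h j hN).1.trap a r ((e a).1 ▸ hj) ?_
      rw [← hclk j hN.le]
      exact ((triggered_iff ρ r j).1 ht).2
  · rintro j hj ⟨a, ha⟩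
    rcases hcases j with hN | ⟨hN, e⟩
    · unfold Finished at ha
      rw [hge a j hN] at ha
      exact absurd (hF.1 a) ha
    · obtain ⟨a, ha⟩ := (h j hN).1.progress
      exact ⟨a, by rwa [(e a).1, (e a).2]⟩
  · intro htr a j hj hj'
    rcases hcases j with hN | ⟨hN, e⟩
    · rw [hge a j hN, ← hge a (j + 1) (by omega)] at hj
      exact absurd hj' hj
    · rw [(e a).1] at hj
      rw [(e a).2] at hj'
      obtain ⟨r, hr, hr'⟩ := (h j hN).1.only htr a hj hj'
      rw [← hclk j hN.le] at hr'
      rw [← (e a).1] at hr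
      exact ⟨r, hr, (triggered_iff ρ r j).2 ⟨⟨a, hr⟩, hr'⟩⟩
  · simp only [hge _ N le_rfl]
    exact hF.2

end RoutingInstance
end

/-! ### Short walks of given parity and token moves on a graph. -/

noncomputable section

namespace RoutingInstance

namespace Chain

variable {σ : Type*} {R : σ → σ → Prop}

theorem append {m n : ℕ} {x y z : σ} (h : Chain R m x y) (h' : Chain R n y z) :
    Chain R (m + n) x z := by
  induction h with
  | nil => rwa [Nat.zero_add]
  | @cons m x _ _ hR _ ih =>
    rw [Nat.add_right_comm]
    exact .cons hR (ih h')

theorem single {x y : σ} (h : R x y) : Chain R 1 x y := .cons h (.nil y)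

theorem symm (hR : ∀ x y, R x y → R y x) {n : ℕ} {x y : σ} (h : Chain R n x y) :
    Chain R n y x := by
  induction h with
  | nil x => exact .nil x
  | cons h _ ih => exact ih.append (.single (hR _ _ h))

/-- In a symmetric relation, walks can be shortened without changing the parity of their length. -/
theorem exists_short (hR : ∀ x y, R x y → R y x) {D : ℕ} {x : σ}
    (hD : ∀ n y, Chain R n x y → ∃ k ≤ D, Chain R k x y) {n : ℕ} {y : σ} (h : Chain R n x y) :
    ∃ k ≤ n, k ≤ 3 * D + 1 ∧ k % 2 = n % 2 ∧ Chain R k x y := by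
  rcases le_or_gt n (3 * D + 1) with hn | hn
  · exact ⟨n, le_rfl, hn, rfl, h⟩
  suffices ∃ k ≤ 3 * D + 1, k % 2 = n % 2 ∧ Chain R k x y by
    obtain ⟨k, hk, h⟩ := this
    exact ⟨k, by omega, hk, h⟩
  clear hn
  have hD' : ∀ y, (∃ n, Chain R n x y) → ∃ k ≤ D, Chain R k x y := fun y ⟨n, hn⟩ => hD n y hn
  choose! δ hδ hδ' using hD'
  -- If some edge joins points of equal parity, it closes an odd walk at `x` of length at most `2 *
  -- D + 1`. Putting it in front of a walk of length at most `D` corrects the parity.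
  by_cases hodd : ∃ u v, R u v ∧ (∃ m, Chain R m x u) ∧ (∃ m, Chain R m x v) ∧ δ u % 2 = δ v % 2
  · obtain ⟨u, v, huv, hu, hv, e⟩ := hodd
    have hloop : Chain R (δ u + 1 + δ v) x x :=
      ((hδ' u hu).append (.single huv)).append ((hδ' v hv).symm hR)
    have h1 := hδ u hu
    have h2 := hδ v hv
    have h3 := hδ y ⟨n, h⟩
    by_cases hp : δ y % 2 = n % 2
    · exact ⟨_, by omega, hp, hδ' y ⟨n, h⟩⟩
    · exact ⟨_, by omega, by omega, hloop.append (hδ' y ⟨n, h⟩)⟩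
  · push Not at hodd
    -- Otherwise every edge flips the parity of `δ`, as in a bipartite graph, so the parity of a
    -- walk is determined by its ends.
    have hpar : ∀ {n : ℕ} {u v : σ}, Chain R n u v → (∃ m, Chain R m x u) →
        δ v % 2 = (δ u + n) % 2 := by
      intro n u v hc
      induction hc with
      | nil => exact fun _ => rfl
      | @cons n u w v huw _ ih =>
        rintro ⟨m, hm⟩
        have hw : Chain R (m + 1) x w := hm.append (.single huw)
        have h1 := ih ⟨_, hw⟩
        have h2 := hodd u w huw ⟨m, hm⟩ ⟨_, hw⟩
        omega
    have hx : ∃ m, Chain R m x x := ⟨0, .nil x⟩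
    have h1 := hpar (hδ' x hx) hx
    have h2 := hpar h hx
    exact ⟨δ y, (hδ y ⟨n, h⟩).trans (by omega), by omega, hδ' y ⟨n, h⟩⟩

end Chain

section Pebbles

variable {V : Type*} [DecidableEq V] (G : SimpleGraph V)

/-- Indistinguishable tokens on the set `X` can move along edges of `G` to the set `Y` such that
some token moves. -/
def TokenMove (X Y : Finset V) : Prop :=
  ∃ σ : V → V, Set.InjOn σ X ∧ X.image σ = Y ∧ (∀ x ∈ X, G.Adj x (σ x) ∨ x = σ x) ∧
    ∃ x ∈ X, x ≠ σ x

variable {G}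

theorem TokenMove.symm {X Y : Finset V} (h : TokenMove G X Y) : TokenMove G Y X := by
  obtain ⟨σ, hinj, rfl, hadj, x₀, hx₀, hne⟩ := h
  have : Nonempty V := ⟨x₀⟩
  have hinv : ∀ x ∈ X, Function.invFunOn σ X (σ x) = x :=
    fun x hx => hinj.leftInvOn_invFunOn hx
  refine ⟨Function.invFunOn σ X, ?_, ?_, ?_, σ x₀, Finset.mem_image_of_mem σ hx₀, ?_⟩
  · intro y hy z hz e
    obtain ⟨x, hx, rfl⟩ := Finset.mem_image.1 hy
    obtain ⟨x', hx', rfl⟩ := Finset.mem_image.1 hz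
    rw [hinv x hx, hinv x' hx'] at e
    rw [e]
  · rw [Finset.image_image]
    conv_rhs => rw [← Finset.image_id (s := X)]
    exact Finset.image_congr fun x hx => hinv x hx
  · intro y hy
    obtain ⟨x, hx, rfl⟩ := Finset.mem_image.1 hy
    rw [hinv x hx]
    exact (hadj x hx).imp (fun h => h.symm) Eq.symm
  · rw [hinv x₀ hx₀]
    exact hne.symm

theorem TokenMove.single {X : Finset V} {x y : V} (hx : x ∈ X) (hy : y ∉ X) (h : G.Adj x y) :
    TokenMove G X (insert y (X.erase x)) := by
  have e : ∀ z ∈ X.erase x, (if z = x then y else z) = z := fun z hz => by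
    simp [Finset.ne_of_mem_erase hz]
  refine ⟨fun z => if z = x then y else z, ?_, ?_, ?_, x, hx, by simpa using h.ne⟩
  · intro a ha b hb hab
    have ha' : a ≠ y := fun h => hy (h ▸ ha)
    have hb' : b ≠ y := fun h => hy (h ▸ hb)
    simp only at hab
    split_ifs at hab <;> simp_all
  · conv_lhs => rw [← Finset.insert_erase hx, Finset.image_insert]
    simp only [if_true]
    rw [Finset.image_congr (g := id) fun z hz => e z hz, Finset.image_id]
  · intro z hz
    simp only
    split_ifs with hzx
    · exact Or.inl (hzx ▸ h)
    · exact Or.inr rfl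

/-- A token can be exchanged for another vertex in the same component. -/
theorem exists_chain_of_walk {x y : V} (p : G.Walk x y) {X : Finset V} (hx : x ∈ X) (hy : y ∉ X) :
    ∃ j ≤ p.length, Chain (TokenMove G) j X (insert y (X.erase x)) := by
  induction p generalizing X with
  | nil => exact absurd hx hy
  | @cons x x' y h p ih =>
    have hxy : x ≠ y := fun h => hy (h ▸ hx)
    by_cases hx'y : x' = y
    · subst hx'y
      exact ⟨1, by simp, .single (.single hx hy h)⟩
    -- If the next vertex is occupied, its token goes on to `y` first and the token at `x` then
    -- takes its place. As tokens are indistinguishable, every edge of the walk is used once in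
    -- either case.
    by_cases hx'X : x' ∈ X
    · obtain ⟨j, hj, hc⟩ := ih hx'X hy
      refine ⟨j + 1, by simpa using hj, hc.append (.single ?_)⟩
      have := TokenMove.single (X := insert y (X.erase x')) (x := x) (y := x')
        (by simp [hx, h.ne]) (by simp [hx'y]) h
      convert this using 1
      have := h.ne
      ext z
      simp only [Finset.mem_insert, Finset.mem_erase]
      grind
    · obtain ⟨j, hj, hc⟩ := ih (X := insert x' (X.erase x)) (by simp)
        (by simp [hy, Ne.symm hx'y])
      refine ⟨j + 1, by simpa using hj, .cons (.single hx hx'X h) ?_⟩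
      convert hc using 1
      ext z
      simp only [Finset.mem_insert, Finset.mem_erase]
      grind

open scoped Classical in
/-- In each component there are equally many vertices of `X` and of `Y`. -/
def Balanced (G : SimpleGraph V) (X Y : Finset V) : Prop :=
  ∀ v, (X.filter (G.Reachable v)).card = (Y.filter (G.Reachable v)).card

theorem TokenMove.balanced {X Y : Finset V} (h : TokenMove G X Y) : Balanced G X Y := by
  classical
  obtain ⟨σ, hinj, rfl, hadj, -⟩ := h
  intro v
  have hr : ∀ x ∈ X, (G.Reachable v (σ x) ↔ G.Reachable v x) := by
    intro x hx
    rcases hadj x hx with h | h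
    · exact ⟨fun h' => h'.trans h.symm.reachable, fun h' => h'.trans h.reachable⟩
    · rw [← h]
  rw [Finset.filter_image, Finset.card_image_of_injOn]
  · congr 1
    exact Finset.filter_congr fun x hx => (hr x hx).symm
  · exact hinj.mono fun x hx => by simpa using (Finset.mem_filter.1 hx).1

theorem Chain.balanced {X Y : Finset V} {n : ℕ} (h : Chain (TokenMove G) n X Y) :
    Balanced G X Y := by
  induction h with
  | nil => exact fun _ => rfl
  | cons h _ ih => exact fun v => (h.balanced v).trans (ih v)

/-- Otherwise, in the component of `y`, the set `X` would be properly contained in `Y`, against the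
equal counts. -/
theorem Balanced.exists_mem {X Y : Finset V} (h : Balanced G X Y) {y : V} (hy : y ∈ Y)
    (hyX : y ∉ X) : ∃ x ∈ X, x ∉ Y ∧ G.Reachable x y := by
  classical
  by_contra hc
  push Not at hc
  have : X.filter (G.Reachable y) ⊂ Y.filter (G.Reachable y) := by
    refine Finset.ssubset_iff_subset_ne.2 ⟨fun x hx => ?_, fun e => hyX ?_⟩
    · rw [Finset.mem_filter] at hx ⊢
      exact ⟨by_contra fun hxY => hc x hx.1 hxY hx.2.symm, hx.2⟩
    · have : y ∈ Y.filter (G.Reachable y) := by simp [hy]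
      rw [← e] at this
      exact (Finset.mem_filter.1 this).1
  exact (Finset.card_lt_card this).ne (h y)

/-- Tokens are exchanged one at a time along paths: a misplaced `x` for a missing `y` of the same
component. Each exchange keeps the balance and takes fewer than `Fintype.card V` moves. -/
theorem Balanced.exists_chain [Fintype V] {X Y : Finset V} (h : Balanced G X Y) :
    ∃ j ≤ (Y \ X).card * Fintype.card V, Chain (TokenMove G) j X Y := by
  induction hn : (Y \ X).card generalizing X with
  | zero =>
    have hYX : Y ⊆ X := by simpa [Finset.sdiff_eq_empty_iff_subset] using hn
    have : X = Y := by
      refine Finset.Subset.antisymm (fun x hx => by_contra fun hxY => ?_) hYX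
      obtain ⟨y, hy, hyX, -⟩ := Balanced.exists_mem (fun v => (h v).symm) hx hxY
      exact hyX (hYX hy)
    subst this
    exact ⟨0, by simp, .nil _⟩
  | succ n ih =>
    obtain ⟨y, hy⟩ := Finset.card_pos.1 (by omega : 0 < (Y \ X).card)
    obtain ⟨hyY, hyX⟩ := Finset.mem_sdiff.1 hy
    obtain ⟨x, hx, hxY, ⟨p⟩⟩ := h.exists_mem hyY hyX
    obtain ⟨j, hj, hc⟩ := exists_chain_of_walk (p.toPath : G.Walk x y) hx hyX
    have hb := hc.balanced
    have hcard : (Y \ insert y (X.erase x)).card = n := by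
      have : Y \ insert y (X.erase x) = (Y \ X).erase y := by
        ext z
        simp only [Finset.mem_sdiff, Finset.mem_insert, Finset.mem_erase]
        grind
      rw [this, Finset.card_erase_of_mem hy, hn]
      rfl
    obtain ⟨j', hj', hc'⟩ := ih (fun v => (hb v).symm.trans (h v)) hcard
    refine ⟨j + j', ?_, hc.append hc'⟩
    have := p.toPath.2.length_lt
    rw [Nat.succ_mul]
    omega

/-- Token moves can be shortened without changing the parity of their number. -/
theorem exists_short_tokenMoves [Fintype V] {X Y : Finset V} {n : ℕ} (h : Chain (TokenMove G) n X Y) :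
    ∃ k ≤ n, k ≤ 3 * Fintype.card V ^ 2 + 1 ∧ k % 2 = n % 2 ∧ Chain (TokenMove G) k X Y := by
  refine Chain.exists_short (fun _ _ h => h.symm) (fun n Z hZ => ?_) h
  obtain ⟨j, hj, hc⟩ := hZ.balanced.exists_chain
  refine ⟨j, hj.trans ?_, hc⟩
  rw [pow_two]
  gcongr
  exact Finset.card_le_univ _

end Pebbles

end RoutingInstance
end

/-! ### Macro steps, renaming of assets, and the passage from assets to tokens. -/

noncomputable section

namespace RoutingInstance

variable {I : RoutingInstance}

open Relation

/-- The move from `C` to `C'` can be undone. -/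
def Back (C C' : Fin I.m → I.Location) : Prop :=
  ∀ a, (C a = some I.s → C' a = some I.s) ∧ (C' a = some I.t ∨ C' a = none → C a = C' a)

/-- `N` timesteps in which the assets alternate between two positions. -/
structure Macro (tr : Prop) (N : ℕ) (S S' : State I) : Prop where
  move : Move tr S.pos S.clk S'.pos
  collision_free : CollisionFree S.pos
  clk : (N = 1 ∧ S'.clk = tick S.pos S.clk) ∨ (N % 2 = 1 ∧ Back S.pos S'.pos ∧
    (∀ (r : I.R) a, S.pos a = some r.1 ∨ S'.pos a = some r.1 → N ≤ S.clk r) ∧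
    S'.clk = fun r => S.clk r - N)

variable {tr : Prop} {C C' : Fin I.m → I.Location} {d d' : I.R → ℕ}

theorem Move.of_pos (h : Move tr C d C') (hb : Back C C')
    (hd : ∀ (r : I.R) a, C a = some r.1 → d' r ≠ 0) : Move tr C d' C' where
  no_return := h.no_return
  stay := h.stay
  move := h.move
  collision_free := h.collision_free
  trap a r hr h0 := absurd h0 (hd r a hr)
  only _ a ha ha' := absurd ((hb a).2 (Or.inr ha') ▸ ha') ha
  progress := h.progress

theorem Move.back (h : Move tr C d C') (hb : Back C C') (hC : CollisionFree C)
    (hd : ∀ (r : I.R) a, C' a = some r.1 → d' r ≠ 0) : Move tr C' d' C where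
  no_return a := (hb a).1
  stay a := (hb a).2
  move a v hv := by
    cases hu : C' a with
    | none => exact absurd (((hb a).2 (Or.inr hu)).trans hu) (by simp [hv])
    | some u =>
      obtain ⟨v', hv', hadj⟩ := h.move a u hu
      rw [hv, Option.some_inj] at hv'
      subst hv'
      exact ⟨u, rfl, hadj.imp (fun h => h.symm) Eq.symm⟩
  collision_free := hC
  trap a r hr h0 := absurd h0 (hd r a hr)
  only _ a ha ha' := absurd (h.stay a (Or.inr ha') ▸ ha') ha
  progress := let ⟨a, ha⟩ := h.progress; ⟨a, ha.symm⟩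

theorem tick_of_pos (h : ∀ (r : I.R) a, C a = some r.1 → d r ≠ 0) :
    tick C d = fun r => d r - 1 := by
  funext r
  refine if_neg ?_
  rintro ⟨⟨a, ha⟩, h0⟩
  exact h r a ha h0

/-- An oscillation unrolls to a genuine walk: `Back` allows the move to be undone, and clocks of at
least `N` at every trap involved keep these traps inactive whenever an asset leaves them. -/
theorem Macro.reflTransGen {N : ℕ} {S S' : State I} (h : Macro tr N S S') :
    ReflTransGen (Step tr) S S' := by
  obtain ⟨C, d⟩ := S
  obtain ⟨C', d'⟩ := S'
  obtain ⟨hm, hC, ⟨rfl, hc⟩ | ⟨hN, hb, hpos, rfl⟩⟩ := h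
  · exact .single ⟨hm, hc⟩
  simp only at hm hC hb hpos
  -- The induction is on the number `e` of full round trips, which precede a last single move.
  have key : ∀ (e : ℕ) (d : I.R → ℕ),
      (∀ (r : I.R) a, C a = some r.1 ∨ C' a = some r.1 → 2 * e + 1 ≤ d r) →
      ReflTransGen (Step tr) ⟨C, d⟩ ⟨C', fun r => d r - (2 * e + 1)⟩ := by
    intro e
    induction e with
    | zero =>
      intro d hd
      have hd' : ∀ (r : I.R) a, C a = some r.1 → d r ≠ 0 := fun r a ha => by
        have := hd r a (Or.inl ha)
        omega
      exact .single ⟨hm.of_pos hb hd', (tick_of_pos hd').symm⟩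
    | succ e ih =>
      intro d hd
      have h1 : ∀ (r : I.R) a, C a = some r.1 → d r ≠ 0 := fun r a ha => by
        have := hd r a (Or.inl ha)
        omega
      have h2 : ∀ (r : I.R) a, C' a = some r.1 → d r - 1 ≠ 0 := fun r a ha => by
        have := hd r a (Or.inr ha)
        omega
      have s1 : Step tr ⟨C, d⟩ ⟨C', fun r => d r - 1⟩ := ⟨hm.of_pos hb h1, (tick_of_pos h1).symm⟩
      have s2 : Step tr ⟨C', fun r => d r - 1⟩ ⟨C, fun r => d r - 1 - 1⟩ :=
        ⟨hm.back hb hC h2, (tick_of_pos h2).symm⟩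
      have s3 := ih (fun r => d r - 1 - 1) fun r a ha => by
        have := hd r a ha
        omega
      have e' : (fun r => d r - 1 - 1 - (2 * e + 1)) = fun r => d r - (2 * (e + 1) + 1) := by
        funext r
        omega
      rw [e'] at s3
      exact .head s1 (.head s2 s3)
  have := key (N / 2) d
  rw [show 2 * (N / 2) + 1 = N by omega] at this
  exact this hpos

/-- Rename the assets. -/
def State.perm (π : Equiv.Perm (Fin I.m)) (S : State I) : State I := ⟨S.pos ∘ π, S.clk⟩

theorem CollisionFree.perm (π : Equiv.Perm (Fin I.m)) (h : CollisionFree C) :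
    CollisionFree (C ∘ π) := fun a a' haa' => h (π a) (π a') (π.injective.ne haa')

theorem Move.perm (π : Equiv.Perm (Fin I.m)) (h : Move tr C d C') : Move tr (C ∘ π) d (C' ∘ π) where
  no_return a := h.no_return (π a)
  stay a := h.stay (π a)
  move a := h.move (π a)
  collision_free := h.collision_free.perm π
  trap a := h.trap (π a)
  only htr a := h.only htr (π a)
  progress := let ⟨a, ha⟩ := h.progress; ⟨π.symm a, by simpa using ha⟩

theorem tick_perm (π : Equiv.Perm (Fin I.m)) : tick (C ∘ π) d = tick C d := by
  classical
  funext r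
  unfold tick
  congr 1
  simp only [Function.comp_apply, eq_iff_iff]
  rw [π.exists_congr_left]
  simp

theorem Macro.perm (π : Equiv.Perm (Fin I.m)) {N : ℕ} {S S' : State I} (h : Macro tr N S S') :
    Macro tr N (S.perm π) (S'.perm π) where
  move := h.move.perm π
  collision_free := h.collision_free.perm π
  clk := by
    rcases h.clk with ⟨hN, hc⟩ | ⟨hN, hb, hpos, hc⟩
    · exact Or.inl ⟨hN, hc.trans (tick_perm π).symm⟩
    · exact Or.inr ⟨hN, fun a => hb (π a), fun r a => hpos r (π a), hc⟩

theorem Chain.map {σ τ : Type*} {R : σ → σ → Prop} {R' : τ → τ → Prop} (f : σ → τ)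
    (hf : ∀ x y, R x y → R' (f x) (f y)) {n : ℕ} {x y : σ} (h : Chain R n x y) :
    Chain R' n (f x) (f y) := by
  induction h with
  | nil x => exact .nil _
  | cons h _ ih => exact .cons (hf _ _ h) ih

/-- Macro steps with at most `B` timesteps. -/
def BMacro (tr : Prop) (B : ℕ) (S S' : State I) : Prop := ∃ N ≤ B, Macro tr N S S'

theorem BMacro.perm (π : Equiv.Perm (Fin I.m)) {B : ℕ} (S S' : State I) (h : BMacro tr B S S') :
    BMacro tr B (S.perm π) (S'.perm π) :=
  let ⟨N, hN, h⟩ := h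
  ⟨N, hN, h.perm π⟩

/-- The vertices other than `s` and `t` that are not protected by an active trap. -/
def Free (d : I.R → ℕ) (v : Fin I.n) : Prop :=
  v ≠ I.s ∧ v ≠ I.t ∧ ∀ r : I.R, r.1 = v → d r ≠ 0

/-- The topology restricted to the free vertices. -/
def freeGraph (d : I.R → ℕ) : SimpleGraph (Fin I.n) where
  Adj u v := I.G.Adj u v ∧ Free d u ∧ Free d v
  symm := ⟨fun _ _ h => ⟨h.1.symm, h.2.2, h.2.1⟩⟩
  loopless := ⟨fun _ h => h.1.ne rfl⟩

open scoped Classical in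
/-- The free vertices that are occupied. -/
def tokens (d : I.R → ℕ) (C : Fin I.m → I.Location) : Finset (Fin I.n) :=
  Finset.univ.filter fun v => Free d v ∧ ∃ a, C a = some v

theorem mem_tokens {v : Fin I.n} : v ∈ tokens d C ↔ Free d v ∧ ∃ a, C a = some v := by
  simp [tokens]

/-- No asset is on an active trap. -/
def Inside (d : I.R → ℕ) (C : Fin I.m → I.Location) : Prop :=
  ∀ a v, C a = some v → Free d v ∨ v = I.s ∨ v = I.t

/-- The assets on free vertices move to free vertices, and the other assets stay put. -/
structure FreeMove (d : I.R → ℕ) (C C' : Fin I.m → I.Location) : Prop where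
  move : ∀ a, C' a = C a ∨ ∃ u v, C a = some u ∧ C' a = some v ∧ (freeGraph d).Adj u v
  collision_free : CollisionFree C'
  progress : ∃ a, C a ≠ C' a

theorem FreeMove.inside (h : FreeMove d C C') (hC : Inside d C) : Inside d C' := by
  intro a v hv
  rcases h.move a with e | ⟨u, v', -, hv', hadj⟩
  · exact hC a v (e ▸ hv)
  · rw [hv, Option.some_inj] at hv'
    exact Or.inl (hv' ▸ hadj.2.2)

theorem CollisionFree.eq (h : CollisionFree C) {v : Fin I.n} (hv : Free d v) {a a' : Fin I.m}
    (ha : C a = some v) (ha' : C a' = some v) : a = a' := by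
  by_contra hne
  rcases h a a' hne (ha.trans ha'.symm) with h' | h' | h' <;> rw [ha] at h'
  · exact hv.1 (Option.some_injective _ h')
  · exact hv.2.1 (Option.some_injective _ h')
  · simp at h'

/-- Moves between free vertices involve neither `s`, `t` nor elimination, so they can be undone. The
clocks `d` fix which vertices count as free, while `d'` are the current clocks, which have run down
meanwhile. -/
theorem FreeMove.toMacro (h : FreeMove d C C') (hC : Inside d C) (hC' : CollisionFree C) {N : ℕ}
    (hN : N % 2 = 1) (hd : ∀ r : I.R, Free d r.1 → N ≤ d' r) :
    Macro tr N ⟨C, d'⟩ ⟨C', fun r => d' r - N⟩ := by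
  have hs : ∀ r : I.R, r.1 ≠ I.s := fun r e => I.s_notMem (e ▸ r.2)
  have ht : ∀ r : I.R, r.1 ≠ I.t := fun r e => I.t_notMem (e ▸ r.2)
  have hpos : ∀ {C : Fin I.m → I.Location}, Inside d C → ∀ (r : I.R) a, C a = some r.1 →
      N ≤ d' r := by
    intro C hC r a ha
    rcases hC a r.1 ha with h | h | h
    · exact hd r h
    · exact absurd h (hs r)
    · exact absurd h (ht r)
  refine ⟨⟨fun a ha => ?_, fun a ha => ?_, fun a v hv => ?_, h.collision_free, fun a r ha h0 => ?_,
    fun _ a ha ha' => ?_, h.progress⟩, hC', Or.inr ⟨hN, fun a => ⟨fun ha => ?_, fun ha => ?_⟩,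
    fun r a ha => ?_, rfl⟩⟩
  · simp only at ha ⊢
    rcases h.move a with e | ⟨u, v, -, hv, hadj⟩
    · rwa [← e]
    · rw [hv, Option.some_inj] at ha
      exact absurd ha hadj.2.2.1
  · simp only at ha ⊢
    rcases h.move a with e | ⟨u, v, hu, -, hadj⟩
    · exact e
    · simp only [hu, Option.some_inj, reduceCtorEq, or_false] at ha
      exact absurd ha hadj.2.1.2.1
  · simp only at hv ⊢
    rcases h.move a with e | ⟨u, v', hu, hv', hadj⟩
    · exact ⟨v, e ▸ hv, Or.inr rfl⟩
    · rw [hv, Option.some_inj] at hv'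
      exact ⟨u, hu, Or.inl (hv' ▸ hadj.1)⟩
  · have := hpos hC r a ha
    simp only at h0
    omega
  · simp only at ha ha'
    rcases h.move a with e | ⟨u, v', hu, hv', hadj⟩
    · exact absurd (e ▸ ha') ha
    · simp [ha'] at hv'
  · simp only at ha ⊢
    rcases h.move a with e | ⟨u, v, hu, -, hadj⟩
    · rwa [e]
    · rw [hu, Option.some_inj] at ha
      exact absurd ha hadj.2.1.1
  · simp only at ha ⊢
    rcases h.move a with e | ⟨u, v, hu, hv, hadj⟩
    · exact e.symm
    · simp only [hv, Option.some_inj, reduceCtorEq, or_false] at ha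
      exact absurd ha hadj.2.2.2.1
  · rcases ha with ha | ha
    · exact hpos hC r a ha
    · exact hpos (h.inside hC) r a ha

theorem FreeMove.tokenMove (h : FreeMove d C C') (hC' : CollisionFree C) :
    TokenMove (freeGraph d) (tokens d C) (tokens d C') := by
  classical
  have key : ∀ x ∈ tokens d C, ∃ a y, C a = some x ∧ C' a = some y ∧ Free d y ∧
      ((freeGraph d).Adj x y ∨ x = y) := by
    intro x hx
    obtain ⟨hf, a, ha⟩ := mem_tokens.1 hx
    rcases h.move a with e | ⟨u, v, hu, hv, hadj⟩
    · exact ⟨a, x, ha, e.trans ha, hf, Or.inr rfl⟩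
    · rw [ha, Option.some_inj] at hu
      subst hu
      exact ⟨a, v, ha, hv, hadj.2.2, Or.inl hadj⟩
  obtain ⟨a₀, -⟩ := h.progress
  have : Nonempty (Fin I.m) := ⟨a₀⟩
  choose! α σ h1 h2 h3 h4 using key
  have hσ : ∀ {a x y}, C a = some x → C' a = some y → Free d x → σ x = y := by
    intro a x y hx hy hf
    have hm : x ∈ tokens d C := mem_tokens.2 ⟨hf, a, hx⟩
    have : α x = a := hC'.eq hf (h1 x hm) hx
    have := h2 x hm
    rw [‹α x = a›, hy] at this
    exact (Option.some_injective _ this).symm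
  refine ⟨σ, fun x hx y hy e => ?_, ?_, h4, ?_⟩
  · have : α x = α y := h.collision_free.eq (h3 x hx) (h2 x hx) (e ▸ h2 y hy)
    have e' := (h1 x hx).symm.trans (this ▸ h1 y hy)
    exact Option.some_injective _ e'
  · ext y
    rw [Finset.mem_image]
    constructor
    · rintro ⟨x, hx, rfl⟩
      exact mem_tokens.2 ⟨h3 x hx, α x, h2 x hx⟩
    · intro hy
      obtain ⟨hf, a, ha⟩ := mem_tokens.1 hy
      rcases h.move a with e | ⟨u, v, hu, hv, hadj⟩
      · exact ⟨y, mem_tokens.2 ⟨hf, a, e ▸ ha⟩, hσ (e ▸ ha) ha hf⟩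
      · exact ⟨u, mem_tokens.2 ⟨hadj.2.1, a, hu⟩, hσ hu ha hadj.2.1⟩
  · obtain ⟨a, ha⟩ := h.progress
    rcases h.move a with e | ⟨u, v, hu, hv, hadj⟩
    · exact absurd e.symm ha
    · refine ⟨u, mem_tokens.2 ⟨hadj.2.1, a, hu⟩, ?_⟩
      rw [hσ hu hv hadj.2.1]
      exact hadj.1.ne

/-- A free vertex carries at most one asset, so the map on tokens prescribes the moves of the
assets; all others stay put. -/
theorem TokenMove.exists_freeMove {Y : Finset (Fin I.n)}
    (h : TokenMove (freeGraph d) (tokens d C) Y) (hC : CollisionFree C) :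
    ∃ C', FreeMove d C C' ∧ tokens d C' = Y := by
  classical
  obtain ⟨σ, hinj, rfl, hadj, x₀, hx₀, hne⟩ := h
  have hfree : ∀ x ∈ tokens d C, Free d (σ x) := by
    intro x hx
    rcases hadj x hx with h | h
    · exact h.2.2
    · exact h ▸ (mem_tokens.1 hx).1
  have hmem : ∀ {a x}, C a = some x → Free d x → x ∈ tokens d C :=
    fun {a x} ha hf => mem_tokens.2 ⟨hf, a, ha⟩
  set C' : Fin I.m → I.Location := fun a => (C a).map fun x => if Free d x then σ x else x with hC'
  have h1 : ∀ {a x}, C a = some x → Free d x → C' a = some (σ x) := by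
    intro a x ha hf
    simp [hC', ha, hf]
  have h2 : ∀ {a}, (∀ x, C a = some x → ¬ Free d x) → C' a = C a := by
    intro a ha
    cases hx : C a with
    | none => simp [hC', hx]
    | some x => simp [hC', hx, ha x hx]
  have h3 : ∀ {a y}, C' a = some y → Free d y → ∃ x ∈ tokens d C, C a = some x ∧ σ x = y := by
    intro a y ha hf
    by_cases h : ∃ x, C a = some x ∧ Free d x
    · obtain ⟨x, hx, hxf⟩ := h
      rw [h1 hx hxf, Option.some_inj] at ha
      exact ⟨x, hmem hx hxf, hx, ha⟩
    · push Not at h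
      rw [h2 h] at ha
      exact absurd hf (h y ha)
  refine ⟨C', ⟨fun a => ?_, fun a a' haa' e => ?_, ?_⟩, ?_⟩
  · by_cases h : ∃ x, C a = some x ∧ Free d x
    · obtain ⟨x, hx, hxf⟩ := h
      rcases hadj x (hmem hx hxf) with h | h
      · exact Or.inr ⟨x, σ x, hx, h1 hx hxf, h⟩
      · left
        rw [h1 hx hxf, hx, ← h]
    · push Not at h
      exact Or.inl (h2 h)
  · by_cases h : ∃ y, C' a = some y ∧ Free d y
    · obtain ⟨y, hy, hyf⟩ := h
      obtain ⟨x, hx, hxa, rfl⟩ := h3 hy hyf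
      obtain ⟨x', hx', hxa', e'⟩ := h3 (e ▸ hy) hyf
      have := hinj hx' hx e'
      subst this
      exact absurd (hC.eq (mem_tokens.1 hx).1 hxa hxa') haa'
    · have h' : ∀ {a}, (¬ ∃ y, C' a = some y ∧ Free d y) → C' a = C a := by
        intro a h
        refine h2 fun x hx hf => h ⟨σ x, h1 hx hf, hfree x (hmem hx hf)⟩
      have e1 := h' h
      have e2 := h' (e ▸ h)
      rw [e1]
      exact hC a a' haa' (e1.symm.trans (e.trans e2))
  · obtain ⟨hf, a, ha⟩ := mem_tokens.1 hx₀
    refine ⟨a, ?_⟩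
    rw [ha, h1 ha hf]
    exact fun h => hne (Option.some_injective _ h)
  · ext y
    rw [mem_tokens, Finset.mem_image]
    constructor
    · rintro ⟨hf, a, ha⟩
      obtain ⟨x, hx, -, e⟩ := h3 ha hf
      exact ⟨x, hx, e⟩
    · rintro ⟨x, hx, rfl⟩
      obtain ⟨hf, a, ha⟩ := mem_tokens.1 hx
      exact ⟨hfree x hx, a, h1 ha hf⟩

theorem chain_freeMove_collisionFree {n : ℕ} (h : Chain (FreeMove d) n C C')
    (hC : CollisionFree C) : CollisionFree C' := by
  induction h with
  | nil => exact hC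
  | cons h _ ih => exact ih h.collision_free

theorem chain_freeMove_tokenMove {n : ℕ} (h : Chain (FreeMove d) n C C')
    (hC : CollisionFree C) : Chain (TokenMove (freeGraph d)) n (tokens d C) (tokens d C') := by
  induction h with
  | nil => exact .nil _
  | cons h _ ih => exact .cons (h.tokenMove hC) (ih h.collision_free)

theorem chain_tokenMove_freeMove {n : ℕ} {X Y : Finset (Fin I.n)}
    (h : Chain (TokenMove (freeGraph d)) n X Y) {C : Fin I.m → I.Location} (hX : tokens d C = X)
    (hC : CollisionFree C) : ∃ C', Chain (FreeMove d) n C C' ∧ tokens d C' = Y := by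
  induction h generalizing C with
  | nil => exact ⟨C, .nil _, hX⟩
  | cons h _ ih =>
    subst hX
    obtain ⟨C₁, h₁, h₁'⟩ := h.exists_freeMove hC
    obtain ⟨C₂, h₂, h₂'⟩ := ih h₁' h₁.collision_free
    exact ⟨C₂, .cons h₁ h₂, h₂'⟩

/-- Moves of assets between free vertices do not change the assets at other locations. -/
theorem chain_freeMove_eq_iff {n : ℕ} (h : Chain (FreeMove d) n C C') {x : I.Location}
    (hx : ∀ v, x = some v → ¬ Free d v) (a : Fin I.m) : C' a = x ↔ C a = x := by
  induction h with
  | nil => rfl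
  | cons h _ ih =>
    rw [ih]
    rcases h.move a with e | ⟨u, v, hu, hv, hadj⟩
    · rw [e]
    · constructor
      · intro e
        exact absurd hadj.2.2 (hx v (e.symm.trans hv))
      · intro e
        exact absurd hadj.2.1 (hx u (e.symm.trans hu))

/-- Each location holds equally many assets in `C₁` and `C₂`: at free vertices this is the equality
of tokens, and elsewhere nothing has changed since `C`. Bijections between the fibres assemble to a
permutation. -/
theorem exists_perm {C C₁ C₂ : Fin I.m → I.Location} {n₁ n₂ : ℕ} (hC : CollisionFree C)
    (h₁ : Chain (FreeMove d) n₁ C C₁) (h₂ : Chain (FreeMove d) n₂ C C₂)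
    (h : tokens d C₁ = tokens d C₂) : ∃ π : Equiv.Perm (Fin I.m), C₂ ∘ π = C₁ := by
  classical
  have e : ∀ x : I.Location, Nonempty ({a // C₁ a = x} ≃ {a // C₂ a = x}) := by
    intro x
    by_cases hx : ∃ v, x = some v ∧ Free d v
    · obtain ⟨v, rfl, hv⟩ := hx
      have hs₁ : Subsingleton {a // C₁ a = some v} :=
        ⟨fun a b => Subtype.ext ((chain_freeMove_collisionFree h₁ hC).eq hv a.2 b.2)⟩
      have hs₂ : Subsingleton {a // C₂ a = some v} :=
        ⟨fun a b => Subtype.ext ((chain_freeMove_collisionFree h₂ hC).eq hv a.2 b.2)⟩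
      have hiff : (∃ a, C₁ a = some v) ↔ ∃ a, C₂ a = some v := by
        have := congrArg (v ∈ ·) h
        simpa [mem_tokens, hv] using this
      by_cases hne : ∃ a, C₁ a = some v
      · obtain ⟨b, hb⟩ := hiff.1 hne
        obtain ⟨a, ha⟩ := hne
        exact ⟨⟨fun _ => ⟨b, hb⟩, fun _ => ⟨a, ha⟩, fun _ => Subsingleton.elim _ _,
          fun _ => Subsingleton.elim _ _⟩⟩
      · have : IsEmpty {a // C₁ a = some v} := ⟨fun a => hne ⟨a.1, a.2⟩⟩
        have : IsEmpty {a // C₂ a = some v} := ⟨fun a => hne (hiff.2 ⟨a.1, a.2⟩)⟩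
        exact ⟨Equiv.equivOfIsEmpty _ _⟩
    · push Not at hx
      exact ⟨Equiv.subtypeEquivRight fun a =>
        (chain_freeMove_eq_iff h₁ hx a).trans (chain_freeMove_eq_iff h₂ hx a).symm⟩
  exact ⟨Equiv.ofFiberEquiv fun x => (e x).some, funext fun a => Equiv.ofFiberEquiv_map _ a⟩

end RoutingInstance
end

/-! ### The potential and the replacement of walks by few macro steps. -/

noncomputable section

namespace RoutingInstance

variable {I : RoutingInstance} {tr : Prop} {S S' F : State I} {C C' : Fin I.m → I.Location}
  {d d' : I.R → ℕ}

open Relation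

theorem Free.congr (h : ∀ r, d r = 0 ↔ d' r = 0) {v : Fin I.n} : Free d v ↔ Free d' v := by
  simp only [Free, ne_eq, h]

theorem FreeMove.congr (h : ∀ r, d r = 0 ↔ d' r = 0) (hm : FreeMove d C C') :
    FreeMove d' C C' where
  move a := (hm.move a).imp_right fun ⟨u, v, hu, hv, hadj⟩ =>
    ⟨u, v, hu, hv, hadj.1, (Free.congr h).1 hadj.2.1, (Free.congr h).1 hadj.2.2⟩
  collision_free := hm.collision_free
  progress := hm.progress

/-- The asset `a` is on an active trap. -/
def Doomed (S : State I) (a : Fin I.m) : Prop := ∃ r : I.R, S.pos a = some r.1 ∧ S.clk r = 0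

open scoped Classical in
/-- A measure of the progress of an asset, from the initial vertex to its final location. -/
def phase (S : State I) (a : Fin I.m) : ℕ :=
  if S.pos a = some I.s then 0 else if S.pos a = some I.t ∨ S.pos a = none then 3
  else if Doomed S a then 2 else 1

theorem phase_le (a : Fin I.m) : phase S a ≤ 3 := by
  unfold phase
  split_ifs <;> omega

theorem phase_eq_one {a : Fin I.m} :
    phase S a = 1 ↔ ∃ v, S.pos a = some v ∧ Free S.clk v := by
  unfold phase
  split_ifs with h1 h2 h3
  · simp [h1, Free]
  · rcases h2 with h2 | h2 <;> simp [h2, Free]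
  · obtain ⟨r, hr, h0⟩ := h3
    simp only [OfNat.ofNat_ne_one, false_iff, not_exists, not_and]
    intro v hv hf
    rw [hr, Option.some_inj] at hv
    exact hf.2.2 r hv h0
  · push Not at h2
    obtain ⟨v, hv⟩ := Option.ne_none_iff_exists'.1 h2.2
    simp only [true_iff]
    refine ⟨v, hv, fun h => h1 (h ▸ hv), fun h => h2.1 (h ▸ hv), fun r hr h0 => h3 ⟨r, ?_, h0⟩⟩
    rw [hr, hv]

/-- Assets do not return to `s`, remain at `t` and `†`, and go from an active trap directly to `†`.
-/
theorem Step.phase_le (h : Step tr S S') (a : Fin I.m) : phase S a ≤ phase S' a := by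
  have hs := h.1.no_return a
  have ht := h.1.stay a
  have h3 : Doomed S a → S'.pos a = none := fun ⟨r, hr, h0⟩ => h.1.trap a r hr h0
  have hst := I.s_ne_t
  unfold phase
  split_ifs with h1 h2 h4 h5 h6 h7 <;> grind

theorem Step.phase_lt (h : Step tr S S') {a : Fin I.m} (ha : Doomed S a) :
    phase S a < phase S' a := by
  obtain ⟨r, hr, h0⟩ := ha
  have hs : r.1 ≠ I.s := fun e => I.s_notMem (e ▸ r.2)
  have ht : r.1 ≠ I.t := fun e => I.t_notMem (e ▸ r.2)
  have h1 := h.1.trap a r hr h0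
  have h2 : Doomed S a := ⟨r, hr, h0⟩
  unfold phase
  simp [h1, h2, hr, hs, ht]

open scoped Classical in
/-- The active traps. -/
def active (S : State I) : Finset I.R := Finset.univ.filter fun r => S.clk r = 0

theorem mem_active {r : I.R} : r ∈ active S ↔ S.clk r = 0 := by simp [active]

open scoped Classical in
/-- The assets on active traps. -/
def doomed (S : State I) : Finset (Fin I.m) := Finset.univ.filter (Doomed S)

theorem mem_doomed {a : Fin I.m} : a ∈ doomed S ↔ Doomed S a := by simp [doomed]

-- Only an asset on an active trap can deactivate it, so distinct traps that become inactive are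
-- paid for by distinct assets.
open scoped Classical in
theorem Step.card_active_sdiff_le (h : Step tr S S') :
    (active S \ active S').card ≤ (doomed S).card := by
  rw [← Finset.card_image_of_injective (active S \ active S')
    (f := fun r : I.R => (some r.1 : I.Location)) fun r r' e => Subtype.ext (by simpa using e)]
  refine (Finset.card_le_card ?_).trans (Finset.card_image_le (f := S.pos))
  intro x hx
  obtain ⟨r, hr, rfl⟩ := Finset.mem_image.1 hx
  rw [Finset.mem_sdiff, mem_active, mem_active, h.2, tick] at hr
  split_ifs at hr with ht
  · obtain ⟨⟨a, ha⟩, h0⟩ := ht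
    exact Finset.mem_image.2 ⟨a, mem_doomed.2 ⟨r, ha, h0⟩, ha⟩
  · omega

/-- A measure of the progress of a plan. -/
def potential (S : State I) : ℕ := 2 * ∑ a, phase S a + (active S).card

theorem potential_le : potential S ≤ 6 * I.m + I.n := by
  have h1 : ∑ a, phase S a ≤ ∑ _a : Fin I.m, 3 := Finset.sum_le_sum fun a _ => phase_le a
  have h2 : (active S).card ≤ I.R.card := (Finset.card_le_univ _).trans (by simp)
  have h3 : I.R.card ≤ I.n := (Finset.card_le_univ _).trans (by simp)
  simp only [Finset.sum_const, Finset.card_univ, Fintype.card_fin, smul_eq_mul] at h1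
  unfold potential
  omega

theorem Step.sum_phase_le (h : Step tr S S') :
    ∑ a, phase S a + (doomed S).card ≤ ∑ a, phase S' a := by
  classical
  rw [doomed, Finset.card_filter, ← Finset.sum_add_distrib]
  refine Finset.sum_le_sum fun a _ => ?_
  split_ifs with ha
  · exact h.phase_lt ha
  · exact h.phase_le a

/-- A doomed asset raises the first summand by at least 2 and accounts for the loss of at most one
active trap. This is the reason for the factor 2. -/
theorem Step.potential_le (h : Step tr S S') :
    potential S + (doomed S).card ≤ potential S' := by
  classical
  have h1 := h.sum_phase_le
  have h2 := h.card_active_sdiff_le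
  have h3 : (active S).card ≤ (active S \ active S').card + (active S').card :=
    Finset.card_le_card_sdiff_add_card
  unfold potential
  omega

/-- A timestep without progress of the potential. -/
theorem Step.quiet (h : Step tr S S') (hp : potential S' ≤ potential S) :
    S'.clk = (fun r => S.clk r - 1) ∧ (∀ r, S.clk r = 0 ↔ S'.clk r = 0) ∧
      Inside S.clk S.pos ∧ FreeMove S.clk S.pos S'.pos := by
  classical
  have h0 := h.potential_le
  have h1 := h.sum_phase_le
  have h2 := h.card_active_sdiff_le
  -- Without a gain of potential all the inequalities are equalities: no asset is doomed, the active
  -- traps are the same, and every asset keeps its phase.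
  have hd : doomed S = ∅ := by rw [← Finset.card_eq_zero]; omega
  have hnd : ∀ a, ¬ Doomed S a := fun a ha => by
    have := mem_doomed.2 ha
    simp [hd] at this
  have hsub : active S ⊆ active S' := by
    rw [← Finset.sdiff_eq_empty_iff_subset, ← Finset.card_eq_zero]
    rw [hd] at h2
    simpa using h2
  have hle := Finset.card_le_card hsub
  have hact : active S = active S' := Finset.eq_of_subset_of_card_le hsub (by
    unfold potential at hp
    omega)
  have hph : ∀ a, phase S a = phase S' a := by
    have : ∑ a, phase S a = ∑ a, phase S' a := by
      unfold potential at hp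
      omega
    intro a
    exact (Finset.sum_eq_sum_iff_of_le fun a _ => h.phase_le a).1 this a (Finset.mem_univ a)
  have hz : ∀ r, S.clk r = 0 ↔ S'.clk r = 0 := fun r => by rw [← mem_active, hact, mem_active]
  refine ⟨?_, hz, fun a v hv => ?_, fun a => ?_, h.1.collision_free, h.1.progress⟩
  · rw [h.2]
    refine tick_of_pos fun r a ha hr => hnd a ⟨r, ha, hr⟩
  · by_contra hc
    push Not at hc
    obtain ⟨hf, hs, ht⟩ := hc
    refine hf ⟨hs, ht, fun r hr h0 => hnd a ⟨r, by rw [hr, hv], h0⟩⟩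
  -- Keeping phase 1 means moving or staying within the free vertices. In phases 0 and 3 the asset
  -- stays where it is, and phase 2 is excluded.
  · by_cases h1 : phase S a = 1
    · obtain ⟨u, hu, huf⟩ := phase_eq_one.1 h1
      obtain ⟨v, hv, hvf⟩ := phase_eq_one.1 ((hph a).symm.trans h1)
      obtain ⟨u', hu', hadj⟩ := h.1.move a v hv
      rw [hu, Option.some_inj] at hu'
      subst hu'
      rcases hadj with hadj | rfl
      · exact Or.inr ⟨u, v, hu, hv, hadj, huf, (Free.congr hz).2 hvf⟩
      · exact Or.inl (hv.trans hu.symm)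
    · left
      by_cases hs : S.pos a = some I.s
      · have : phase S' a = 0 := by rw [← hph]; simp [phase, hs]
        unfold phase at this
        split_ifs at this with hs'
        exact hs'.trans hs.symm
      · by_cases ht : S.pos a = some I.t ∨ S.pos a = none
        · exact h.1.stay a ht
        · exact absurd (by simp [phase, hs, ht, hnd a]) h1

theorem Chain.potential_le {n : ℕ} (h : Chain (Step tr) n S S') :
    potential S ≤ potential S' := by
  induction h with
  | nil => exact le_rfl
  | cons h _ ih => exact le_trans (by have := h.potential_le; omega) ih

theorem Chain.quiet {n : ℕ} (h : Chain (Step tr) n S S') (hp : potential S' ≤ potential S) :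
    S'.clk = (fun r => S.clk r - n) ∧ (∀ r, S.clk r = 0 ↔ S'.clk r = 0) ∧
      (n ≠ 0 → Inside S.clk S.pos) ∧ Chain (FreeMove S.clk) n S.pos S'.pos := by
  induction h with
  | nil => exact ⟨rfl, fun _ => Iff.rfl, fun h => absurd rfl h, .nil _⟩
  | cons h hc ih =>
    have h1 := h.potential_le
    have h2 := hc.potential_le
    obtain ⟨e, hz, hi, hf⟩ := h.quiet (by omega)
    obtain ⟨e', hz', -, hf'⟩ := ih (by omega)
    refine ⟨?_, fun r => (hz r).trans (hz' r), fun _ => hi, .cons hf ?_⟩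
    · rw [e', e]
      funext r
      simp only
      omega
    · exact hf'.map id fun _ _ => FreeMove.congr fun r => (hz r).symm

theorem chain_bMacro {B n : ℕ} (hB : 1 ≤ B) (h : Chain (FreeMove d) n C C') (hC : Inside d C)
    (hC' : CollisionFree C) (d' : I.R → ℕ) (hd : ∀ r : I.R, Free d r.1 → n ≤ d' r) :
    Chain (BMacro tr B) n ⟨C, d'⟩ ⟨C', fun r => d' r - n⟩ := by
  induction h generalizing d' with
  | nil => exact .nil _
  | @cons n _ _ _ h _ ih =>
    have := ih (h.inside hC) h.collision_free (fun r => d' r - 1) fun r hr => by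
      have := hd r hr
      omega
    refine .cons ⟨1, hB, h.toMacro hC hC' rfl fun r hr => ?_⟩ ?_
    · have := hd r hr
      omega
    · convert this using 3
      omega

/-- The first move is kept and oscillated for `M` timesteps, and the rest is replaced by `K` token
moves with `K` of the same parity. The renaming `π` appears because tokens forget which asset they
are. -/
theorem Chain.exists_bMacro_of_quiet {B n : ℕ} (hB : 1 ≤ B) (h : Chain (Step tr) n S S')
    (hp : potential S' ≤ potential S) (hC : CollisionFree S.pos) (hS : ∀ r, S.clk r ≤ B) :
    ∃ L ≤ 3 * I.n ^ 2 + 2, ∃ π, Chain (BMacro tr B) L S (S'.perm π) := by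
  obtain ⟨e, hz, hi, hf⟩ := h.quiet hp
  obtain ⟨C, d⟩ := S
  obtain ⟨C', d'⟩ := S'
  simp only at e hz hi hf hC hS
  subst e
  cases n with
  | zero =>
    cases hf
    exact ⟨0, by omega, 1, .nil _⟩
  | succ n =>
    replace hi := hi (by omega)
    cases hf with
    | @cons _ _ C₁ _ h₁ hf =>
      obtain ⟨K, hK, hK', hpar, hc⟩ := exists_short_tokenMoves
        (chain_freeMove_tokenMove hf h₁.collision_free)
      obtain ⟨C₂, hc₂, ht⟩ := chain_tokenMove_freeMove hc rfl h₁.collision_free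
      obtain ⟨π, hπ⟩ := exists_perm h₁.collision_free hc₂ hf ht
      have hfree : ∀ r : I.R, Free d r.1 → n + 1 ≤ d r := fun r hr => by
        have h0 := hr.2.2 r rfl
        have := hz r
        simp only at this
        omega
      -- In general `M = n + 1 - K`, odd as `K` and `n` have the same parity; a clock that stays
      -- positive throughout shows `n + 1 < B`. If all clocks are 0, the duration is irrelevant and
      -- `M = 1` does.
      obtain ⟨M, hM, hMB, hMn, hMd⟩ : ∃ M, M % 2 = 1 ∧ M ≤ B ∧ M + K ≤ n + 1 ∧
          ∀ r, d r - M - K = d r - (n + 1) := by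
        by_cases hall : ∀ r, d r = 0
        · exact ⟨1, rfl, hB, by omega, fun r => by simp [hall r]⟩
        · push Not at hall
          obtain ⟨r, hr⟩ := hall
          have := hz r
          simp only at this
          have := hS r
          exact ⟨n + 1 - K, by omega, by omega, by omega, fun r => by omega⟩
      refine ⟨K + 1, by simpa using hK', π, .cons ⟨M, hMB, h₁.toMacro hi hC hM fun r hr => ?_⟩ ?_⟩
      · have := hfree r hr
        omega
      · have := chain_bMacro (tr := tr) hB hc₂ (h₁.inside hi) h₁.collision_free
          (fun r => d r - M) fun r hr => by
            have := hfree r hr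
            omega
        simpa only [hMd, State.perm, hπ] using this

/-- The walk is split at the first timestep that raises the potential. -/
theorem Chain.exists_event {n : ℕ} (h : Chain (Step tr) n S F) (hp : potential S < potential F) :
    ∃ S₁ S₂ n₁ n₂, Chain (Step tr) n₁ S S₁ ∧ potential S₁ ≤ potential S ∧ Step tr S₁ S₂ ∧
      potential S < potential S₂ ∧ Chain (Step tr) n₂ S₂ F := by
  induction h with
  | nil => exact absurd hp (lt_irrefl _)
  | @cons n x y z h hc ih =>
    by_cases hy : potential x < potential y
    · exact ⟨x, y, 0, n, .nil _, le_rfl, h, hy, hc⟩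
    · obtain ⟨S₁, S₂, n₁, n₂, h1, hp1, h2, hp2, h3⟩ := ih (by omega)
      have := h.potential_le
      exact ⟨S₁, S₂, n₁ + 1, n₂, .cons h h1, by omega, h2, by omega, h3⟩

theorem Step.invariant {B : ℕ} (hB : ∀ r, I.c r ≤ B) (h : Step tr S S') (hS : ∀ r, S.clk r ≤ B) :
    CollisionFree S'.pos ∧ ∀ r, S'.clk r ≤ B := by
  refine ⟨h.1.collision_free, fun r => ?_⟩
  rw [h.2, tick]
  split_ifs
  · exact hB r
  · exact (Nat.sub_le _ _).trans (hS r)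

theorem Chain.invariant {B n : ℕ} (hB : ∀ r, I.c r ≤ B) (h : Chain (Step tr) n S S')
    (hC : CollisionFree S.pos) (hS : ∀ r, S.clk r ≤ B) :
    CollisionFree S'.pos ∧ ∀ r, S'.clk r ≤ B := by
  induction h with
  | nil => exact ⟨hC, hS⟩
  | cons h _ ih =>
    obtain ⟨h1, h2⟩ := h.invariant hB hS
    exact ih h1 h2

/-- Up to the names of the assets, walks can be replaced by few macro steps. -/
theorem Chain.exists_bMacro {B n : ℕ} (hB : 1 ≤ B) (hc : ∀ r, I.c r ≤ B)
    (h : Chain (Step tr) n S F) (hC : CollisionFree S.pos) (hS : ∀ r, S.clk r ≤ B) :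
    ∃ L ≤ (6 * I.m + I.n - potential S + 1) * (3 * I.n ^ 2 + 3), ∃ π,
      Chain (BMacro tr B) L S (F.perm π) := by
  -- The induction is on the potential still to be gained. Each round costs at most `3 * I.n ^ 2 +
  -- 2` macro steps for the quiet stretch and one for the timestep that ends it.
  induction hD : 6 * I.m + I.n - potential S using Nat.strong_induction_on generalizing S n with
  | _ D ih =>
    by_cases hp : potential F ≤ potential S
    · obtain ⟨L, hL, π, h⟩ := h.exists_bMacro_of_quiet hB hp hC hS
      refine ⟨L, hL.trans ?_, π, h⟩
      nlinarith
    · obtain ⟨S₁, S₂, n₁, n₂, h1, hp1, h2, hp2, h3⟩ := h.exists_event (by omega)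
      obtain ⟨L₁, hL₁, π₁, hm₁⟩ := h1.exists_bMacro_of_quiet hB hp1 hC hS
      obtain ⟨hC₁, hS₁⟩ := h1.invariant hc hC hS
      obtain ⟨hC₂, hS₂⟩ := h2.invariant hc hS₁
      have hlt := _root_.RoutingInstance.potential_le (S := S₂)
      obtain ⟨L₂, hL₂, π₂, hm₂⟩ := ih _ (by omega) h3 hC₂ hS₂ rfl
      have hm : BMacro tr B S₁ S₂ := ⟨1, hB, h2.1, hC₁, Or.inl ⟨rfl, h2.2⟩⟩
      -- The quiet stretch ends in a renamed state, so everything after it is renamed by `π₁` as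
      -- well.
      refine ⟨L₁ + (L₂ + 1), ?_, π₂ * π₁,
        hm₁.append (.cons (hm.perm π₁) (hm₂.map (State.perm π₁) (BMacro.perm π₁)))⟩
      have : 6 * I.m + I.n - potential S₂ + 1 ≤ D := by omega
      have := Nat.mul_le_mul_right (3 * I.n ^ 2 + 3) this
      rw [Nat.succ_mul]
      omega

theorem Final.perm (h : Final F) (π : Equiv.Perm (Fin I.m)) : Final (F.perm π) := by
  refine ⟨fun a => h.1 (π a), h.2.trans_eq (Nat.card_congr ?_)⟩
  exact (π.subtypeEquivOfSubtype (p := fun a => F.pos a = some I.t)).symm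

theorem exists_short_walk {B : ℕ} (hB : 1 ≤ B) (hc : ∀ r, I.c r ≤ B)
    (h : ReflTransGen (Step tr) (State.init I) F) (hF : Final F) :
    ∃ L ≤ (6 * I.m + I.n + 1) * (3 * I.n ^ 2 + 3), ∃ F',
      Chain (BMacro tr B) L (State.init I) F' ∧ Final F' := by
  obtain ⟨n, h⟩ := exists_chain h
  obtain ⟨L, hL, π, h⟩ := h.exists_bMacro hB hc (fun a a' _ _ => Or.inl rfl) fun r => Nat.zero_le _
  refine ⟨L, hL.trans ?_, _, h, hF.perm π⟩
  gcongr
  omega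

end RoutingInstance
end

/-! ### The verifier and its running time. -/

noncomputable section

namespace RoutingInstance

open StackProg

/-- The numbers of vertices and assets, the goal, the initial vertex and the target of an instance,
its adjacency matrix, and for each vertex its reload time in binary (or the empty word if it is not
a trap). -/
abbrev Data := ℕ × ℕ × ℕ × ℕ × ℕ × List (List Bool) × List (List Bool)

/-- The duration of the last macro step, the positions of the assets, and the clocks of the
traps. -/
abbrev Snapshot := List Bool × List ℕ × List (List Bool)

/-- The clock at the vertex `v`. -/
def Snapshot.clk (σ : Snapshot) (v : ℕ) : List Bool := σ.2.2.getD v []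

/-- Equality of binary numbers. -/
def eqBits (a b : List Bool) : Bool := leBits a b && leBits b a

theorem eqBits_iff (a b : List Bool) : eqBits a b = true ↔ bitsVal a = bitsVal b := by
  rw [eqBits, Bool.and_eq_true, leBits_iff, leBits_iff]
  omega

namespace Data

variable (D : Data) (σ σ' : Snapshot)

/-- The number of vertices. -/
def n : ℕ := D.1
/-- The number of assets. -/
def m : ℕ := D.2.1
/-- The goal. -/
def k : ℕ := D.2.2.1
/-- The initial vertex. -/
def s : ℕ := D.2.2.2.1
/-- The target. -/
def t : ℕ := D.2.2.2.2.1
/-- The adjacency matrix. -/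
def adj (u v : ℕ) : Bool := (D.2.2.2.2.2.1.getD u []).getD v false
/-- The reload times. -/
def trap (v : ℕ) : List Bool := if decide (v < D.n) = true then D.2.2.2.2.2.2.getD v [] else []
/-- Whether there is a trap at the vertex `v`. -/
def isTrap (v : ℕ) : Bool := !(D.trap v).isEmpty

/-- The location of the asset `a`; the number of vertices stands for `†`. -/
def loc (a : ℕ) : ℕ := if decide (σ.2.1.getD a D.n < D.n) = true then σ.2.1.getD a D.n else D.n

/-- Whether there is an active trap at `v`. -/
def armed (v : ℕ) : Bool := D.isTrap v && leBits (σ.clk v) []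

/-- Check for collisions. -/
def collisionFree : Bool :=
  (List.range D.m).all fun a => (List.range D.m).all fun a' =>
    decide (a = a') || !decide (D.loc σ a = D.loc σ a') || decide (D.loc σ a = D.s) ||
      decide (D.loc σ a = D.t) || decide (D.loc σ a = D.n)

/-- Check the move of an asset. -/
def assetCheck (b : Bool) (a : ℕ) : Bool :=
  (!decide (D.loc σ' a = D.s) || decide (D.loc σ a = D.s)) &&
  (!(decide (D.loc σ a = D.t) || decide (D.loc σ a = D.n)) ||
    decide (D.loc σ' a = D.loc σ a)) &&
  (decide (D.loc σ' a = D.n) || (!decide (D.loc σ a = D.n) &&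
    (D.adj (D.loc σ a) (D.loc σ' a) || decide (D.loc σ a = D.loc σ' a)))) &&
  (!D.armed σ (D.loc σ a) || decide (D.loc σ' a = D.n)) &&
  (!b || decide (D.loc σ a = D.n) || !decide (D.loc σ' a = D.n) || D.armed σ (D.loc σ a))

/-- Check a move. -/
def moveCheck (b : Bool) : Bool :=
  (List.range D.m).all (fun a => D.assetCheck σ σ' b a) && D.collisionFree σ' &&
    (List.range D.m).any fun a => !decide (D.loc σ a = D.loc σ' a)

/-- Check the clocks after a single timestep. -/
def tickCheck : Bool :=
  (List.range D.n).all fun v => !D.isTrap v || eqBits (σ'.clk v)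
    (if ((List.range D.m).any (fun a => decide (D.loc σ a = v)) && leBits (σ.clk v) []) = true
      then D.trap v else subBits (σ.clk v) [true])

/-- Check the conditions on macro steps with more than one timestep. -/
def repeatCheck : Bool :=
  σ'.1.headD false &&
  (List.range D.m).all (fun a => (!decide (D.loc σ a = D.s) || decide (D.loc σ' a = D.s)) &&
    (!(decide (D.loc σ' a = D.t) || decide (D.loc σ' a = D.n)) ||
      decide (D.loc σ a = D.loc σ' a))) &&
  (List.range D.n).all fun v => !D.isTrap v || (eqBits (σ'.clk v) (subBits (σ.clk v) σ'.1) &&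
    (List.range D.m).all fun a => !(decide (D.loc σ a = v) || decide (D.loc σ' a = v)) ||
      leBits σ'.1 (σ.clk v))

/-- Check a macro step. -/
def macroCheck (b : Bool) : Bool :=
  D.moveCheck σ σ' b && D.collisionFree σ &&
    ((eqBits σ'.1 [true] && D.tickCheck σ σ') || D.repeatCheck σ σ')

/-- Check that all assets are at the initial vertex and all traps are active. -/
def initCheck : Bool :=
  (List.range D.m).all (fun a => decide (D.loc σ a = D.s)) &&
    (List.range D.n).all fun v => !D.isTrap v || leBits (σ.clk v) []

/-- Check that all assets have reached their final location and enough of them survive. -/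
def finalCheck : Bool :=
  (List.range D.m).all (fun a => decide (D.loc σ a = D.t) || decide (D.loc σ a = D.n)) &&
    decide (D.k ≤ (List.range D.m).countP fun a => decide (D.loc σ a = D.t))

/-- Check that the data describe an instance. -/
def wellFormed : Bool :=
  decide (D.s < D.n) && decide (D.t < D.n) && !decide (D.s = D.t) && !D.isTrap D.s &&
  !D.isTrap D.t && decide (1 ≤ D.k) && decide (D.k ≤ D.m) &&
  (List.range D.n).all (fun u => !D.adj u u && (List.range D.n).all fun v =>
    !D.adj u v || D.adj v u) &&
  (List.range D.n).all fun v => !D.isTrap v || (D.trap v).reverse.headD false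

/-- The encoding of an instance. -/
def word : List Bool :=
  ((List.range D.n).map (fun _ => true) ++ [false]) ++
  ((List.range D.m).map (fun _ => true) ++ [false]) ++
  (D.k.bits.flatMap (fun b => [true, b]) ++ [false]) ++
  (D.s.bits.flatMap (fun b => [true, b]) ++ [false]) ++
  (D.t.bits.flatMap (fun b => [true, b]) ++ [false]) ++
  (List.range D.n).flatMap (fun u => (List.range D.n).map fun v => D.adj u v) ++
  (List.range D.n).flatMap (fun v => if D.isTrap v = true then
    true :: ((D.trap v).flatMap (fun b => [true, b]) ++ [false]) else [false])

end Data

/-- The verifier for Routing Plan; the flag tells whether assets have to be eliminated by active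
traps. -/
def verify (b : Bool) (x : List Bool × Data × List Snapshot) : Bool :=
  decide (x.2.1.word = x.1) && x.2.1.wellFormed && x.2.1.initCheck (x.2.2.getD 0 ([], [], [])) &&
  (List.range (x.2.2.length - 1)).all (fun i => x.2.1.macroCheck (x.2.2.getD i ([], [], []))
    (x.2.2.getD (i + 1) ([], [], [])) b) &&
  x.2.1.finalCheck (x.2.2.getD (x.2.2.length - 1) ([], [], []))

section PTime

variable {α : Type} [Coded α] {D : α → Data} {σ σ' : α → Snapshot} {u v : α → ℕ}
  {f g : α → List Bool} {b : Bool}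

@[fun_prop] theorem ptime_clk (hσ : PTime σ) (hv : PTime v) :
    PTime fun x => (σ x).clk (v x) := by unfold Snapshot.clk; fun_prop

@[fun_prop] theorem ptime_eqBits (hf : PTime f) (hg : PTime g) :
    PTime fun x => eqBits (f x) (g x) := by unfold eqBits; fun_prop

@[fun_prop] theorem ptime_n (hD : PTime D) : PTime fun x => (D x).n := by unfold Data.n; fun_prop
@[fun_prop] theorem ptime_m (hD : PTime D) : PTime fun x => (D x).m := by unfold Data.m; fun_prop
@[fun_prop] theorem ptime_k (hD : PTime D) : PTime fun x => (D x).k := by unfold Data.k; fun_prop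
@[fun_prop] theorem ptime_s (hD : PTime D) : PTime fun x => (D x).s := by unfold Data.s; fun_prop
@[fun_prop] theorem ptime_t (hD : PTime D) : PTime fun x => (D x).t := by unfold Data.t; fun_prop

@[fun_prop] theorem ptime_adj (hD : PTime D) (hu : PTime u) (hv : PTime v) :
    PTime fun x => (D x).adj (u x) (v x) := by unfold Data.adj; fun_prop

@[fun_prop] theorem ptime_trap (hD : PTime D) (hv : PTime v) :
    PTime fun x => (D x).trap (v x) := by unfold Data.trap; fun_prop

@[fun_prop] theorem ptime_isTrap (hD : PTime D) (hv : PTime v) :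
    PTime fun x => (D x).isTrap (v x) := by unfold Data.isTrap; fun_prop

@[fun_prop] theorem ptime_loc (hD : PTime D) (hσ : PTime σ) (hv : PTime v) :
    PTime fun x => (D x).loc (σ x) (v x) := by unfold Data.loc; fun_prop

@[fun_prop] theorem ptime_armed (hD : PTime D) (hσ : PTime σ) (hv : PTime v) :
    PTime fun x => (D x).armed (σ x) (v x) := by unfold Data.armed; fun_prop

@[fun_prop] theorem ptime_collisionFree (hD : PTime D) (hσ : PTime σ) :
    PTime fun x => (D x).collisionFree (σ x) := by
  unfold Data.collisionFree
  exact PTime.all (PTime.all (by fun_prop) (by fun_prop)) (by fun_prop)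

@[fun_prop] theorem ptime_assetCheck (hD : PTime D) (hσ : PTime σ) (hσ' : PTime σ')
    (hv : PTime v) : PTime fun x => (D x).assetCheck (σ x) (σ' x) b (v x) := by
  unfold Data.assetCheck
  fun_prop

@[fun_prop] theorem ptime_moveCheck (hD : PTime D) (hσ : PTime σ) (hσ' : PTime σ') :
    PTime fun x => (D x).moveCheck (σ x) (σ' x) b := by
  unfold Data.moveCheck
  exact .and (.and (.all (by fun_prop) (by fun_prop)) (by fun_prop))
    (.any (by fun_prop) (by fun_prop))

@[fun_prop] theorem ptime_tickCheck (hD : PTime D) (hσ : PTime σ) (hσ' : PTime σ') :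
    PTime fun x => (D x).tickCheck (σ x) (σ' x) := by
  unfold Data.tickCheck
  exact .all (.or (by fun_prop) (ptime_eqBits (by fun_prop) (.ite
    (.and (.any (by fun_prop) (by fun_prop)) (by fun_prop)) (by fun_prop) (by fun_prop))))
    (by fun_prop)

@[fun_prop] theorem ptime_repeatCheck (hD : PTime D) (hσ : PTime σ) (hσ' : PTime σ') :
    PTime fun x => (D x).repeatCheck (σ x) (σ' x) := by
  unfold Data.repeatCheck
  exact .and (.and (by fun_prop) (.all (by fun_prop) (by fun_prop)))
    (.all (.or (by fun_prop) (.and (by fun_prop) (.all (by fun_prop) (by fun_prop))))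
      (by fun_prop))

@[fun_prop] theorem ptime_macroCheck (hD : PTime D) (hσ : PTime σ) (hσ' : PTime σ') :
    PTime fun x => (D x).macroCheck (σ x) (σ' x) b := by
  unfold Data.macroCheck
  fun_prop

@[fun_prop] theorem ptime_initCheck (hD : PTime D) (hσ : PTime σ) :
    PTime fun x => (D x).initCheck (σ x) := by
  unfold Data.initCheck
  exact .and (.all (by fun_prop) (by fun_prop)) (.all (by fun_prop) (by fun_prop))

@[fun_prop] theorem ptime_finalCheck (hD : PTime D) (hσ : PTime σ) :
    PTime fun x => (D x).finalCheck (σ x) := by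
  unfold Data.finalCheck
  exact .and (.all (by fun_prop) (by fun_prop))
    (.decideLe (by fun_prop) (.countP (by fun_prop) (by fun_prop)))

@[fun_prop] theorem ptime_wellFormed (hD : PTime D) : PTime fun x => (D x).wellFormed := by
  unfold Data.wellFormed
  exact .and (.and (by fun_prop) (.all (.and (by fun_prop) (.all (by fun_prop) (by fun_prop)))
    (by fun_prop))) (.all (by fun_prop) (by fun_prop))

theorem ptime_digits (hf : PTime f) :
    PTime fun x => (f x).flatMap (fun b => [true, b]) ++ [false] :=
  .append (.flatMap (by fun_prop) hf) (by fun_prop)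

@[fun_prop] theorem ptime_word (hD : PTime D) : PTime fun x => (D x).word := by
  have h : ∀ v : α → ℕ, PTime v → PTime fun x => (List.range (v x)).map (fun _ => true) ++ [false] :=
    fun v hv => .append (.map (by fun_prop) (by fun_prop)) (by fun_prop)
  unfold Data.word
  exact .append (.append (.append (.append (.append (.append (h _ (by fun_prop)) (h _ (by fun_prop)))
    (ptime_digits (by fun_prop))) (ptime_digits (by fun_prop))) (ptime_digits (by fun_prop)))
    (.flatMap (.map (by fun_prop) (by fun_prop)) (by fun_prop)))
    (.flatMap (.ite (by fun_prop) (.cons (by fun_prop) (ptime_digits (by fun_prop)))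
      (by fun_prop)) (by fun_prop))

theorem ptime_verify (b : Bool) : PTime (verify b) := by
  unfold verify
  exact .and (.and (by fun_prop) (.all (by fun_prop) (by fun_prop))) (by fun_prop)

end PTime

end RoutingInstance
end

/-! ### Soundness of the verifier. -/

noncomputable section

namespace RoutingInstance

open StackProg Relation

variable {I : RoutingInstance} {D : Data} {σ σ' : Snapshot} {S S' : State I} {b : Bool}

/-- The number that stands for a location. -/
def locCode (x : I.Location) : ℕ := x.elim I.n Fin.val

@[simp] theorem locCode_some (v : Fin I.n) : locCode (some v : I.Location) = v := rfl

@[simp] theorem locCode_none : locCode (none : I.Location) = I.n := rfl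

theorem locCode_injective : Function.Injective (locCode (I := I)) := by
  intro x y h
  cases x with
  | none => cases y with
    | none => rfl
    | some v => exact absurd v.2 (by simp at h; omega)
  | some u => cases y with
    | none => exact absurd u.2 (by simp at h; omega)
    | some v => simpa [Fin.ext_iff] using h

theorem locCode_eq_iff {x y : I.Location} : locCode x = locCode y ↔ x = y :=
  locCode_injective.eq_iff

theorem locCode_eq_val {x : I.Location} {v : Fin I.n} : locCode x = v ↔ x = some v :=
  locCode_eq_iff (y := some v)

theorem locCode_eq_n {x : I.Location} : locCode x = I.n ↔ x = none :=
  locCode_eq_iff (y := none)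

/-- The data describe the instance. -/
structure Data.Represents (D : Data) (I : RoutingInstance) : Prop where
  n : D.n = I.n
  m : D.m = I.m
  k : D.k = I.k
  s : D.s = I.s
  t : D.t = I.t
  adj : ∀ u v : Fin I.n, D.adj u v = true ↔ I.G.Adj u v
  trap : ∀ r : I.R, D.trap r.1 = (I.c r).bits
  isTrap : ∀ v : ℕ, D.isTrap v = true ↔ ∃ r : I.R, (r.1 : ℕ) = v

/-- The snapshot describes the state. -/
structure Snapshot.Shows (σ : Snapshot) (D : Data) (S : State I) : Prop where
  loc : ∀ a : Fin I.m, D.loc σ a = locCode (S.pos a)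
  clk : ∀ r : I.R, bitsVal (σ.clk r.1) = S.clk r

theorem all_range_iff {n : ℕ} {p : ℕ → Bool} :
    (List.range n).all p = true ↔ ∀ a : Fin n, p a = true := by
  simp [Fin.forall_iff]

theorem any_range_iff {n : ℕ} {p : ℕ → Bool} :
    (List.range n).any p = true ↔ ∃ a : Fin n, p a = true := by
  simp [Fin.exists_iff]

namespace Data.Represents

variable (hD : D.Represents I)
include hD

theorem all_traps_iff {p : ℕ → Bool} :
    (List.range D.n).all (fun v => !D.isTrap v || p v) = true ↔ ∀ r : I.R, p r.1 = true := by
  rw [hD.n, all_range_iff]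
  constructor
  · intro h r
    have := h r.1
    rwa [(hD.isTrap r.1).2 ⟨r, rfl⟩] at this
  · intro h v
    by_cases hv : D.isTrap v = true
    · obtain ⟨r, hr⟩ := (hD.isTrap v).1 hv
      rw [← hr, h r, Bool.or_true]
    · simp [hv]

theorem armed_iff (h : σ.Shows D S) (x : I.Location) :
    D.armed σ (locCode x) = true ↔ ∃ r : I.R, x = some r.1 ∧ S.clk r = 0 := by
  rw [Data.armed, Bool.and_eq_true, hD.isTrap, leBits_iff]
  constructor
  · rintro ⟨⟨r, hr⟩, h0⟩
    refine ⟨r, locCode_eq_val.1 hr.symm, ?_⟩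
    rw [← hr, h.clk] at h0
    simpa using h0
  · rintro ⟨r, rfl, h0⟩
    refine ⟨⟨r, rfl⟩, ?_⟩
    rw [locCode_some, h.clk, h0]
    exact Nat.zero_le _

theorem collisionFree_iff (h : σ.Shows D S) :
    D.collisionFree σ = true ↔ CollisionFree S.pos := by
  simp only [Data.collisionFree, hD.m, hD.s, hD.t, hD.n, all_range_iff, h.loc, Bool.or_eq_true,
    Bool.not_eq_true', decide_eq_true_eq, decide_eq_false_iff_not, locCode_eq_iff, locCode_eq_val,
    locCode_eq_n, Fin.val_inj, CollisionFree]
  grind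

theorem moveCheck_iff (h : σ.Shows D S) (h' : σ'.Shows D S') :
    D.moveCheck σ σ' b = true ↔ Move (b = true) S.pos S.clk S'.pos := by
  have hadj : ∀ x y : I.Location,
      (y = none ∨ x ≠ none ∧ (D.adj (locCode x) (locCode y) = true ∨ x = y)) ↔
        ∀ v, y = some v → ∃ u, x = some u ∧ (I.G.Adj u v ∨ u = v) := by
    rintro (_ | u) (_ | v) <;> simp [hD.adj]
  simp only [Data.moveCheck, Data.assetCheck, hD.m, hD.s, hD.t, hD.n, all_range_iff, any_range_iff,
    h.loc, h'.loc, Bool.and_eq_true, Bool.or_eq_true, Bool.not_eq_true', decide_eq_true_eq,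
    locCode_eq_iff, locCode_eq_val, locCode_eq_n, ← ne_eq, hadj,
    hD.collisionFree_iff h', ← Bool.not_eq_true, hD.armed_iff h]
  constructor
  · rintro ⟨⟨H, hc⟩, hp⟩
    refine ⟨fun a ha => ?_, fun a ha => ?_, fun a => (H a).1.1.2, hc, fun a r hr h0 => ?_,
      fun hb a ha ha' => ?_, hp⟩
    · exact (H a).1.1.1.1.resolve_left (not_not_intro ha)
    · exact (H a).1.1.1.2.resolve_left (not_not_intro ha)
    · exact (H a).1.2.resolve_left (not_not_intro ⟨r, hr, h0⟩)
    · have := (H a).2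
      tauto
  · intro H
    refine ⟨⟨fun a => ⟨⟨⟨⟨?_, ?_⟩, H.move a⟩, ?_⟩, ?_⟩, H.collision_free⟩, H.progress⟩
    · exact imp_iff_not_or.1 (H.no_return a)
    · exact imp_iff_not_or.1 (H.stay a)
    · exact imp_iff_not_or.1 fun ⟨r, hr, h0⟩ => H.trap a r hr h0
    · have := fun hb => H.only hb a
      tauto

theorem tickCheck_iff (h : σ.Shows D S) (h' : σ'.Shows D S') :
    D.tickCheck σ σ' = true ↔ S'.clk = tick S.pos S.clk := by
  rw [Data.tickCheck, hD.all_traps_iff, funext_iff]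
  refine forall_congr' fun r => ?_
  rw [eqBits_iff, h'.clk, tick]
  have : ((List.range D.m).any (fun a => decide (D.loc σ a = r.1)) && leBits (σ.clk r.1) [])
      = true ↔ (∃ a, S.pos a = some r.1) ∧ S.clk r = 0 := by
    simp only [Bool.and_eq_true, hD.m, any_range_iff, h.loc, decide_eq_true_eq, locCode_eq_val,
      leBits_iff, h.clk, bitsVal_nil, Nat.le_zero]
  simp only [this]
  split_ifs
  · rw [hD.trap, bitsVal_bits]
  · rw [bitsVal_subBits, h.clk]
    simp

theorem repeatCheck_iff (h : σ.Shows D S) (h' : σ'.Shows D S') :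
    D.repeatCheck σ σ' = true ↔ bitsVal σ'.1 % 2 = 1 ∧ Back S.pos S'.pos ∧
      (∀ (r : I.R) a, S.pos a = some r.1 ∨ S'.pos a = some r.1 → bitsVal σ'.1 ≤ S.clk r) ∧
      S'.clk = fun r => S.clk r - bitsVal σ'.1 := by
  have hodd : ∀ l : List Bool, l.headD false = true ↔ bitsVal l % 2 = 1 := by
    rintro (_ | ⟨_ | _, l⟩) <;> simp [Nat.add_mod]
  rw [Data.repeatCheck, Bool.and_eq_true, Bool.and_eq_true, hD.all_traps_iff]
  simp only [hD.m, hD.s, hD.t, hD.n, all_range_iff, h.loc, h'.loc, Bool.and_eq_true,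
    Bool.or_eq_true, Bool.not_eq_true', Bool.or_eq_false_iff,
    decide_eq_true_eq, decide_eq_false_iff_not, locCode_eq_iff, locCode_eq_val, locCode_eq_n,
    hodd, eqBits_iff, leBits_iff, bitsVal_subBits, h.clk, h'.clk, Back, funext_iff,
    ← not_or, ← imp_iff_not_or, forall_and]
  tauto

theorem macroCheck_iff (h : σ.Shows D S) (h' : σ'.Shows D S') :
    D.macroCheck σ σ' b = true ↔ Macro (b = true) (bitsVal σ'.1) S S' := by
  rw [Data.macroCheck, Bool.and_eq_true, Bool.and_eq_true, Bool.or_eq_true, Bool.and_eq_true,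
    hD.moveCheck_iff h h', hD.collisionFree_iff h, hD.tickCheck_iff h h', hD.repeatCheck_iff h h',
    eqBits_iff]
  simp only [bitsVal_cons, bitsVal_nil, Bool.toNat_true]
  exact ⟨fun ⟨⟨h1, h2⟩, h3⟩ => ⟨h1, h2, h3⟩, fun ⟨h1, h2, h3⟩ => ⟨⟨h1, h2⟩, h3⟩⟩

theorem initCheck_iff (h : σ.Shows D S) : D.initCheck σ = true ↔ S = State.init I := by
  rw [Data.initCheck, Bool.and_eq_true, hD.all_traps_iff]
  simp only [hD.m, hD.s, all_range_iff, h.loc, decide_eq_true_eq, locCode_eq_val, leBits_iff,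
    h.clk, bitsVal_nil, Nat.le_zero, State.ext_iff, State.init, funext_iff]

theorem finalCheck_iff (h : σ.Shows D S) : D.finalCheck σ = true ↔ Final S := by
  classical
  have hc : (List.range I.m).countP (fun a => decide (D.loc σ a = I.t)) =
      Nat.card {a // S.pos a = some I.t} := by
    have e : Finset.univ.filter (fun a => S.pos a = some I.t) =
        ((List.finRange I.m).filter fun a : Fin I.m => decide (D.loc σ a = I.t)).toFinset := by
      ext a
      simp [h.loc, locCode_eq_val]
    rw [← List.map_coe_finRange_eq_range, List.countP_map, Nat.card_eq_fintype_card,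
      Fintype.card_subtype, e, List.toFinset_card_of_nodup ((List.nodup_finRange _).filter _),
      List.countP_eq_length_filter]
    rfl
  rw [Data.finalCheck, Bool.and_eq_true]
  simp only [hD.m, hD.t, hD.n, hD.k, hc, all_range_iff, h.loc, Bool.or_eq_true, decide_eq_true_eq,
    locCode_eq_val, locCode_eq_n]
  rfl

theorem word_eq : D.word = I.encode := by
  classical
  have hmap : ∀ n : ℕ, (List.range n).map (fun _ => true) ++ [false] = encodeUnary n := by
    intro n
    simp [encodeUnary, List.map_const']
  have hr : List.range I.n = (List.finRange I.n).map Fin.val := by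
    rw [List.map_coe_finRange_eq_range]
  rw [Data.word, hmap, hmap, hD.k, hD.s, hD.t, hD.m, hD.n, hr]
  simp only [List.flatMap_map, List.map_map, encode, encodeBinary]
  congr 1
  · congr 1
    refine List.flatMap_congr fun u _ => List.map_congr_left fun v _ => ?_
    rw [Bool.eq_iff_iff, Function.comp_apply, hD.adj, decide_eq_true_eq]
  · refine List.flatMap_congr fun v _ => ?_
    by_cases hv : v ∈ I.R
    · have : D.isTrap v = true := (hD.isTrap v).2 ⟨⟨v, hv⟩, rfl⟩
      rw [if_pos this, dif_pos hv, hD.trap ⟨v, hv⟩]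
    · have : ¬ D.isTrap v = true := fun h => by
        obtain ⟨r, hr⟩ := (hD.isTrap v).1 h
        exact hv (Fin.ext hr ▸ r.2)
      rw [if_neg this, dif_neg hv]

end Data.Represents

theorem Data.exists_represents (h : D.wellFormed = true) : ∃ I, D.Represents I := by
  -- An empty reload word marks a vertex without trap. This is unambiguous, since reload times are
  -- positive.
  simp only [Data.wellFormed, Bool.and_eq_true, Bool.or_eq_true, Bool.not_eq_true',
    decide_eq_true_eq, decide_eq_false_iff_not, all_range_iff] at h
  obtain ⟨⟨⟨⟨⟨⟨⟨⟨hs, ht⟩, hst⟩, hst'⟩, htt⟩, hk⟩, hkm⟩, hadj⟩, htrap⟩ := h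
  have hlt : ∀ v, D.isTrap v = true → v < D.n := by
    intro v hv
    by_contra hn
    simp [Data.isTrap, Data.trap, hn] at hv
  let R : Finset (Fin D.n) := Finset.univ.filter fun v => D.isTrap v = true
  have hbits : ∀ r : R, 0 < bitsVal (D.trap r.1) ∧ (bitsVal (D.trap r.1)).bits = D.trap r.1 := by
    intro r
    have hr := (Finset.mem_filter.1 r.2).2
    refine bits_bitsVal ((htrap r.1).resolve_left ?_)
    simp [hr]
  refine ⟨⟨D.n, D.m, ⟨fun u v => D.adj u v = true, ⟨fun u v h => ?_⟩, ⟨fun u => ?_⟩⟩, ⟨D.s, hs⟩,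
    ⟨D.t, ht⟩, fun e => hst (congrArg Fin.val e), R, by simp [R, hst'], by simp [R, htt],
    fun r => bitsVal (D.trap r.1), fun r => (hbits r).1, D.k, hk, hkm⟩, ⟨rfl, rfl, rfl, rfl, rfl,
    fun u v => Iff.rfl, fun r => (hbits r).2.symm, fun v => ⟨fun hv => ?_, ?_⟩⟩⟩
  · exact ((hadj u).2 v).resolve_left (by simp [h])
  · simpa using (hadj u).1
  · exact ⟨⟨⟨v, hlt v hv⟩, Finset.mem_filter.2 ⟨Finset.mem_univ _, hv⟩⟩, rfl⟩
  · rintro ⟨r, rfl⟩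
    exact (Finset.mem_filter.1 r.2).2

/-- Every snapshot shows some state. -/
theorem Snapshot.exists_shows (hD : D.Represents I) (σ : Snapshot) :
    ∃ S : State I, σ.Shows D S := by
  refine ⟨⟨fun a => if h : D.loc σ a < I.n then some ⟨_, h⟩ else none,
    fun r => bitsVal (σ.clk r.1)⟩, fun a => ?_, fun r => rfl⟩
  simp only
  split_ifs with h
  · rfl
  · rw [locCode_none]
    unfold Data.loc at *
    -- Positions out of range have been replaced by the code of `†`, so even a meaningless snapshot
    -- denotes a state.
    rw [hD.n] at *
    split_ifs at h ⊢ with h1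
    · exact absurd (of_decide_eq_true h1) h
    · rfl

/-- `I` is a yes-instance; the flag tells whether assets have to be eliminated by active traps. -/
def IsYesWith (I : RoutingInstance) (b : Bool) : Prop :=
  ∃ ρ : I.Plan, Valid ρ ∧ (b = true → EliminatedByTraps ρ) ∧ Achieves ρ I.k

/-- Well-formed data describe an instance, and comparing words shows that it is the encoded one. The
snapshots show states joined by macro steps, which unroll to a walk and hence to a plan. -/
theorem verify_sound {x : List Bool} {c : Data × List Snapshot} (h : verify b (x, c) = true) :
    ∃ I : RoutingInstance, I.encode = x ∧ I.IsYesWith b := by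
  obtain ⟨D, l⟩ := c
  simp only [verify, Bool.and_eq_true, decide_eq_true_eq, List.all_eq_true, List.mem_range] at h
  obtain ⟨⟨⟨⟨hw, hwf⟩, hinit⟩, hm⟩, hfin⟩ := h
  obtain ⟨I, hD⟩ := D.exists_represents hwf
  refine ⟨I, hD.word_eq.symm.trans hw, ?_⟩
  choose S hS using fun i => Snapshot.exists_shows hD (l.getD i ([], [], []))
  have key : ∀ i ≤ l.length - 1, ReflTransGen (Step (b = true)) (State.init I) (S i) := by
    intro i
    induction i with
    | zero =>
      intro _
      rw [(hD.initCheck_iff (hS 0)).1 hinit]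
    | succ i ih =>
      intro hi
      exact (ih (by omega)).trans ((hD.macroCheck_iff (hS i) (hS (i + 1))).1 (hm i hi)).reflTransGen
  exact exists_plan_of_walk (key _ le_rfl) ((hD.finalCheck_iff (hS _)).1 hfin)

end RoutingInstance
end

/-! ### Completeness of the verifier: certificates of polynomial size. -/

noncomputable section

namespace RoutingInstance

open StackProg Relation

variable {I : RoutingInstance} {S S' : State I} {b : Bool}

variable (I) in
open scoped Classical in
/-- The data of an instance. -/
def data : Data :=
  (I.n, I.m, I.k, I.s, I.t, List.ofFn fun u => List.ofFn fun v => decide (I.G.Adj u v),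
    List.ofFn fun v => if h : v ∈ I.R then (I.c ⟨v, h⟩).bits else [])

open scoped Classical in
/-- The snapshot of a state after a macro step of duration `N`. -/
def snapshot (N : ℕ) (S : State I) : Snapshot :=
  (N.bits, List.ofFn fun a => locCode (S.pos a),
    List.ofFn fun v => if h : v ∈ I.R then (S.clk ⟨v, h⟩).bits else [])

theorem getD_ofFn {α : Type*} {n : ℕ} (f : Fin n → α) (i : Fin n) (d : α) :
    (List.ofFn f).getD i d = f i := by
  simp [List.getD_eq_getElem?_getD]

theorem trap_data (v : Fin I.n) [Decidable (v ∈ I.R)] :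
    I.data.trap v = if h : v ∈ I.R then (I.c ⟨v, h⟩).bits else [] := by
  rw [Data.trap, if_pos (decide_eq_true (show (v : ℕ) < I.data.n from v.2))]
  refine (getD_ofFn _ v []).trans ?_
  split_ifs <;> rfl

theorem bits_c_ne_nil (r : I.R) : (I.c r).bits ≠ [] := by
  intro h
  have := bitsVal_bits (I.c r)
  have := I.c_pos r
  simp [h] at *
  omega

theorem represents_data : I.data.Represents I where
  n := rfl
  m := rfl
  k := rfl
  s := rfl
  t := rfl
  adj u v := by
    classical
    rw [Data.adj]
    refine (Eq.congr_left (congrArg (fun l => List.getD l _ _) (getD_ofFn _ u []))).trans ?_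
    rw [getD_ofFn, decide_eq_true_eq]
  trap r := by
    classical
    rw [trap_data, dif_pos r.2]
  isTrap v := by
    classical
    rw [Data.isTrap, Bool.not_eq_true', List.isEmpty_eq_false_iff]
    constructor
    · intro h
      by_cases hv : v < I.n
      · rw [trap_data ⟨v, hv⟩] at h
        split_ifs at h with hR
        · exact ⟨⟨_, hR⟩, rfl⟩
        · exact absurd rfl h
      · refine absurd (if_neg ?_) h
        exact fun h => hv (of_decide_eq_true h)
    · rintro ⟨r, rfl⟩
      rw [trap_data, dif_pos r.2]
      exact bits_c_ne_nil r

theorem wellFormed_data : I.data.wellFormed = true := by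
  have hD := I.represents_data
  have ht : ∀ v : Fin I.n, v ∉ I.R → I.data.isTrap v = false := by
    intro v hv
    rw [Bool.eq_false_iff]
    intro h
    obtain ⟨r, hr⟩ := (hD.isTrap v).1 h
    exact hv (Fin.ext hr ▸ r.2)
  rw [Data.wellFormed, Bool.and_eq_true, hD.all_traps_iff]
  simp only [hD.s, hD.t, hD.n, hD.k, hD.m, Bool.and_eq_true, Bool.or_eq_true, Bool.not_eq_true',
    decide_eq_true_eq, all_range_iff, ht _ I.s_notMem, ht _ I.t_notMem,
    ← Bool.not_eq_true, hD.adj, hD.trap]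
  refine ⟨⟨⟨⟨⟨⟨⟨⟨I.s.2, I.t.2⟩, fun h => I.s_ne_t (Fin.ext h)⟩, ?_⟩, ?_⟩, I.k_pos⟩, I.k_le⟩,
    fun u => ⟨I.G.loopless.1 u, fun v => imp_iff_not_or.1 fun h => I.G.symm.symm _ _ h⟩⟩,
    fun r => headD_reverse_bits (I.c_pos r)⟩ <;> simp

theorem shows_snapshot (N : ℕ) (S : State I) : (snapshot N S).Shows I.data S where
  loc a := by
    rw [Data.loc]
    have h : (snapshot N S).2.1.getD a I.data.n = locCode (S.pos a) := getD_ofFn _ a _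
    rw [h]
    cases S.pos a with
    | none => simp [Data.n, data]
    | some v => exact if_pos (decide_eq_true v.2)
  clk r := by
    have h : (snapshot N S).clk r.1 = _ := getD_ofFn _ r.1 []
    rw [h, dif_pos r.2, bitsVal_bits]

theorem BMacro.clk_le {tr : Prop} {B : ℕ} (hB : ∀ r, I.c r ≤ B) (h : BMacro tr B S S')
    (hS : ∀ r, S.clk r ≤ B) (r : I.R) : S'.clk r ≤ B := by
  obtain ⟨N, -, h⟩ := h
  rcases h.clk with ⟨-, e⟩ | ⟨-, -, -, e⟩
  · rw [e, tick]
    split_ifs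
    · exact hB r
    · exact (Nat.sub_le _ _).trans (hS r)
  · rw [e]
    exact (Nat.sub_le _ _).trans (hS r)

section Size

variable (I)

theorem length_encodeBinary (x : ℕ) : (encodeBinary x).length = 2 * x.bits.length + 1 := by
  simp [encodeBinary, List.length_flatMap]
  ring

theorem n_le_length_encode : I.n ≤ I.encode.length := by
  simp only [encode, encodeUnary, List.length_append, List.length_replicate]
  omega

theorem m_le_length_encode : I.m ≤ I.encode.length := by
  simp only [encode, encodeUnary, List.length_append, List.length_replicate]
  omega

/-- The digits of each reload time occur in the encoding. Clocks never exceed the reload times, so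
`2 ^ I.encode.length` can serve as the bound `B` on clocks and on durations of macro steps. -/
theorem c_lt_two_pow (r : I.R) : I.c r < 2 ^ I.encode.length := by
  classical
  rw [← Nat.size_le, ← Nat.size_eq_bits_len]
  have h1 : (true :: encodeBinary (I.c r)).length ≤ ((List.finRange I.n).flatMap fun v =>
      if h : v ∈ I.R then true :: encodeBinary (I.c ⟨v, h⟩) else [false]).length := by
    refine (List.sublist_flatten_of_mem (List.mem_map.2 ⟨r.1, List.mem_finRange _, ?_⟩)).length_le
    rw [dif_pos r.2]
  rw [List.length_cons, length_encodeBinary] at h1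
  rw [encode, List.length_append]
  exact le_trans (by omega) (h1.trans (Nat.le_add_left _ _))

theorem sz_ofFn_le {α : Type} [Coded α] {n E N : ℕ} (hn : n ≤ E) (f : Fin n → α)
    (h : ∀ i, sz (f i) ≤ N) : sz (List.ofFn f) ≤ E * (N + 1) + 1 := by
  refine (sz_list_le _ N fun a ha => ?_).trans ?_
  · obtain ⟨i, rfl⟩ := List.mem_ofFn.1 ha
    exact h i
  · rw [List.length_ofFn]
    gcongr

theorem sz_data_le {E : ℕ} (hE : E = I.encode.length) :
    sz I.data ≤ 8 * E ^ 2 + 14 * E + 12 := by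
  have hn := I.n_le_length_encode
  have hm := I.m_le_length_encode
  have hc := I.c_lt_two_pow
  rw [← hE] at hn hm hc
  have hk := I.k_le
  have hs := I.s.2
  have ht := I.t.2
  classical
  have h1 := sz_ofFn_le hn (fun u => List.ofFn fun v => decide (I.G.Adj u v))
    fun u => sz_ofFn_le hn _ fun v => sz_bool_le _
  have h2 := sz_ofFn_le hn (fun v => if h : v ∈ I.R then (I.c ⟨v, h⟩).bits else [])
    (N := 4 * E + 1) fun v => by
      split_ifs
      · exact sz_bits_le (hc _)
      · simp
  have e : sz I.data = 2 * I.n + 1 + (2 * I.m + 1 + (2 * I.k + 1 + (2 * I.s + 1 + (2 * I.t + 1 +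
      (sz (List.ofFn fun u => List.ofFn fun v => decide (I.G.Adj u v)) +
      sz (List.ofFn fun v => if h : v ∈ I.R then (I.c ⟨v, h⟩).bits else []) + 1) + 1) + 1) + 1) + 1)
      + 1 := by
    unfold data
    simp only [sz_prod, sz_nat]
  rw [e]
  nlinarith

variable {I}

theorem sz_snapshot_le {E N : ℕ} (hE : E = I.encode.length) (hN : N ≤ 2 ^ E)
    (hS : ∀ r, S.clk r ≤ 2 ^ E) : sz (snapshot N S) ≤ 6 * E ^ 2 + 12 * E + 9 := by
  have hn := I.n_le_length_encode
  have hm := I.m_le_length_encode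
  rw [← hE] at hn hm
  have hlt : 2 ^ E < 2 ^ (E + 1) := Nat.pow_lt_pow_right (by omega) (by omega)
  classical
  have h0 := sz_bits_le (hN.trans_lt hlt)
  have h1 := sz_ofFn_le hm (fun a => locCode (S.pos a)) (N := 2 * E + 1) fun a => by
    rw [sz_nat]
    cases S.pos a with
    | none => simpa using hn
    | some v =>
      have := v.2
      rw [locCode_some]
      omega
  have h2 := sz_ofFn_le hn (fun v => if h : v ∈ I.R then (S.clk ⟨v, h⟩).bits else [])
    (N := 4 * (E + 1) + 1) fun v => by
      split_ifs
      · exact sz_bits_le ((hS _).trans_lt hlt)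
      · simp
  have e : sz (snapshot N S) = sz N.bits + (sz (List.ofFn fun a => locCode (S.pos a)) +
      sz (List.ofFn fun v => if h : v ∈ I.R then (S.clk ⟨v, h⟩).bits else []) + 1) + 1 := rfl
  rw [e]
  nlinarith

end Size

/-- A bound on the size of certificates. -/
def certificateBound : Polynomial ℕ :=
  8 * .X ^ 2 + 14 * .X + 12 + ((7 * .X + 1) * (3 * .X ^ 2 + 3) + 1) * (6 * .X ^ 2 + 12 * .X + 10) + 2

theorem verify_complete (h : I.IsYesWith b) :
    ∃ c : Data × List Snapshot, sz c ≤ certificateBound.eval I.encode.length ∧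
      verify b (I.encode, c) = true := by
  obtain ⟨ρ, hv, ht, ha⟩ := h
  obtain ⟨F, hw, hF⟩ := exists_walk_of_plan hv ht ha
  obtain ⟨E, hE⟩ : ∃ E, E = I.encode.length := ⟨_, rfl⟩
  have hc : ∀ r, I.c r ≤ 2 ^ E := fun r => hE ▸ (I.c_lt_two_pow r).le
  obtain ⟨L, hL, F, hm, hF⟩ := exists_short_walk Nat.one_le_two_pow hc hw hF
  obtain ⟨f, h0, hfL, hf⟩ := hm.exists_seq
  have hclk : ∀ i ≤ L, ∀ r, (f i).clk r ≤ 2 ^ E := by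
    intro i
    induction i with
    | zero =>
      intro _ r
      rw [h0]
      exact Nat.zero_le _
    | succ i ih => exact fun hi => (hf i hi).clk_le hc (ih (by omega))
  choose! N hN hf using hf
  -- A snapshot stores the duration of the macro step that leads to it, so durations are shifted by
  -- one; the value 0 at the first snapshot is a dummy.
  obtain ⟨N', hN', hf'⟩ : ∃ N' : ℕ → ℕ, (∀ i ≤ L, N' i ≤ 2 ^ E) ∧
      ∀ i < L, Macro (b = true) (N' (i + 1)) (f i) (f (i + 1)) := by
    refine ⟨fun i => i.casesOn 0 N, fun i hi => ?_, hf⟩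
    cases i with
    | zero => exact Nat.zero_le _
    | succ i => exact hN i hi
  have hD := I.represents_data
  have hget : ∀ i ≤ L, ((List.range (L + 1)).map fun i => snapshot (N' i) (f i)).getD i
      ([], [], []) = snapshot (N' i) (f i) := by
    intro i hi
    simp [List.getD_eq_getElem?_getD, List.getElem?_range (show i < L + 1 by omega)]
  have hlen : ((List.range (L + 1)).map fun i => snapshot (N' i) (f i)).length - 1 = L := by simp
  refine ⟨(I.data, (List.range (L + 1)).map fun i => snapshot (N' i) (f i)), ?_, ?_⟩
  · have h1 := I.sz_data_le hE
    have h2 := sz_list_le ((List.range (L + 1)).map fun i => snapshot (N' i) (f i))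
      (6 * E ^ 2 + 12 * E + 9) fun σ hσ => by
        obtain ⟨i, hi, rfl⟩ := List.mem_map.1 hσ
        have hi : i ≤ L := by
          have := List.mem_range.1 hi
          omega
        exact sz_snapshot_le hE (hN' i hi) (hclk i hi)
    have hn := I.n_le_length_encode
    have hm := I.m_le_length_encode
    rw [← hE] at hn hm
    -- Vertices and assets are listed in unary, so `m` and `n` are at most `E`, and `6 * m + n` is
    -- at most `7 * E`.
    have h3 : L ≤ (7 * E + 1) * (3 * E ^ 2 + 3) := hL.trans (by gcongr; omega)
    have h4 : (L + 1) * (6 * E ^ 2 + 12 * E + 9 + 1) ≤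
        ((7 * E + 1) * (3 * E ^ 2 + 3) + 1) * (6 * E ^ 2 + 12 * E + 10) := by gcongr
    rw [List.length_map, List.length_range] at h2
    rw [← hE]
    refine (sz_prod _).trans_le ?_
    simp only [certificateBound, Polynomial.eval_add, Polynomial.eval_mul,
      Polynomial.eval_pow, Polynomial.eval_X, Polynomial.eval_ofNat, Polynomial.eval_one]
    linarith
  · simp only [verify, hlen, Bool.and_eq_true, decide_eq_true_eq, List.all_eq_true, List.mem_range]
    refine ⟨⟨⟨⟨hD.word_eq, wellFormed_data⟩, ?_⟩, fun i hi => ?_⟩, ?_⟩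
    · rw [hget 0 (Nat.zero_le _)]
      exact (hD.initCheck_iff (shows_snapshot _ _)).2 h0
    · rw [hget i hi.le, hget (i + 1) hi]
      refine (hD.macroCheck_iff (shows_snapshot _ _) (shows_snapshot _ _)).2 ?_
      have e : bitsVal (snapshot (N' (i + 1)) (f (i + 1))).1 = N' (i + 1) := bitsVal_bits _
      rw [e]
      exact hf' i hi
    · rw [hget L le_rfl, hfL]
      exact (hD.finalCheck_iff (shows_snapshot _ _)).2 hF

theorem mem_NP_of_iff {L : Language Bool} (b : Bool)
    (hL : ∀ x, x ∈ L ↔ ∃ I : RoutingInstance, I.encode = x ∧ I.IsYesWith b) : L ∈ NP := by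
  refine mem_NP (ptime_verify b) certificateBound (fun x c h => (hL x).2 (verify_sound h)) ?_
  intro x hx
  obtain ⟨I, rfl, h⟩ := (hL x).1 hx
  exact verify_complete h

end RoutingInstance

theorem mainTheorem3 : RoutingPlan ∈ NP ∧ RoutingPlanTrapsOnly ∈ NP :=
  -- With the flag `false` the condition on eliminations is vacuous, so both variants are instances
  -- of one statement.
  ⟨RoutingInstance.mem_NP_of_iff false fun _ => exists_congr fun _ => and_congr_right fun _ =>
    exists_congr fun _ => by simp,
  RoutingInstance.mem_NP_of_iff true fun _ => exists_congr fun _ => and_congr_right fun _ =>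
    exists_congr fun _ => by simp⟩

end
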